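/- Setting. Let $U,V$ be infinite-dimensional real separable Hilbert spaces and let $\mu_1,\mu_2$ be centered non-degenerate Gaussian measures on $U,V$ with covariance operators $Q_1,Q_2$, orthonormal eigenbases $(d_i)_{i\in\mathbb N}$, $(e_i)_{i\in\mathbb N}$ and positive decreasing eigenvalues $(\lambda_{1,i})$, $(\lambda_{2,i})$. Put $U_n=\mathrm{span}\{d_1,\dots,d_n\}$, $V_n=\mathrm{span}\{e_1,\dots,e_n\}$, and let $\mathcal FC_b^\infty$ be the set of functions $u\mapsto\varphi((u,d_1),\dots,(u,d_n))$ with $n\in\mathbb N$ and $\varphi\in C_b^\infty(\mathbb R^n)$. Let $K_{12}\in\mathcal L(U;V)$ and $K_{21}=K_{12}^*$ be such that $K_{21}K_{12}$ is positive definite (i.e. $(K_{21}K_{12}u,u)>0$ for $u\neq0$), and suppose there is a strictly increasing sequence $(m_k)$ in $\mathbb N$ with $K_{12}(U_n)\subseteq V_{m_k}$ and $K_{21}(V_n)\subseteq U_{m_k}$ whenever $n\le m_k$. Let $C=K_{21}Q_2^{-1}K_{12}$ with $D(C)=\{u: K_{12}u\in Q_2(V)\}$. For $F$ such that $FD:\mathcal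 FC_b^\infty\to L^2(U;\mu_1;U)$ is closable, $W^{1,2}_F(U;\mu_1)$ denotes the domain of the closure of $FD$ in $L^2(U;\mu_1)$, and this closure is again written $FD$. Let $\Phi:U\to(-\infty,\infty]$ be measurable, bounded from below and in $W^{1,2}_{Q_1^\alpha}(U;\mu_1)$ for some $\alpha\in[0,\infty)$; put $\partial_i\Phi=\lambda_{1,i}^{-\alpha}(Q_1^\alpha D\Phi,d_i)$ and $\mu_1^\Phi=\big(\int_U e^{-\Phi}d\mu_1\big)^{-1}e^{-\Phi}\mu_1$. For $f\in\mathcal FC_b^\infty$ let $$Nf(u)=\mathrm{tr}[CD^2f(u)]-(u,Q_1^{-1}CDf(u))_U,\qquad N^\Phi f=Nf-(D\Phi,CDf)_U,$$ where $(D\Phi,CDf)_U=\sum_i\partial_i\Phi\,(d_i,CDf)_U$ is a finite sum. Theorem. The operators $(N,\mathcal FC_b^\infty)$ on $L^2(U;\mu_1)$ and $(N^\Phi,\mathcal FC_b^\infty)$ on $L^2(U;\mu_1^\Phi)$ are well defined, $N$ is closable, and $$(N^\Phi f,g)_{L^2(U;\mu_1^\Phi)}=\int_U-(CDf,Dg)_U\,d\mu_1^\Phi\qquad\text{for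 all } f,g\in\mathcal FC_b^\infty .$$ Assume moreover that one of the following holds: (i) $\Phi\in W^{1,2}_{Q_1^{1/2}}(U;\mu_1)$ and $\|Q_1^{1/2}D\Phi\|_{L^\infty(\mu_1)}<\frac12$; (ii) $C$ is bounded, i.e. extends to an operator in $\mathcal L(U)$ (again denoted $C$, with positive square root $C^{1/2}$), $\Phi\in W^{1,2}_{C^{1/2}}(U;\mu_1)$ and $\|C^{1/2}D\Phi\|_{L^\infty(\mu_1)}<\infty$. Then $(N^\Phi,\mathcal FC_b^\infty)$ is essentially self-adjoint on $L^2(U;\mu_1^\Phi)$. Denoting the closures of $N$ in $L^2(U;\mu_1)$ and of $N^\Phi$ in $L^2(U;\mu_1^\Phi)$ by $(N,D(N))$ and $(N^\Phi,D(N^\Phi))$, one has $D(N)\subseteq D(N^\Phi)$ and $$N^\Phi f=Nf-(D\Phi,CDf)_U\in L^2(U;\mu_1^\Phi)\qquad\text{for all } f\in D(N),$$ where $(D\Phi,CDf)_U$ stands for $(Q_1^{1/2}D\Phi,Q_1^{-1/2}CDf)_U$ with $f\in W^{1,2}_{Q_1^{-1/2}C}(U;\mu_1)$ in case (i), and for $(C^{1/2}D\Phi,C^{1/2}Df)_U$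 with $f\in W^{1,2}_{C^{1/2}}(U;\mu_1)$ in case (ii). Furthermore, for every $\lambda\in(0,\infty)$ the resolvent $(\lambda-N^\Phi)^{-1}$ of the closure exists as a bounded operator on $L^2(U;\mu_1^\Phi)$. -/

import Mathlib

open MeasureTheory ProbabilityTheory Filter Topology
open scoped ENNReal ContDiff RealInnerProductSpace

noncomputable section

namespace OUPerturbation

section Gaussian

variable {H : Type*} [NormedAddCommGroup H] [InnerProductSpace ℝ H] [CompleteSpace H]
  [MeasurableSpace H] [BorelSpace H]

/-- `μ` is a centered non-degenerate Gaussian measure on `H`, the orthonormal basis `d` consists of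
eigenvectors of its covariance operator, and `lam` are the corresponding (positive, decreasing)
eigenvalues. -/
structure IsNondegenerateGaussian (μ : Measure H) (d : HilbertBasis ℕ ℝ H) (lam : ℕ → ℝ) :
    Prop where
  isGaussian : IsGaussian μ
  centered : ∫ x, x ∂μ = 0
  eigen : ∀ i, covarianceOperator μ (d i) = lam i • d i
  pos : ∀ i, 0 < lam i
  antitone : Antitone lam

/-- The inverse of the covariance operator of `μ`, with domain the range of that operator. -/
def covInv (μ : Measure H) : H →ₗ.[ℝ] H :=
  ((covarianceOperator μ).toLinearMap.toPMap ⊤).inverse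

end Gaussian

section Basis

variable {H : Type*} [NormedAddCommGroup H] [InnerProductSpace ℝ H]

/-- The span of the first `n` basis vectors. -/
def firstSpan (d : HilbertBasis ℕ ℝ H) (n : ℕ) : Submodule ℝ H :=
  Submodule.span ℝ ((fun i => d i) '' Set.Iio n)

/-- The real power `Q ^ θ` of the operator with `Q (d i) = lam i • d i`; on the span of the basis
vectors the sum is finite. -/
def diagPow (d : HilbertBasis ℕ ℝ H) (lam : ℕ → ℝ) (θ : ℝ) (x : H) : H :=
  ∑' i, (lam i ^ θ * ⟪d i, x⟫) • d i

/-- The coordinate map `x ↦ ((x, d 0), …, (x, d (n - 1)))`. -/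
def coords (d : HilbertBasis ℕ ℝ H) (n : ℕ) (x : H) : EuclideanSpace ℝ (Fin n) :=
  WithLp.toLp 2 fun i => ⟪x, d i⟫

/-- The smooth cylinder functions `φ ∘ coords d n`, where `φ` is smooth and bounded with bounded
derivatives of all orders. -/
def cylinder (d : HilbertBasis ℕ ℝ H) : Set (H → ℝ) :=
  {f | ∃ (n : ℕ) (φ : EuclideanSpace ℝ (Fin n) → ℝ), ContDiff ℝ ∞ φ ∧
    (∀ k : ℕ, ∃ M : ℝ, ∀ y, ‖iteratedFDeriv ℝ k φ y‖ ≤ M) ∧ f = φ ∘ coords d n}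

end Basis

/-- The value of a partially defined operator (and `0` outside of its domain). -/
def pval {E F : Type*} [AddCommGroup E] [Module ℝ E] [AddCommGroup F] [Module ℝ F]
    (T : E →ₗ.[ℝ] F) (x : E) : F :=
  open Classical in if h : x ∈ T.domain then T ⟨x, h⟩ else 0

section Coefficient

variable {U V : Type*} [NormedAddCommGroup U] [InnerProductSpace ℝ U] [CompleteSpace U]
  [NormedAddCommGroup V] [InnerProductSpace ℝ V] [CompleteSpace V]

/-- The invariance properties of `K₁₂` and `K₂₁ = K₁₂*` along the strictly increasing sequence
`m`. -/
structure IsBlockInvariant (K₁₂ : U →L[ℝ] V) (d : HilbertBasis ℕ ℝ U) (e : HilbertBasis ℕ ℝ V)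
    (m : ℕ → ℕ) : Prop where
  strictMono : StrictMono m
  map_fst : ∀ k n, n ≤ m k → ∀ u ∈ firstSpan d n, K₁₂ u ∈ firstSpan e (m k)
  map_snd : ∀ k n, n ≤ m k → ∀ v ∈ firstSpan e n,
    ContinuousLinearMap.adjoint K₁₂ v ∈ firstSpan d (m k)

/-- The operator `C = K₂₁ Q₂⁻¹ K₁₂` with domain `{u | K₁₂ u ∈ D(Q₂⁻¹)}`, where `K₂₁ = K₁₂*` and
`Q₂` is the covariance operator of `μ₂`. -/
def opC [MeasurableSpace V] [BorelSpace V] (μ₂ : Measure V) (K₁₂ : U →L[ℝ] V) : U →ₗ.[ℝ] U where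
  domain := (covInv μ₂).domain.comap K₁₂.toLinearMap
  toFun := (ContinuousLinearMap.adjoint K₁₂).toLinearMap ∘ₗ (covInv μ₂).toFun ∘ₗ
    K₁₂.toLinearMap.restrict (fun _ hx => hx)

end Coefficient

section Operators

variable {U : Type*} [NormedAddCommGroup U] [InnerProductSpace ℝ U] [CompleteSpace U]
  [MeasurableSpace U] [BorelSpace U]

/-- The differential expression `N f (u) = tr[C D²f(u)] - (u, Q₁⁻¹ C Df(u))`. The trace is computed
in the basis `d`. -/
def opN (μ₁ : Measure U) (d : HilbertBasis ℕ ℝ U) (C : U →ₗ.[ℝ] U) (f : U → ℝ) (u : U) : ℝ :=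
  (∑' i, ⟪pval C (fderiv ℝ (gradient f) u (d i)), d i⟫)
    - ⟪u, pval (covInv μ₁) (pval C (gradient f u))⟫

/-- The pairing `(DΦ(u), h) = ∑ᵢ ∂ᵢΦ(u) (d i, h)` for `h` in the span of the basis vectors, where
`G = Q₁ ^ α DΦ` and `∂ᵢΦ = lam i ^ (-α) (Q₁ ^ α DΦ, d i)`. -/
def gradPairing (d : HilbertBasis ℕ ℝ U) (lam : ℕ → ℝ) (α : ℝ) (G : U → U) (u h : U) : ℝ :=
  ∑' i, (lam i ^ (-α) * ⟪G u, d i⟫) * ⟪d i, h⟫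

/-- The differential expression `N^Φ f = N f - (DΦ, C Df)`, where `G = Q₁ ^ α DΦ`. -/
def opNPhi (μ₁ : Measure U) (d : HilbertBasis ℕ ℝ U) (lam : ℕ → ℝ) (C : U →ₗ.[ℝ] U) (α : ℝ)
    (G : U → U) (f : U → ℝ) (u : U) : ℝ :=
  opN μ₁ d C f u - gradPairing d lam α G u (pval C (gradient f u))

/-- `f` lies in the Sobolev space `W^{1,2}_F(U; μ)`, the domain of the closure of
`F D : cylinder d → L²(U; μ; U)`, and `G` is (a representative of) the value at `f` of this closure:
`f = lim fₙ` in `L²` and `G = lim F Dfₙ` in `L²` for cylinder functions `fₙ`. -/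
def IsSobolevGradient (μ : Measure U) (d : HilbertBasis ℕ ℝ U) (F : U → U) (f : U → ℝ)
    (G : U → U) : Prop :=
  MemLp f 2 μ ∧ MemLp G 2 μ ∧ ∃ fn : ℕ → U → ℝ, (∀ n, fn n ∈ cylinder d) ∧
    (∀ n, MemLp (fun u => F (gradient (fn n) u)) 2 μ) ∧
    Tendsto (fun n => eLpNorm (fun u => fn n u - f u) 2 μ) atTop (𝓝 0) ∧
    Tendsto (fun n => eLpNorm (fun u => F (gradient (fn n) u) - G u) 2 μ) atTop (𝓝 0)

/-- The version of `IsSobolevGradient` for extended-real-valued potentials, which have to be finite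
almost everywhere. -/
def IsPotentialGradient (μ : Measure U) (d : HilbertBasis ℕ ℝ U) (F : U → U) (Φ : U → EReal)
    (G : U → U) : Prop :=
  (∀ᵐ u ∂μ, Φ u ≠ ⊤) ∧ IsSobolevGradient μ d F (fun u => (Φ u).toReal) G

/-- The probability measure `(∫ e^{-Φ} dμ)⁻¹ e^{-Φ} μ`. -/
def gibbs (μ : Measure U) (Φ : U → EReal) : Measure U :=
  (∫⁻ u, EReal.exp (-Φ u) ∂μ)⁻¹ • μ.withDensity fun u => EReal.exp (-Φ u)

/-- `T` is the operator in `L²(μ)` with domain (the classes of) the cylinder functions that acts as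
the differential expression `A`. -/
def IsRealization (μ : Measure U) (d : HilbertBasis ℕ ℝ U) (A : (U → ℝ) → U → ℝ)
    (T : Lp ℝ 2 μ →ₗ.[ℝ] Lp ℝ 2 μ) : Prop :=
  (∀ f ∈ cylinder d, MemLp f 2 μ ∧ MemLp (A f) 2 μ) ∧
    (T.graph : Set (Lp ℝ 2 μ × Lp ℝ 2 μ)) = {p | ∃ f ∈ cylinder d, p.1 =ᵐ[μ] f ∧ p.2 =ᵐ[μ] A f}

/-- `D(N) ⊆ D(N^Φ)` (for the closures) and `N^Φ f = N f - (DΦ, C Df)` on `D(N)`. Here `(DΦ, C Df)`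
is the scalar product of `G`, a weighted gradient of `Φ`, and the value at `f` of the closure
of `F D`. -/
def DomainInclusion {μ μΦ : Measure U} (d : HilbertBasis ℕ ℝ U) (F G : U → U)
    (N : Lp ℝ 2 μ →ₗ.[ℝ] Lp ℝ 2 μ) (NΦ : Lp ℝ 2 μΦ →ₗ.[ℝ] Lp ℝ 2 μΦ) : Prop :=
  ∀ f : N.closure.domain,
    (∃ h : U → U, IsSobolevGradient μ d F (f : Lp ℝ 2 μ) h) ∧
    ∀ h : U → U, IsSobolevGradient μ d F (f : Lp ℝ 2 μ) h →
      ∃ g : NΦ.closure.domain, (g : Lp ℝ 2 μΦ) =ᵐ[μΦ] (f : Lp ℝ 2 μ) ∧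
        NΦ.closure g =ᵐ[μΦ] fun u => N.closure f u - ⟪G u, h u⟫

end Operators

section HilbertSpace

variable {E : Type*} [NormedAddCommGroup E] [InnerProductSpace ℝ E] [CompleteSpace E]

/-- A densely defined closable operator with self-adjoint closure. -/
def IsEssentiallySelfAdjoint (T : E →ₗ.[ℝ] E) : Prop :=
  Dense (T.domain : Set E) ∧ T.IsClosable ∧ IsSelfAdjoint T.closure

/-- `R` is the resolvent `(l - T)⁻¹`. -/
def IsResolventAt (T : E →ₗ.[ℝ] E) (l : ℝ) (R : E →L[ℝ] E) : Prop :=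
  (∀ x : T.domain, R (l • (x : E) - T x) = x) ∧
    ∀ y : E, ∃ x : T.domain, (x : E) = R y ∧ l • (x : E) - T x = y

end HilbertSpace

end OUPerturbation

end

/-! A densely defined symmetric dissipative operator `T` is essentially self-adjoint once `l - T`
has dense range for a single `l > 0`, and its closure then has a resolvent at every positive number
(`essentiallySelfAdjoint_of_dense_range`). Everything therefore reduces to integration by parts and
one density statement.

Let `L_j` (`ld`) be minus the formal adjoint of `∂_j` in `L²(μ₁)`. Both operators have the form `f ↦
∑_j (L_j - P_j)(C Df)_j`, with `P = 0` for `N` and `P_j = ∂_jΦ` for `N^Φ`. The weight `e^{-Φ}` makes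
`L_j - P_j` minus the formal adjoint of `∂_j` in `L²(μ₁^Φ)` (`exists_isWeight_gibbs`), so one
argument for weighted measures gives the integration by parts formula, symmetry, dissipativity and
well-definedness in both cases. The invariance of `U_{m_k}` and `V_{m_k}` makes `C` a positive
semidefinite matrix on each `U_{m_k}` (`isBlockOperator_opC`), so every computation with a given
cylinder function is finite-dimensional.

For `N` the resolvent equation is solved explicitly. The Ornstein-Uhlenbeck semigroup maps a plane
wave with wave vector `h` to a damped plane wave with wave vector `X t`, where `X' = -Q₁⁻¹ C X` and
`X 0 = h`. The Laplace transform in `t` of these waves is a cylinder function solving `(l - N) f =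
cos(⟪h, u⟫ + θ)` (`exists_resolvent_wave`). Plane waves with wave vectors in a dense set separate
integrable functions, so the range of `l - N` is dense (`dense_range_opN`).

The drift is then a relatively bounded perturbation: `N^Φ f = N f - ⟪G, F Df⟫` with `‖G‖ ≤ γ` a.e.
and `‖F Df‖² ≤ β ‖(l - N) f‖²` in `L²(μ₁)`, where `γ² β < 1`. If `v` is orthogonal to the range of
`l - N^Φ` in `L²(μ₁^Φ)`, then `v` times the density is orthogonal in `L²(μ₁)` to a small
perturbation of the dense range of `l - N`, hence zero (`dense_range_of_perturbation`). The same
estimate makes `F D` continuous for the graph norm of `N`, which yields the inclusion of domains.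

In case (i), `F = Q₁^{-1/2} C`, and the estimate is the second-order bound `∫ ‖Q₁^{-1/2} C Df‖² ≤ ∫
(N f)²`: commuting derivatives with their adjoints leaves as remainder the integral of `tr[(C
D²f)²]`, which is nonnegative (`integral_sq_flux_le`). In case (ii), `F = C^{1/2}`, and the form
identity `∫ ‖C^{1/2} Df‖² = -∫ f N f` gives a relative bound that shrinks as `l` grows. Weak
derivatives (`IsWeakDeriv`) identify the differently weighted gradients of `Φ` with one another. -/

noncomputable section

set_option linter.unusedSectionVars false

namespace OUPerturbation

/-! ### Symmetric dissipative operators and their resolvents -/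

section Dissipative

variable {E : Type*} [NormedAddCommGroup E] [InnerProductSpace ℝ E]

/-- An approximating sequence for a point of the graph of the closure. -/
theorem exists_seq_of_mem_closure_graph {T : E →ₗ.[ℝ] E} (hT : T.IsClosable) (x : T.closure.domain) :
    ∃ s : ℕ → T.domain, Tendsto (fun n => (s n : E)) atTop (𝓝 (x : E)) ∧
      Tendsto (fun n => T (s n)) atTop (𝓝 (T.closure x)) := by
  have hx : ((x : E), T.closure x) ∈ T.graph.topologicalClosure := by
    rw [hT.graph_closure_eq_closure_graph]; exact T.closure.mem_graph x
  rw [← SetLike.mem_coe, Submodule.topologicalClosure_coe, mem_closure_iff_seq_limit] at hx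
  obtain ⟨p, hp, hlim⟩ := hx
  have hp' : ∀ n, ∃ y : T.domain, (y : E) = (p n).1 ∧ T y = (p n).2 := fun n =>
    (T.mem_graph_iff).1 (hp n)
  choose y hy1 hy2 using hp'
  rw [Prod.tendsto_iff] at hlim
  exact ⟨y, by simpa only [hy1] using hlim.1, by simpa only [hy2] using hlim.2⟩

/-- Limits of points of the graph lie in the graph of the closure. -/
theorem mem_closure_graph_of_seq {T : E →ₗ.[ℝ] E} (hT : T.IsClosable) {s : ℕ → T.domain} {x y : E}
    (hx : Tendsto (fun n => (s n : E)) atTop (𝓝 x)) (hy : Tendsto (fun n => T (s n)) atTop (𝓝 y)) :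
    ∃ z : T.closure.domain, (z : E) = x ∧ T.closure z = y := by
  have : (x, y) ∈ T.graph.topologicalClosure := by
    rw [← SetLike.mem_coe, Submodule.topologicalClosure_coe, mem_closure_iff_seq_limit]
    exact ⟨fun n => ((s n : E), T (s n)), fun n => T.mem_graph _, hx.prodMk_nhds hy⟩
  rw [hT.graph_closure_eq_closure_graph] at this
  exact (LinearPMap.mem_graph_iff _).1 this

/-- Cauchy-Schwarz applied to `⟪(l - A) x, x⟫ ≥ l ‖x‖²`. This yields closed range, injectivity and
the bound `l⁻¹` on the resolvent. -/
theorem norm_le_of_dissipative {A : E →ₗ.[ℝ] E} (hdis : ∀ x : A.domain, ⟪A x, x⟫ ≤ 0) {l : ℝ}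
    (x : A.domain) : l * ‖(x : E)‖ ≤ ‖l • (x : E) - A x‖ := by
  have h1 : l * ‖(x : E)‖ ^ 2 ≤ ‖l • (x : E) - A x‖ * ‖(x : E)‖ := by
    refine le_trans ?_ (real_inner_le_norm _ _)
    rw [inner_sub_left, real_inner_smul_left, real_inner_self_eq_norm_sq]
    linarith [hdis x]
  rcases eq_or_lt_of_le (norm_nonneg (x : E)) with h0 | h0
  · rw [← h0]; simp
  · nlinarith

theorem closure_symmetric {T : E →ₗ.[ℝ] E} (hT : T.IsClosable)
    (hsym : ∀ x y : T.domain, ⟪T x, y⟫ = ⟪(x : E), T y⟫) (x y : T.closure.domain) :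
    ⟪T.closure x, y⟫ = ⟪(x : E), T.closure y⟫ := by
  obtain ⟨s, hs1, hs2⟩ := exists_seq_of_mem_closure_graph hT x
  obtain ⟨t, ht1, ht2⟩ := exists_seq_of_mem_closure_graph hT y
  refine tendsto_nhds_unique (hs2.inner ht1) ?_
  simpa only [hsym] using hs1.inner ht2

theorem closure_dissipative {T : E →ₗ.[ℝ] E} (hT : T.IsClosable)
    (hdis : ∀ x : T.domain, ⟪T x, x⟫ ≤ 0) (x : T.closure.domain) :
    ⟪T.closure x, x⟫ ≤ 0 := by
  obtain ⟨s, hs1, hs2⟩ := exists_seq_of_mem_closure_graph hT x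
  exact le_of_tendsto' (hs2.inner hs1) fun n => hdis (s n)

variable [CompleteSpace E]

/-- A densely defined symmetric operator is closable. -/
theorem isClosable_of_symmetric {T : E →ₗ.[ℝ] E} (hd : Dense (T.domain : Set E))
    (hsym : ∀ x y : T.domain, ⟪T x, y⟫ = ⟪(x : E), T y⟫) : T.IsClosable := by
  have h : T.IsFormalAdjoint T := fun x y => hsym x y
  exact (LinearPMap.adjoint_isClosed hd).isClosable.leIsClosable (h.le_adjoint hd)

/-- The range of `l - A` for a closed dissipative operator `A` is closed. -/
theorem surjective_of_dense_range {A : E →ₗ.[ℝ] E} (hA : A.IsClosed)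
    (hdis : ∀ x : A.domain, ⟪A x, x⟫ ≤ 0) {l : ℝ} (hl : 0 < l)
    (hr : Dense (Set.range fun x : A.domain => l • (x : E) - A x)) (y : E) :
    ∃ x : A.domain, l • (x : E) - A x = y := by
  obtain ⟨z, hz, hlim⟩ := mem_closure_iff_seq_limit.1 (hr y)
  choose s hs using hz
  -- By the lower bound for `l - A`, preimages of a Cauchy sequence are Cauchy.
  have hcau : CauchySeq fun n => (s n : E) := by
    rw [Metric.cauchySeq_iff']
    intro ε hε
    obtain ⟨N, hN⟩ := Metric.cauchySeq_iff'.1 hlim.cauchySeq (l * ε) (by positivity)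
    refine ⟨N, fun n hn => ?_⟩
    have h1 := norm_le_of_dissipative hdis (l := l) (s n - s N)
    have h2 := hN n hn
    rw [dist_eq_norm, ← hs, ← hs] at h2
    rw [A.map_sub] at h1
    have h3 : l • ((s n - s N : A.domain) : E) - (A (s n) - A (s N))
        = l • (s n : E) - A (s n) - (l • (s N : E) - A (s N)) := by
      simp [smul_sub]; abel
    rw [h3] at h1
    rw [dist_eq_norm]
    exact lt_of_mul_lt_mul_left (h1.trans_lt h2) hl.le
  obtain ⟨x, hx⟩ := cauchySeq_tendsto_of_complete hcau
  have hAx : Tendsto (fun n => A (s n)) atTop (𝓝 (l • x - y)) := by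
    have := (hx.const_smul l).sub hlim
    refine this.congr fun n => ?_
    rw [← hs]; exact sub_sub_cancel _ _
  have hmem : (x, l • x - y) ∈ A.graph :=
    _root_.IsClosed.mem_of_tendsto hA (hx.prodMk_nhds hAx) (Eventually.of_forall fun n => A.mem_graph _)
  obtain ⟨w, hw1, hw2⟩ := (LinearPMap.mem_graph_iff _).1 hmem
  exact ⟨w, by simp only at hw1 hw2; rw [hw1, hw2]; abel⟩

/-- A densely defined symmetric dissipative operator `T` such that `l₀ - T` has dense range for some
`l₀ > 0` is essentially self-adjoint, and its closure has a resolvent at all `l > 0`. -/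
theorem essentiallySelfAdjoint_of_dense_range {T : E →ₗ.[ℝ] E} (hd : Dense (T.domain : Set E))
    (hsym : ∀ x y : T.domain, ⟪T x, y⟫ = ⟪(x : E), T y⟫)
    (hdis : ∀ x : T.domain, ⟪T x, x⟫ ≤ 0) {l₀ : ℝ} (hl₀ : 0 < l₀)
    (hr : Dense (Set.range fun x : T.domain => l₀ • (x : E) - T x)) :
    IsEssentiallySelfAdjoint T ∧ ∀ l : ℝ, 0 < l → ∃ R, IsResolventAt T.closure l R := by
  have hT := isClosable_of_symmetric hd hsym
  set A := T.closure with hA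
  have hAc : A.IsClosed := hT.closure_isClosed
  have hAs : ∀ x y : A.domain, ⟪A x, y⟫ = ⟪(x : E), A y⟫ := closure_symmetric hT hsym
  have hAd : ∀ x : A.domain, ⟪A x, x⟫ ≤ 0 := closure_dissipative hT hdis
  have hle : T ≤ A := T.le_closure
  have hAdense : Dense (A.domain : Set E) := hd.mono hle.1
  have hr' : Dense (Set.range fun x : A.domain => l₀ • (x : E) - A x) := by
    refine hr.mono ?_
    rintro _ ⟨x, rfl⟩
    refine ⟨⟨x, hle.1 x.2⟩, ?_⟩
    have : T x = A ⟨x, hle.1 x.2⟩ := hle.2 rfl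
    simp [this]
  have hsurj := surjective_of_dense_range hAc hAd hl₀ hr'
  have hAle : A ≤ A.adjoint := LinearPMap.IsFormalAdjoint.le_adjoint hAdense fun x y => hAs x y
  -- For `y` in the adjoint domain, solve `(l₀ - A) z = l₀ y - A* y`. Then `y - z` is orthogonal to
  -- the range of `l₀ - A`, which is everything, so `y = z` lies in the domain of `A`.
  have hadj : A.adjoint ≤ A := by
    have key : ∀ y : A.adjoint.domain, ∃ z : A.domain, (z : E) = y ∧ A z = A.adjoint y := by
      intro y
      obtain ⟨z, hz⟩ := hsurj (l₀ • (y : E) - A.adjoint y)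
      have horth : ∀ x : A.domain, ⟪(y : E) - z, l₀ • (x : E) - A x⟫ = 0 := by
        intro x
        have h1 : ⟪A.adjoint y, x⟫ = ⟪(y : E), A x⟫ := A.adjoint_isFormalAdjoint hAdense y x
        have h2 := hAs z x
        have h3 := congrArg (fun w => ⟪w, (x : E)⟫) hz
        simp only [inner_sub_left, real_inner_smul_left] at h3
        simp only [inner_sub_left, inner_sub_right, real_inner_smul_right]
        linarith
      have hyz : (z : E) = y := by
        obtain ⟨x, hx⟩ := hsurj ((y : E) - z)
        have := horth x
        rw [hx, inner_self_eq_zero, sub_eq_zero] at this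
        exact this.symm
      refine ⟨z, hyz, ?_⟩
      rw [hyz] at hz
      exact sub_right_injective hz
    refine ⟨fun y hy => ?_, ?_⟩
    · obtain ⟨z, hz, -⟩ := key ⟨y, hy⟩
      rw [show y = z from hz.symm]; exact z.2
    · intro y x hxy
      obtain ⟨z, hz, hz2⟩ := key y
      have : z = x := Subtype.ext (hz.trans hxy)
      rw [← hz2, this]
  have hsa : A.adjoint = A := le_antisymm hadj hAle
  refine ⟨⟨hd, hT, LinearPMap.isSelfAdjoint_def.2 hsa⟩, fun l hl => ?_⟩
  -- For another `l > 0`, a vector `v` orthogonal to the range of `l - A` lies in the domain of `A*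
  -- = A` and satisfies `⟪A v, v⟫ = l ‖v‖²`, which contradicts dissipativity unless `v = 0`.
  have hrl : Dense (Set.range fun x : A.domain => l • (x : E) - A x) := by
    let M : A.domain →ₗ[ℝ] E := l • A.domain.subtype - A.toFun
    have hM : (Set.range fun x : A.domain => l • (x : E) - A x) = (LinearMap.range M : Set E) := by
      ext; simp [M]
    rw [hM, Submodule.dense_iff_topologicalClosure_eq_top,
      Submodule.topologicalClosure_eq_top_iff, Submodule.eq_bot_iff]
    intro v hv
    rw [Submodule.mem_orthogonal'] at hv
    have hv' : ∀ x : A.domain, ⟪v, l • (x : E) - A x⟫ = 0 := fun x => hv _ ⟨x, rfl⟩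
    have hex : ∀ x : A.domain, ⟪l • v, (x : E)⟫ = ⟪v, A x⟫ := fun x => by
      have := hv' x
      rw [inner_sub_right, real_inner_smul_right] at this
      rw [real_inner_smul_left]; linarith
    have hvd : v ∈ A.adjoint.domain := A.mem_adjoint_domain_of_exists v ⟨_, hex⟩
    have hvA : v ∈ A.domain := hadj.1 hvd
    have h1 := hv' ⟨v, hvA⟩
    have h2 := hAd ⟨v, hvA⟩
    rw [real_inner_comm] at h2
    simp only [inner_sub_right, real_inner_smul_right, real_inner_self_eq_norm_sq] at h1 h2
    have h3 : ‖v‖ ^ 2 ≤ 0 := by nlinarith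
    simpa using h3
  have hs := surjective_of_dense_range hAc hAd hl hrl
  choose r hrr using hs
  have hinj : ∀ x x' : A.domain, l • (x : E) - A x = l • (x' : E) - A x' → x = x' := by
    intro x x' h
    have h1 := norm_le_of_dissipative hAd (l := l) (x - x')
    have h2 : l • ((x - x' : A.domain) : E) - A (x - x') = 0 := by
      rw [A.map_sub, ← sub_eq_zero.2 h]; simp [smul_sub]; abel
    rw [h2, norm_zero] at h1
    have h3 : ‖((x - x' : A.domain) : E)‖ ≤ 0 := by nlinarith
    rw [norm_le_zero_iff] at h3
    simpa [sub_eq_zero] using h3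
  let R₀ : E →ₗ[ℝ] E :=
    { toFun := fun y => r y
      map_add' := fun y y' => by
        have : r (y + y') = r y + r y' := by
          apply hinj
          rw [hrr, A.map_add]
          nth_rewrite 1 [← hrr y, ← hrr y']
          simp [smul_add]; abel
        rw [this]; rfl
      map_smul' := fun a y => by
        have : r (a • y) = a • r y := by
          apply hinj
          rw [hrr, A.map_smul]
          nth_rewrite 1 [← hrr y]
          simp [smul_sub, smul_comm a l]
        rw [this]; rfl }
  refine ⟨R₀.mkContinuous l⁻¹ fun y => ?_, fun x => ?_, fun y => ⟨r y, rfl, hrr y⟩⟩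
  · have := norm_le_of_dissipative hAd (l := l) (r y)
    rw [hrr] at this
    change ‖(r y : E)‖ ≤ _
    rw [inv_mul_eq_div, le_div_iff₀ hl]; linarith
  · change (r _ : E) = x
    rw [hinj (r _) x (hrr _)]

end Dissipative

/-! ### Scalar products and convergence in `L²` -/

section LTwo

variable {X : Type*} [MeasurableSpace X] {μ : Measure X}

theorem inner_toLp_toLp {f g : X → ℝ} (hf : MemLp f 2 μ) (hg : MemLp g 2 μ) :
    ⟪hf.toLp f, hg.toLp g⟫ = ∫ x, f x * g x ∂μ := by
  rw [L2.inner_def]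
  refine integral_congr_ae ?_
  filter_upwards [hf.coeFn_toLp, hg.coeFn_toLp] with x h1 h2
  rw [h1, h2]; simp [mul_comm]

theorem inner_lp_eq_integral (f g : Lp ℝ 2 μ) : ⟪f, g⟫ = ∫ x, f x * g x ∂μ := by
  rw [L2.inner_def]
  simp [mul_comm]

theorem integrable_mul_of_memLp_two {f g : X → ℝ} (hf : MemLp f 2 μ) (hg : MemLp g 2 μ) :
    Integrable (fun x => f x * g x) μ := hf.integrable_mul hg

/-- The `L²` scalar product is continuous along sequences converging in `L²`. -/
theorem tendsto_integral_mul {f g : X → ℝ} {fn gn : ℕ → X → ℝ} (hf : MemLp f 2 μ)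
    (hg : MemLp g 2 μ) (hfn : ∀ n, MemLp (fn n) 2 μ) (hgn : ∀ n, MemLp (gn n) 2 μ)
    (h1 : Tendsto (fun n => eLpNorm (fun x => fn n x - f x) 2 μ) atTop (𝓝 0))
    (h2 : Tendsto (fun n => eLpNorm (fun x => gn n x - g x) 2 μ) atTop (𝓝 0)) :
    Tendsto (fun n => ∫ x, fn n x * gn n x ∂μ) atTop (𝓝 (∫ x, f x * g x ∂μ)) := by
  have h1' := (Lp.tendsto_Lp_iff_tendsto_eLpNorm'' fn hfn f hf).2 h1
  have h2' := (Lp.tendsto_Lp_iff_tendsto_eLpNorm'' gn hgn g hg).2 h2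
  have := h1'.inner (𝕜 := ℝ) h2'
  simpa only [inner_toLp_toLp] using this

theorem tendsto_integral_mul_const {f g : X → ℝ} {fn : ℕ → X → ℝ} (hf : MemLp f 2 μ)
    (hg : MemLp g 2 μ) (hfn : ∀ n, MemLp (fn n) 2 μ)
    (h1 : Tendsto (fun n => eLpNorm (fun x => fn n x - f x) 2 μ) atTop (𝓝 0)) :
    Tendsto (fun n => ∫ x, fn n x * g x ∂μ) atTop (𝓝 (∫ x, f x * g x ∂μ)) :=
  tendsto_integral_mul hf hg hfn (fun _ => hg) h1 (by simp)

theorem eLpNorm_tendsto_zero_of_le {E F : Type*} [NormedAddCommGroup E] [NormedAddCommGroup F]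
    {fn : ℕ → X → E} {gn : ℕ → X → F} {p : ℝ≥0∞}
    (c : ℝ) (h : ∀ n, ∀ᵐ x ∂μ, ‖fn n x‖ ≤ c * ‖gn n x‖)
    (hg : Tendsto (fun n => eLpNorm (gn n) p μ) atTop (𝓝 0)) :
    Tendsto (fun n => eLpNorm (fn n) p μ) atTop (𝓝 0) := by
  have h0 : Tendsto (fun n => ENNReal.ofReal c * eLpNorm (gn n) p μ) atTop (𝓝 0) := by
    have := ENNReal.Tendsto.const_mul hg (Or.inr (ENNReal.ofReal_ne_top (r := c)))
    simpa using this
  exact tendsto_of_tendsto_of_tendsto_of_le_of_le tendsto_const_nhds h0 (fun _ => zero_le)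
    fun n => eLpNorm_le_mul_eLpNorm_of_ae_le_mul (h n) p

end LTwo

/-! ### Plane waves separate integrable functions -/

section Trigonometric

variable {U : Type*} [NormedAddCommGroup U] [InnerProductSpace ℝ U] [CompleteSpace U]
  [SecondCountableTopology U] [MeasurableSpace U] [BorelSpace U]

theorem charFun_withDensity_ofReal {ν : Measure U} {g : U → ℝ} (hg : Integrable g ν) (h : U) :
    charFun (ν.withDensity fun u => ENNReal.ofReal (g u)) h =
      ∫ u, ((max (g u) 0 : ℝ) : ℂ) * Complex.exp (⟪u, h⟫ * Complex.I) ∂ν := by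
  rw [charFun_apply, integral_withDensity_eq_integral_toReal_smul₀ hg.1.aemeasurable.ennreal_ofReal
    (Eventually.of_forall fun _ => ENNReal.ofReal_lt_top)]
  refine integral_congr_ae (Eventually.of_forall fun u => ?_)
  simp [ENNReal.toReal_ofReal']

theorem integrable_mul_exp_inner {ν : Measure U} {g : U → ℝ} (hg : Integrable g ν) (h : U) :
    Integrable (fun u => (g u : ℂ) * Complex.exp (⟪u, h⟫ * Complex.I)) ν := by
  refine (hg.ofReal (𝕜 := ℂ)).mul_bdd (c := 1) ?_ (Eventually.of_forall fun u => ?_)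
  · have : Continuous fun u : U => Complex.exp (⟪u, h⟫ * Complex.I) := by fun_prop
    exact this.aestronglyMeasurable
  · rw [Complex.norm_exp_ofReal_mul_I]

/-- An integrable function whose Fourier transform vanishes on a dense set vanishes. -/
theorem ae_eq_zero_of_trigonometric {ν : Measure U} [IsFiniteMeasure ν] {g : U → ℝ}
    (hg : Integrable g ν) {S : Set U} (hS : Dense S)
    (hcos : ∀ h ∈ S, ∫ u, g u * Real.cos ⟪u, h⟫ ∂ν = 0)
    (hsin : ∀ h ∈ S, ∫ u, g u * Real.sin ⟪u, h⟫ ∂ν = 0) : g =ᵐ[ν] 0 := by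
  have hgn : Integrable (fun u => -g u) ν := hg.neg
  have hfin : ∀ f : U → ℝ, Integrable f ν →
      IsFiniteMeasure (ν.withDensity fun u => ENNReal.ofReal (f u)) := fun f hf =>
    isFiniteMeasure_withDensity_ofReal hf.2
  have := hfin g hg
  have := hfin _ hgn
  -- The positive and negative parts of `g` are densities of finite measures. Their characteristic
  -- functions agree on `S`, hence everywhere by continuity, so the two measures coincide.
  have heq : (ν.withDensity fun u => ENNReal.ofReal (g u))
      = ν.withDensity fun u => ENNReal.ofReal (-g u) := by
    refine Measure.ext_of_charFun ?_
    refine Continuous.ext_on hS (continuous_charFun) (continuous_charFun) fun h hh => ?_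
    rw [charFun_withDensity_ofReal hg, charFun_withDensity_ofReal hgn, ← sub_eq_zero,
      ← integral_sub (integrable_mul_exp_inner hg.pos_part h)
        (integrable_mul_exp_inner hgn.pos_part h)]
    have hi := integrable_mul_exp_inner hg h
    have hc : ∀ u, ((max (g u) 0 : ℝ) : ℂ) * Complex.exp (⟪u, h⟫ * Complex.I)
        - ((max (-g u) 0 : ℝ) : ℂ) * Complex.exp (⟪u, h⟫ * Complex.I)
        = (g u : ℂ) * Complex.exp (⟪u, h⟫ * Complex.I) := fun u => by
      rw [← sub_mul, ← Complex.ofReal_sub, max_zero_sub_max_neg_zero_eq_self]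
    simp_rw [hc]
    have hre : ∀ u, ((g u : ℂ) * Complex.exp (⟪u, h⟫ * Complex.I)).re = g u * Real.cos ⟪u, h⟫ :=
      fun u => by simp [Complex.exp_ofReal_mul_I_re]
    have him : ∀ u, ((g u : ℂ) * Complex.exp (⟪u, h⟫ * Complex.I)).im = g u * Real.sin ⟪u, h⟫ :=
      fun u => by simp [Complex.exp_ofReal_mul_I_im]
    apply Complex.ext
    · rw [← RCLike.re_eq_complex_re, ← integral_re hi]
      simpa only [RCLike.re_eq_complex_re, hre, Complex.zero_re] using hcos h hh
    · rw [← RCLike.im_eq_complex_im, ← integral_im hi]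
      simpa only [RCLike.im_eq_complex_im, him, Complex.zero_im] using hsin h hh
  rw [withDensity_eq_iff hg.1.aemeasurable.ennreal_ofReal hgn.1.aemeasurable.ennreal_ofReal] at heq
  · filter_upwards [heq] with u hu
    have := congrArg ENNReal.toReal hu
    rw [ENNReal.toReal_ofReal', ENNReal.toReal_ofReal'] at this
    have h2 := max_zero_sub_max_neg_zero_eq_self (g u)
    simp only [Pi.zero_apply]
    rw [← h2, this, sub_self]
  · exact hg.lintegral_lt_top.ne

end Trigonometric

/-! ### Smooth functions with bounded derivatives -/

section SmoothBounded

variable {E F : Type*} [NormedAddCommGroup E] [NormedSpace ℝ E] [NormedAddCommGroup F]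
  [NormedSpace ℝ F]

/-- Smooth functions with bounded derivatives of all orders. -/
def SmoothBdd (f : E → ℝ) : Prop :=
  ContDiff ℝ ∞ f ∧ ∀ k : ℕ, ∃ M : ℝ, ∀ y, ‖iteratedFDeriv ℝ k f y‖ ≤ M

theorem natCast_le_smooth (k : ℕ) : (k : WithTop ℕ∞) ≤ ((⊤ : ℕ∞) : WithTop ℕ∞) := by
  exact_mod_cast (le_top : (k : ℕ∞) ≤ ⊤)

namespace SmoothBdd

variable {f g : E → ℝ}

theorem comp_clm (hf : SmoothBdd f) (L : F →L[ℝ] E) : SmoothBdd (f ∘ L) := by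
  refine ⟨hf.1.comp L.contDiff, fun k => ?_⟩
  obtain ⟨M, hM⟩ := hf.2 k
  refine ⟨M * ∏ _i : Fin k, ‖L‖, fun y => ?_⟩
  rw [L.iteratedFDeriv_comp_right hf.1 y (natCast_le_smooth k)]
  refine (ContinuousMultilinearMap.norm_compContinuousLinearMap_le _ _).trans ?_
  gcongr
  exact hM _

theorem add (hf : SmoothBdd f) (hg : SmoothBdd g) : SmoothBdd (f + g) := by
  refine ⟨hf.1.add hg.1, fun k => ?_⟩
  obtain ⟨M, hM⟩ := hf.2 k
  obtain ⟨M', hM'⟩ := hg.2 k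
  refine ⟨M + M', fun y => ?_⟩
  rw [iteratedFDeriv_add_apply ((hf.1.of_le (natCast_le_smooth k)).contDiffAt)
    ((hg.1.of_le (natCast_le_smooth k)).contDiffAt)]
  exact (norm_add_le _ _).trans (add_le_add (hM y) (hM' y))

theorem mul (hf : SmoothBdd f) (hg : SmoothBdd g) : SmoothBdd (f * g) := by
  refine ⟨hf.1.mul hg.1, fun k => ?_⟩
  choose M hM using hf.2
  choose M' hM' using hg.2
  refine ⟨∑ i ∈ Finset.range (k + 1), (k.choose i : ℝ) * M i * M' (k - i), fun y => ?_⟩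
  refine (norm_iteratedFDeriv_mul_le hf.1 hg.1 y (natCast_le_smooth k)).trans ?_
  refine Finset.sum_le_sum fun i _ => ?_
  have := (norm_nonneg _).trans (hM i y)
  gcongr
  · exact hM i y
  · exact hM' _ y

theorem const (a : ℝ) : SmoothBdd (fun _ : E => a) := by
  refine ⟨contDiff_const, fun k => ?_⟩
  rcases Nat.eq_zero_or_pos k with rfl | hk
  · exact ⟨‖a‖, fun y => by simp⟩
  · exact ⟨0, fun y => by rw [iteratedFDeriv_const_of_ne hk.ne']; simp⟩

theorem fderiv_apply (hf : SmoothBdd f) (v : E) : SmoothBdd (fun u => fderiv ℝ f u v) := by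
  have h1 : ContDiff ℝ ∞ (fderiv ℝ f) := hf.1.fderiv_right (by simp)
  refine ⟨h1.clm_apply contDiff_const, fun k => ?_⟩
  obtain ⟨M, hM⟩ := hf.2 (k + 1)
  refine ⟨‖v‖ * M, fun y => ?_⟩
  refine (norm_iteratedFDeriv_clm_apply_const h1.contDiffAt (natCast_le_smooth k)).trans ?_
  rw [norm_iteratedFDeriv_fderiv]
  gcongr
  exact hM y

theorem exists_bound (hf : SmoothBdd f) : ∃ M : ℝ, 0 ≤ M ∧ ∀ y, |f y| ≤ M := by
  obtain ⟨M, hM⟩ := hf.2 0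
  exact ⟨M, (norm_nonneg _).trans (hM 0), fun y => by simpa using hM y⟩

theorem differentiable (hf : SmoothBdd f) : Differentiable ℝ f :=
  hf.1.differentiable (by simp)

end SmoothBdd

end SmoothBounded

/-! ### Cylinder functions, partial derivatives and gradients -/

section Cylinder

variable {U : Type*} [NormedAddCommGroup U] [InnerProductSpace ℝ U]

/-- The coordinate map as a continuous linear map. -/
def coordsCLM (d : HilbertBasis ℕ ℝ U) (n : ℕ) : U →L[ℝ] EuclideanSpace ℝ (Fin n) :=
  (EuclideanSpace.equiv (Fin n) ℝ).symm.toContinuousLinearMap ∘L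
    ContinuousLinearMap.pi fun i : Fin n => innerSL ℝ (d i)

theorem coordsCLM_apply (d : HilbertBasis ℕ ℝ U) (n : ℕ) (u : U) :
    coordsCLM d n u = coords d n u := by
  ext i
  simp [coordsCLM, coords, real_inner_comm]

/-- The embedding of `ℝⁿ` that inverts the coordinate map on the first `n` basis vectors. -/
def embedCLM (d : HilbertBasis ℕ ℝ U) (n : ℕ) : EuclideanSpace ℝ (Fin n) →L[ℝ] U :=
  ∑ i : Fin n, (EuclideanSpace.proj i).smulRight (d i)

theorem inner_basis (d : HilbertBasis ℕ ℝ U) (i j : ℕ) : ⟪d i, d j⟫ = if i = j then (1 : ℝ) else 0 :=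
  orthonormal_iff_ite.1 d.orthonormal i j

theorem inner_embedCLM (d : HilbertBasis ℕ ℝ U) (n : ℕ) (y : EuclideanSpace ℝ (Fin n)) (i : Fin n) :
    ⟪embedCLM d n y, d i⟫ = y i := by
  simp [embedCLM, sum_inner, real_inner_smul_left, inner_basis,
    Fin.val_inj]

/-- The function depends on the first `n` coordinates only. -/
def DependsOnFirst {Y : Type*} (d : HilbertBasis ℕ ℝ U) (n : ℕ) (f : U → Y) : Prop :=
  ∀ u v : U, (∀ i < n, ⟪u, d i⟫ = ⟪v, d i⟫) → f u = f v

theorem DependsOnFirst.mono {Y : Type*} {d : HilbertBasis ℕ ℝ U} {n m : ℕ} {f : U → Y}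
    (hf : DependsOnFirst d n f) (h : n ≤ m) : DependsOnFirst d m f :=
  fun u v huv => hf u v fun i hi => huv i (hi.trans_le h)

/-- Composing with the embedding of `ℝⁿ` recovers the profile `φ`. This description on the whole
space makes sums, products and derivatives easy, since no profiles on spaces of different dimension
have to be matched. -/
theorem mem_cylinder_iff {d : HilbertBasis ℕ ℝ U} {f : U → ℝ} :
    f ∈ cylinder d ↔ SmoothBdd f ∧ ∃ n, DependsOnFirst d n f := by
  constructor
  · rintro ⟨n, φ, h1, h2, rfl⟩
    have : φ ∘ coords d n = φ ∘ coordsCLM d n := by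
      ext u; simp [coordsCLM_apply]
    refine ⟨this ▸ SmoothBdd.comp_clm ⟨h1, h2⟩ _, n, fun u v huv => ?_⟩
    have : coords d n u = coords d n v := by
      ext i; exact huv i i.2
    simp [this]
  · rintro ⟨hf, n, hn⟩
    have := hf.comp_clm (embedCLM d n)
    refine ⟨n, f ∘ embedCLM d n, this.1, this.2, ?_⟩
    ext u
    refine hn _ _ fun i hi => ?_
    rw [inner_embedCLM d n _ ⟨i, hi⟩]
    rfl

/-- The partial derivative in the direction of the `i`-th basis vector. -/
def pd (d : HilbertBasis ℕ ℝ U) (i : ℕ) (f : U → ℝ) (u : U) : ℝ := fderiv ℝ f u (d i)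

variable {d : HilbertBasis ℕ ℝ U} {f g : U → ℝ} {n : ℕ}

theorem smoothBdd_of_mem_cylinder (hf : f ∈ cylinder d) : SmoothBdd f := (mem_cylinder_iff.1 hf).1

theorem exists_dependsOnFirst (hf : f ∈ cylinder d) : ∃ n, DependsOnFirst d n f :=
  (mem_cylinder_iff.1 hf).2

theorem add_mem_cylinder (hf : f ∈ cylinder d) (hg : g ∈ cylinder d) : f + g ∈ cylinder d := by
  obtain ⟨h1, n, hn⟩ := mem_cylinder_iff.1 hf
  obtain ⟨h2, m, hm⟩ := mem_cylinder_iff.1 hg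
  refine mem_cylinder_iff.2 ⟨h1.add h2, max n m, fun u v huv => ?_⟩
  have e1 := (hn.mono (le_max_left n m)) u v huv
  have e2 := (hm.mono (le_max_right n m)) u v huv
  simp [e1, e2]

theorem mul_mem_cylinder (hf : f ∈ cylinder d) (hg : g ∈ cylinder d) : f * g ∈ cylinder d := by
  obtain ⟨h1, n, hn⟩ := mem_cylinder_iff.1 hf
  obtain ⟨h2, m, hm⟩ := mem_cylinder_iff.1 hg
  refine mem_cylinder_iff.2 ⟨h1.mul h2, max n m, fun u v huv => ?_⟩
  have e1 := (hn.mono (le_max_left n m)) u v huv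
  have e2 := (hm.mono (le_max_right n m)) u v huv
  simp [e1, e2]

theorem const_mem_cylinder (a : ℝ) : (fun _ => a) ∈ cylinder d :=
  mem_cylinder_iff.2 ⟨SmoothBdd.const a, 0, fun _ _ _ => rfl⟩

theorem const_mul_mem_cylinder (a : ℝ) (hf : f ∈ cylinder d) : (fun u => a * f u) ∈ cylinder d :=
  mul_mem_cylinder (const_mem_cylinder a) hf

theorem sum_mem_cylinder {ι : Type*} (s : Finset ι) {F : ι → U → ℝ} (hF : ∀ i ∈ s, F i ∈ cylinder d) :
    (fun u => ∑ i ∈ s, F i u) ∈ cylinder d := by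
  classical
  induction s using Finset.induction_on with
  | empty => simpa using const_mem_cylinder (d := d) 0
  | insert a s ha ih =>
    simp only [Finset.sum_insert ha]
    exact add_mem_cylinder (hF a (Finset.mem_insert_self a s))
      (ih fun i hi => hF i (Finset.mem_insert_of_mem hi))

/-- If `u` and `v` share their first `n` coordinates, then `f` is invariant under translation by `v
- u`, hence so is its derivative. -/
theorem DependsOnFirst.fderiv (hf : DependsOnFirst d n f) : DependsOnFirst d n (fderiv ℝ f) := by
  intro u v huv
  have h : f = fun w => f (w + (v - u)) := by
    ext w
    refine hf _ _ fun i hi => ?_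
    rw [inner_add_left, inner_sub_left, huv i hi]; ring
  conv_lhs => rw [h]
  rw [fderiv_comp_add_right]
  simp

theorem DependsOnFirst.pd (hf : DependsOnFirst d n f) (i : ℕ) : DependsOnFirst d n (pd d i f) :=
  fun u v huv => by simp [OUPerturbation.pd, hf.fderiv u v huv]

theorem pd_mem_cylinder (hf : f ∈ cylinder d) (i : ℕ) : pd d i f ∈ cylinder d := by
  obtain ⟨h1, n, hn⟩ := mem_cylinder_iff.1 hf
  exact mem_cylinder_iff.2 ⟨h1.fderiv_apply (d i), n, hn.pd i⟩

theorem hasDerivAt_pd (hf : Differentiable ℝ f) (i : ℕ) (u : U) :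
    HasDerivAt (fun s : ℝ => f (u + s • d i)) (pd d i f u) 0 := by
  have h1 : HasFDerivAt f (fderiv ℝ f u) (u + (0 : ℝ) • d i) := by
    simpa using (hf u).hasFDerivAt
  have h2 : HasDerivAt (fun s : ℝ => u + s • d i) (d i) 0 := by
    simpa using ((hasDerivAt_id (0 : ℝ)).smul_const (d i)).const_add u
  exact h1.comp_hasDerivAt 0 h2

theorem pd_eq_of_hasDerivAt (hf : Differentiable ℝ f) {i : ℕ} {u : U} {a : ℝ}
    (h : HasDerivAt (fun s : ℝ => f (u + s • d i)) a 0) : pd d i f u = a :=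
  (hasDerivAt_pd hf i u).unique h

theorem pd_eq_zero (hf : Differentiable ℝ f) (hn : DependsOnFirst d n f) {i : ℕ} (hi : n ≤ i) (u : U) :
    pd d i f u = 0 := by
  refine pd_eq_of_hasDerivAt hf ?_
  have : (fun s : ℝ => f (u + s • d i)) = fun _ => f u := by
    ext s
    refine hn _ _ fun j hj => ?_
    rw [inner_add_left, real_inner_smul_left, inner_basis, if_neg (by omega)]; simp
  rw [this]; exact hasDerivAt_const _ _

theorem pd_add (hf : Differentiable ℝ f) (hg : Differentiable ℝ g) (i : ℕ) :
    pd d i (f + g) = pd d i f + pd d i g := by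
  ext u; simp [pd, fderiv_add (hf u) (hg u)]

theorem pd_const_mul (hf : Differentiable ℝ f) (a : ℝ) (i : ℕ) :
    pd d i (fun u => a * f u) = fun u => a * pd d i f u := by
  ext u; simp [pd, fderiv_const_mul (hf u)]

theorem pd_mul (hf : Differentiable ℝ f) (hg : Differentiable ℝ g) (i : ℕ) :
    pd d i (f * g) = fun u => pd d i f u * g u + f u * pd d i g u := by
  ext u; simp [pd, fderiv_mul (hf u) (hg u)]; ring

theorem pd_comm (hf : f ∈ cylinder d) (i j : ℕ) : pd d i (pd d j f) = pd d j (pd d i f) := by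
  ext u
  have hc := (smoothBdd_of_mem_cylinder hf).1
  have h1 : Differentiable ℝ (fderiv ℝ f) := (hc.fderiv_right (m := ∞) (by simp)).differentiable (by simp)
  have hs := (hc.contDiffAt (x := u)).isSymmSndFDerivAt (by
    simpa using natCast_le_smooth 2)
  have key : ∀ k l, pd d k (pd d l f) u = fderiv ℝ (fderiv ℝ f) u (d k) (d l) := by
    intro k l
    have : pd d l f = fun u => fderiv ℝ f u (d l) := rfl
    rw [this, pd, fderiv_clm_apply (h1 u) (differentiableAt_const _)]
    simp
  rw [key, key, hs.eq]

variable [CompleteSpace U]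

theorem inner_gradient (f : U → ℝ) (u v : U) : ⟪gradient f u, v⟫ = fderiv ℝ f u v := by
  rw [← toDual_gradient]; rfl

theorem eq_sum_of_inner_eq_zero {x : U} (h : ∀ i, n ≤ i → ⟪x, d i⟫ = 0) :
    x = ∑ i ∈ Finset.range n, ⟪x, d i⟫ • d i := by
  have h1 := d.hasSum_repr x
  have h2 : HasSum (fun i => d.repr x i • d i) (∑ i ∈ Finset.range n, d.repr x i • d i) :=
    hasSum_sum_of_ne_finset_zero fun i hi => by
      rw [d.repr_apply_apply, real_inner_comm, h i (by simpa using hi), zero_smul]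
  have := h1.unique h2
  simpa only [d.repr_apply_apply, real_inner_comm] using this

theorem gradient_eq_sum (hf : Differentiable ℝ f) (hn : DependsOnFirst d n f) (u : U) :
    gradient f u = ∑ i ∈ Finset.range n, pd d i f u • d i := by
  have := eq_sum_of_inner_eq_zero (d := d) (n := n) (x := gradient f u) fun i hi => by
    rw [inner_gradient]; exact pd_eq_zero hf hn hi u
  simp only [inner_gradient] at this
  exact this

theorem fderiv_gradient_eq_sum (hf : f ∈ cylinder d) (hn : DependsOnFirst d n f) (u : U) (i : ℕ) :
    fderiv ℝ (gradient f) u (d i) = ∑ j ∈ Finset.range n, pd d i (pd d j f) u • d j := by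
  have hd := (smoothBdd_of_mem_cylinder hf).differentiable
  have : gradient f = fun u => ∑ j ∈ Finset.range n, pd d j f u • d j := by
    ext u; exact gradient_eq_sum hd hn u
  have hpd : ∀ j, Differentiable ℝ (pd d j f) := fun j =>
    (smoothBdd_of_mem_cylinder (pd_mem_cylinder hf j)).differentiable
  rw [this, fderiv_fun_sum fun j _ => (hpd j u).smul_const (d j)]
  simp only [sum_apply]
  refine Finset.sum_congr rfl fun j _ => ?_
  rw [fderiv_smul_const (hpd j u)]
  rfl

theorem firstSpan_mono {n m : ℕ} (h : n ≤ m) : firstSpan d n ≤ firstSpan d m :=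
  Submodule.span_mono (Set.image_mono (Set.Iio_subset_Iio h))

theorem basis_mem_firstSpan {i n : ℕ} (h : i < n) : d i ∈ firstSpan d n :=
  Submodule.subset_span ⟨i, h, rfl⟩

theorem mem_firstSpan_iff {x : U} : x ∈ firstSpan d n ↔ ∀ i, n ≤ i → ⟪x, d i⟫ = 0 := by
  constructor
  · intro hx i hi
    induction hx using Submodule.span_induction with
    | mem x h =>
      obtain ⟨j, hj, rfl⟩ := h
      have hj' : j < n := hj
      rw [inner_basis, if_neg (by omega)]
    | zero => simp
    | add x y _ _ hx hy => rw [inner_add_left, hx, hy, add_zero]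
    | smul a x _ hx => rw [real_inner_smul_left, hx, mul_zero]
  · intro h
    rw [eq_sum_of_inner_eq_zero h]
    exact Submodule.sum_mem _ fun i hi =>
      Submodule.smul_mem _ _ (basis_mem_firstSpan (Finset.mem_range.1 hi))

theorem dense_iUnion_firstSpan (d : HilbertBasis ℕ ℝ U) : Dense (⋃ n, (firstSpan d n : Set U)) := by
  have h := d.dense_span
  rw [← Submodule.dense_iff_topologicalClosure_eq_top] at h
  refine h.mono fun x hx => ?_
  have : Submodule.span ℝ (Set.range d) ≤ ⨆ n, firstSpan d n := by
    rw [Submodule.span_le]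
    rintro _ ⟨i, rfl⟩
    exact Submodule.mem_iSup_of_mem (i + 1) (basis_mem_firstSpan (Nat.lt_succ_self i))
  have h2 := this hx
  rw [Submodule.mem_iSup_of_directed _
    (Monotone.directed_le fun n m hnm => firstSpan_mono hnm)] at h2
  simpa using h2

end Cylinder

/-! ### Gaussian integration by parts -/

/-- Integration by parts for a one-dimensional centered Gaussian measure. -/
theorem integral_deriv_gaussianReal {v : NNReal} (hv : v ≠ 0) {g g' : ℝ → ℝ}
    (hg : ∀ s, HasDerivAt g (g' s) s) (h1 : Integrable g (gaussianReal 0 v))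
    (h2 : Integrable g' (gaussianReal 0 v)) (h3 : Integrable (fun s => g s * s) (gaussianReal 0 v)) :
    ∫ s, g' s ∂gaussianReal 0 v = (v : ℝ)⁻¹ * ∫ s, g s * s ∂gaussianReal 0 v := by
  have key : ∀ f : ℝ → ℝ, Integrable f (gaussianReal 0 v) →
      Integrable (fun s => gaussianPDFReal 0 v s * f s) := fun f hf => by
    rw [gaussianReal_of_var_ne_zero _ hv, integrable_withDensity_iff_integrable_smul'
      (measurable_gaussianPDF _ _) (Eventually.of_forall fun _ => ENNReal.ofReal_lt_top)] at hf
    simpa [toReal_gaussianPDF] using hf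
  -- The density `p` satisfies `p' = -s p / v`, which produces the factor `s` in the integrand.
  have hp : ∀ s, HasDerivAt (gaussianPDFReal 0 v) (-(v : ℝ)⁻¹ * (gaussianPDFReal 0 v s * s)) s := by
    intro s
    have e : HasDerivAt (fun x : ℝ => -(x - 0) ^ 2 / (2 * (v : ℝ))) (-(v : ℝ)⁻¹ * s) s := by
      have hv' : (v : ℝ) ≠ 0 := by exact_mod_cast hv
      have := ((((hasDerivAt_id s).sub_const 0).pow 2).neg).div_const (2 * (v : ℝ))
      refine this.congr_deriv ?_
      simp
      field_simp
    refine (e.exp.const_mul (Real.sqrt (2 * Real.pi * v))⁻¹).congr_deriv ?_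
    rw [gaussianPDFReal_def]; ring
  have := integral_mul_deriv_eq_deriv_mul_of_integrable (u := gaussianPDFReal 0 v) (v := g)
    (u' := fun s => -(v : ℝ)⁻¹ * (gaussianPDFReal 0 v s * s)) (v' := g')
    (fun s _ => hp s) (fun s _ => hg s) (key _ h2)
    (by
      refine ((key _ h3).const_mul (-(v : ℝ)⁻¹)).congr (Eventually.of_forall fun s => ?_)
      simp only [Pi.mul_apply]; ring) (key _ h1)
  rw [integral_gaussianReal_eq_integral_smul hv, integral_gaussianReal_eq_integral_smul hv,
    ← integral_const_mul]
  simp only [smul_eq_mul]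
  rw [this, ← integral_neg]
  congr 1; ext s; ring

section Gaussian

variable {U : Type*} [NormedAddCommGroup U] [InnerProductSpace ℝ U] [CompleteSpace U]
  [SecondCountableTopology U] [MeasurableSpace U] [BorelSpace U]
  {μ : Measure U} {d : HilbertBasis ℕ ℝ U} {lam : ℕ → ℝ}

namespace IsNondegenerateGaussian

variable (hμ : IsNondegenerateGaussian μ d lam)
include hμ

theorem isProbabilityMeasure : IsProbabilityMeasure μ :=
  have := hμ.isGaussian
  inferInstance

theorem memLp_id : MemLp id 2 μ :=
  have := hμ.isGaussian
  IsGaussian.memLp_two_id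

theorem memLp_coord (i : ℕ) : MemLp (fun u => ⟪u, d i⟫) 2 μ := hμ.memLp_id.inner_const (d i)

theorem charFun_eq (t : U) :
    charFun μ t = Complex.exp (-((⟪covarianceOperator μ t, t⟫ : ℝ) : ℂ) / 2) := by
  have := hμ.isGaussian
  have hid : Integrable (fun x : U => x) μ := IsGaussian.integrable_id
  have h0 : ∫ x, ⟪t, x⟫ ∂μ = 0 := by
    rw [integral_inner hid, hμ.centered, inner_zero_right]
  rw [IsGaussian.charFun_eq, integral_complex_ofReal, h0, variance_of_integral_eq_zero (by fun_prop) h0,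
    covarianceOperator_inner hμ.memLp_id]
  simp [pow_two, neg_div]

/-- Since `d i` is an eigenvector, the covariance form has no cross term between `d i` and its
orthogonal complement. This is the independence behind `map_split`. -/
theorem inner_covariance_split (i : ℕ) (t : U) :
    ⟪covarianceOperator μ t, t⟫ = lam i * ⟪d i, t⟫ ^ 2 +
      ⟪covarianceOperator μ (t - ⟪d i, t⟫ • d i), t - ⟪d i, t⟫ • d i⟫ := by
  have hsym : ⟪covarianceOperator μ t, d i⟫ = lam i * ⟪d i, t⟫ := by
    have h := isPositive_covarianceOperator (μ := μ).1 t (d i)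
    simp only [ContinuousLinearMap.coe_coe] at h
    rw [h, hμ.eigen, real_inner_smul_right, real_inner_comm]
  have hn : ⟪d i, d i⟫ = (1 : ℝ) := by rw [inner_basis, if_pos rfl]
  simp only [map_sub, map_smul, hμ.eigen, inner_sub_left, inner_sub_right, real_inner_smul_left,
    real_inner_smul_right, hsym, hn]
  ring

/-- The direction `d i` splits off as an independent one-dimensional Gaussian variable. -/
theorem map_split (i : ℕ) :
    (μ.prod (gaussianReal 0 (lam i).toNNReal)).map
      (fun z : U × ℝ => (z.1 - ⟪d i, z.1⟫ • d i) + z.2 • d i) = μ := by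
  have := hμ.isGaussian
  have hT : Continuous fun z : U × ℝ => (z.1 - ⟪d i, z.1⟫ • d i) + z.2 • d i := by fun_prop
  have : IsProbabilityMeasure ((μ.prod (gaussianReal 0 (lam i).toNNReal)).map
      (fun z : U × ℝ => (z.1 - ⟪d i, z.1⟫ • d i) + z.2 • d i)) :=
    Measure.isProbabilityMeasure_map hT.aemeasurable
  refine Measure.ext_of_charFun (funext fun t => ?_)
  rw [charFun_apply, integral_map hT.aemeasurable
    (by
      have : Continuous fun x : U => Complex.exp (⟪x, t⟫ * Complex.I) := by fun_prop
      exact this.aestronglyMeasurable)]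
  -- The character factors into one of `z.1`, tested against the part of `t` orthogonal to `d i`,
  -- and one of the scalar `z.2`. The integral over the product measure factors accordingly.
  have hsplit : ∀ z : U × ℝ, Complex.exp (⟪(z.1 - ⟪d i, z.1⟫ • d i) + z.2 • d i, t⟫ * Complex.I) =
      Complex.exp (⟪z.1, t - ⟪d i, t⟫ • d i⟫ * Complex.I) *
        Complex.exp ((⟪d i, t⟫ : ℂ) * (z.2 : ℂ) * Complex.I) := by
    intro z
    rw [← Complex.exp_add]
    congr 1
    simp only [inner_add_left, inner_sub_left, inner_sub_right, real_inner_smul_left,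
      real_inner_smul_right, real_inner_comm (d i) z.1]
    push_cast
    ring
  simp_rw [hsplit]
  rw [integral_prod_mul (f := fun x : U => Complex.exp (⟪x, t - ⟪d i, t⟫ • d i⟫ * Complex.I))
    (g := fun s : ℝ => Complex.exp ((⟪d i, t⟫ : ℂ) * (s : ℂ) * Complex.I)), ← charFun_apply,
    ← charFun_apply_real, charFun_gaussianReal, hμ.charFun_eq, hμ.charFun_eq, ← Complex.exp_add]
  congr 1
  rw [hμ.inner_covariance_split i t, Real.coe_toNNReal _ (hμ.pos i).le]
  push_cast
  ring

/-- Integration by parts for a Gaussian measure in the direction of an eigenvector. -/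
theorem integral_deriv_eq {F F' : U → ℝ} (i : ℕ)
    (hF : ∀ u, HasDerivAt (fun s : ℝ => F (u + s • d i)) (F' u) 0) (h1 : Integrable F μ)
    (h2 : Integrable F' μ) (h3 : Integrable (fun u => F u * ⟪u, d i⟫) μ) :
    ∫ u, F' u ∂μ = (lam i)⁻¹ * ∫ u, F u * ⟪u, d i⟫ ∂μ := by
  have := hμ.isGaussian
  set T := fun z : U × ℝ => (z.1 - ⟪d i, z.1⟫ • d i) + z.2 • d i with hTdef
  have hT : Continuous T := by fun_prop
  set γ := gaussianReal 0 (lam i).toNNReal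
  have hmap : (μ.prod γ).map T = μ := hμ.map_split i
  have hint : ∀ G : U → ℝ, Integrable G μ → Integrable (G ∘ T) (μ.prod γ) := fun G hG => by
    rw [← hmap] at hG
    exact (integrable_map_measure hG.1 hT.aemeasurable).1 hG
  have hval : ∀ G : U → ℝ, Integrable G μ → ∫ u, G u ∂μ = ∫ u, ∫ s, G (T (u, s)) ∂γ ∂μ :=
    fun G hG => by
      have h := hG.1
      rw [← hmap] at h
      calc ∫ u, G u ∂μ = ∫ u, G u ∂((μ.prod γ).map T) := by rw [hmap]
        _ = ∫ z, G (T z) ∂(μ.prod γ) := integral_map hT.aemeasurable h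
        _ = _ := integral_prod _ (hint G hG)
  -- On each fibre the `i`-th coordinate is the integration variable itself, so the one-dimensional
  -- formula applies fibrewise.
  have hcoord : ∀ u s, ⟪T (u, s), d i⟫ = s := fun u s => by
    have hn : ⟪d i, d i⟫ = (1 : ℝ) := by rw [inner_basis, if_pos rfl]
    simp only [hTdef, inner_add_left, inner_sub_left, real_inner_smul_left, hn,
      real_inner_comm (d i) u]
    ring
  rw [hval _ h2, hval _ h3, ← integral_const_mul]
  refine integral_congr_ae ?_
  filter_upwards [(hint _ h1).prod_right_ae, (hint _ h2).prod_right_ae,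
    (hint _ h3).prod_right_ae] with u i1 i2 i3
  have hv : (lam i).toNNReal ≠ 0 := by simpa using hμ.pos i
  have := integral_deriv_gaussianReal hv (g := fun s => F (T (u, s))) (g' := fun s => F' (T (u, s)))
    (fun s => ?_) i1 i2 (by simpa only [Function.comp_def, hcoord] using i3)
  · simp only [hcoord]
    rw [this, Real.coe_toNNReal _ (hμ.pos i).le]
  · have h := hF (T (u, s))
    have h' : HasDerivAt (fun r : ℝ => F (T (u, s) + r • d i)) (F' (T (u, s))) (s - s) := by
      rwa [sub_self]
    have h2 := h'.comp_sub_const s s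
    refine h2.congr_of_eventuallyEq (Eventually.of_forall fun r => ?_)
    simp only [hTdef]
    congr 1
    rw [add_assoc, ← add_smul]
    congr 2
    ring

end IsNondegenerateGaussian

/-- The negative of the formal adjoint of the `j`-th partial derivative. -/
def ld (d : HilbertBasis ℕ ℝ U) (lam : ℕ → ℝ) (j : ℕ) (F : U → ℝ) (u : U) : ℝ :=
  pd d j F u - (lam j)⁻¹ * (⟪u, d j⟫ * F u)

section

variable {f g : U → ℝ}

theorem continuous_of_mem_cylinder (hf : f ∈ cylinder d) : Continuous f :=
  (smoothBdd_of_mem_cylinder hf).1.continuous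

theorem differentiable_of_mem_cylinder (hf : f ∈ cylinder d) : Differentiable ℝ f :=
  (smoothBdd_of_mem_cylinder hf).differentiable

theorem memLp_of_mem_cylinder {ν : Measure U} [IsFiniteMeasure ν] (hf : f ∈ cylinder d) (p : ℝ≥0∞) :
    MemLp f p ν := by
  obtain ⟨M, -, hM⟩ := (smoothBdd_of_mem_cylinder hf).exists_bound
  exact MemLp.of_bound (continuous_of_mem_cylinder hf).aestronglyMeasurable M
    (Eventually.of_forall hM)

theorem memLp_mul_of_mem_cylinder {ν : Measure U} {h : U → ℝ} {p : ℝ≥0∞} (hf : f ∈ cylinder d)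
    (hh : MemLp h p ν) : MemLp (fun u => f u * h u) p ν := by
  obtain ⟨M, hM0, hM⟩ := (smoothBdd_of_mem_cylinder hf).exists_bound
  refine hh.of_le_mul (c := M) ((continuous_of_mem_cylinder hf).aestronglyMeasurable.mul hh.1)
    (Eventually.of_forall fun u => ?_)
  rw [norm_mul]
  gcongr
  exact hM u

variable (hμ : IsNondegenerateGaussian μ d lam)
include hμ

theorem memLp_ld (hf : f ∈ cylinder d) (j : ℕ) : MemLp (ld d lam j f) 2 μ := by
  have := hμ.isProbabilityMeasure
  refine (memLp_of_mem_cylinder (pd_mem_cylinder hf j) 2).sub (MemLp.const_mul ?_ _)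
  simpa only [mul_comm] using memLp_mul_of_mem_cylinder hf (hμ.memLp_coord j)

theorem integral_pd_eq (hf : f ∈ cylinder d) (j : ℕ) :
    ∫ u, pd d j f u ∂μ = (lam j)⁻¹ * ∫ u, f u * ⟪u, d j⟫ ∂μ := by
  have := hμ.isProbabilityMeasure
  exact hμ.integral_deriv_eq j (hasDerivAt_pd (differentiable_of_mem_cylinder hf) j)
    (memLp_one_iff_integrable.1 (memLp_of_mem_cylinder hf 1))
    (memLp_one_iff_integrable.1 (memLp_of_mem_cylinder (pd_mem_cylinder hf j) 1))
    (integrable_mul_of_memLp_two (memLp_of_mem_cylinder hf 2) (hμ.memLp_coord j))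

/-- Gaussian integration by parts for the product `f * g`. This justifies reading `ld` as minus the
formal adjoint of `pd`. -/
theorem integral_ld_mul (hf : f ∈ cylinder d) (hg : g ∈ cylinder d) (j : ℕ) :
    ∫ u, ld d lam j f u * g u ∂μ = -∫ u, f u * pd d j g u ∂μ := by
  have := hμ.isProbabilityMeasure
  have h := integral_pd_eq hμ (mul_mem_cylinder hf hg) j
  rw [pd_mul (differentiable_of_mem_cylinder hf) (differentiable_of_mem_cylinder hg)] at h
  have m : ∀ {h}, h ∈ cylinder d → MemLp h 2 μ := fun hh => memLp_of_mem_cylinder hh 2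
  have i1 := integrable_mul_of_memLp_two (m (pd_mem_cylinder hf j)) (m hg)
  have i2 := integrable_mul_of_memLp_two (m hf) (m (pd_mem_cylinder hg j))
  have i3 := integrable_mul_of_memLp_two (m (mul_mem_cylinder hf hg)) (hμ.memLp_coord j)
  rw [integral_add i1 i2] at h
  have e : ∀ u, ld d lam j f u * g u =
      pd d j f u * g u - (lam j)⁻¹ * ((f * g) u * ⟪u, d j⟫) := fun u => by
    simp only [ld, Pi.mul_apply]; ring
  simp_rw [e]
  rw [integral_sub i1 (i3.const_mul _), integral_const_mul]
  linarith

/-- The commutation relation between derivatives and their adjoints, in integrated form. -/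
theorem integral_ld_mul_ld (hf : f ∈ cylinder d) (hg : g ∈ cylinder d) (j l : ℕ) :
    ∫ u, ld d lam j f u * ld d lam l g u ∂μ =
      ∫ u, pd d l f u * pd d j g u ∂μ + (if j = l then (lam l)⁻¹ else 0) * ∫ u, f u * g u ∂μ := by
  have := hμ.isProbabilityMeasure
  have m : ∀ {h}, h ∈ cylinder d → MemLp h 2 μ := fun hh => memLp_of_mem_cylinder hh 2
  have hgj := pd_mem_cylinder hg j
  have hfj := pd_mem_cylinder hf j
  set δ : ℝ := if j = l then (lam l)⁻¹ else 0 with hδ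
  have i0 := integrable_mul_of_memLp_two (m hf) (memLp_ld hμ hg l)
  have i1 := integrable_mul_of_memLp_two (m hfj) (memLp_ld hμ hg l)
  have i2 := integrable_mul_of_memLp_two (memLp_ld hμ hgj l) (m hf)
  have i3 := integrable_mul_of_memLp_two (m hf) (m hg)
  have i4 := integrable_mul_of_memLp_two (memLp_mul_of_mem_cylinder hf (hμ.memLp_coord j))
    (memLp_ld hμ hg l)
  -- The term with `δ` comes from differentiating the coordinate factor `⟪u, d l⟫` inside `ld`. The
  -- rest is `pd d j` commuting with the remaining part of `ld d lam l`.
  have hder : ∀ u, HasDerivAt (fun s : ℝ => f (u + s • d j) * ld d lam l g (u + s • d j))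
      (pd d j f u * ld d lam l g u + (ld d lam l (pd d j g) u * f u - δ * (f u * g u))) 0 := by
    intro u
    have a1 := hasDerivAt_pd (d := d) (differentiable_of_mem_cylinder hf) j u
    have a2 := hasDerivAt_pd (d := d) (differentiable_of_mem_cylinder hg) j u
    have a3 := hasDerivAt_pd (d := d) (differentiable_of_mem_cylinder (pd_mem_cylinder hg l)) j u
    have a4 : HasDerivAt (fun s : ℝ => ⟪u + s • d j, d l⟫) (if j = l then (1 : ℝ) else 0) 0 := by
      have : (fun s : ℝ => ⟪u + s • d j, d l⟫) = fun s => ⟪u, d l⟫ + s * (if j = l then (1 : ℝ) else 0) := by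
        ext s; rw [inner_add_left, real_inner_smul_left, inner_basis]
      rw [this]
      simpa using ((hasDerivAt_id (0 : ℝ)).mul_const (if j = l then (1 : ℝ) else 0)).const_add ⟪u, d l⟫
    have := a1.mul (a3.sub ((a4.mul a2).const_mul (lam l)⁻¹))
    refine this.congr_deriv ?_
    have hc : pd d j (pd d l g) u = pd d l (pd d j g) u := congrFun (pd_comm hg j l) u
    simp only [zero_smul, add_zero, ld, hc, hδ]
    split_ifs <;> simp <;> ring
  have key := hμ.integral_deriv_eq (F' := fun u => pd d j f u * ld d lam l g u +
      (ld d lam l (pd d j g) u * f u - δ * (f u * g u))) j hder i0 (i1.add (i2.sub (i3.const_mul δ)))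
    (i4.congr (Eventually.of_forall fun u => by simp only; ring))
  rw [integral_add i1 (f := fun x => pd d j f x * ld d lam l g x) (g := fun u => ld d lam l (pd d j g) u * f u - δ * (f u * g u)) (i2.sub (i3.const_mul δ)), integral_sub i2 (i3.const_mul δ),
    integral_const_mul, integral_ld_mul hμ hgj hf l] at key
  have e : ∀ u, ld d lam j f u * ld d lam l g u =
      pd d j f u * ld d lam l g u - (lam j)⁻¹ * (f u * ld d lam l g u * ⟪u, d j⟫) := fun u => by
    rw [ld]; ring
  have e2 : ∫ u, pd d j g u * pd d l f u ∂μ = ∫ u, pd d l f u * pd d j g u ∂μ := by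
    simp_rw [mul_comm]
  simp_rw [e]
  rw [integral_sub i1, integral_const_mul]
  · linarith
  · exact (i4.congr (Eventually.of_forall fun u => by simp only; ring)).const_mul _

end

end Gaussian

theorem pval_of_mem {E F : Type*} [AddCommGroup E] [Module ℝ E] [AddCommGroup F] [Module ℝ F]
    {T : E →ₗ.[ℝ] F} {x : E} (h : x ∈ T.domain) : pval T x = T ⟨x, h⟩ := dif_pos h

/-! ### Finite expansions in an orthonormal basis -/

section Basis

variable {H : Type*} [NormedAddCommGroup H] [InnerProductSpace ℝ H] [CompleteSpace H]
  {d : HilbertBasis ℕ ℝ H} {n : ℕ}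

theorem ext_inner_basis {x y : H} (h : ∀ i, ⟪x, d i⟫ = ⟪y, d i⟫) : x = y := by
  apply d.repr.injective
  ext i
  rw [d.repr_apply_apply, d.repr_apply_apply, real_inner_comm, h, real_inner_comm]

theorem inner_sum_basis (a : ℕ → ℝ) (j : ℕ) :
    ⟪∑ i ∈ Finset.range n, a i • d i, d j⟫ = if j < n then a j else 0 := by
  simp [sum_inner, real_inner_smul_left, inner_basis]

theorem sum_basis_mem_firstSpan (a : ℕ → ℝ) : ∑ i ∈ Finset.range n, a i • d i ∈ firstSpan d n :=
  Submodule.sum_mem _ fun _ hi =>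
    Submodule.smul_mem _ _ (basis_mem_firstSpan (Finset.mem_range.1 hi))

theorem eq_sum_of_mem_firstSpan {x : H} (h : x ∈ firstSpan d n) :
    x = ∑ i ∈ Finset.range n, ⟪x, d i⟫ • d i :=
  eq_sum_of_inner_eq_zero (mem_firstSpan_iff.1 h)

theorem diagPow_eq_sum (lam : ℕ → ℝ) (θ : ℝ) {x : H} (h : x ∈ firstSpan d n) :
    diagPow d lam θ x = ∑ i ∈ Finset.range n, (lam i ^ θ * ⟪x, d i⟫) • d i := by
  rw [diagPow, tsum_eq_sum (s := Finset.range n)]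
  · simp_rw [real_inner_comm]
  · intro i hi
    rw [real_inner_comm, mem_firstSpan_iff.1 h i (by simpa using hi)]
    simp

theorem inner_diagPow (lam : ℕ → ℝ) (θ : ℝ) {x : H} (h : x ∈ firstSpan d n) (i : ℕ) :
    ⟪diagPow d lam θ x, d i⟫ = lam i ^ θ * ⟪x, d i⟫ := by
  rw [diagPow_eq_sum lam θ h, inner_sum_basis]
  split_ifs with hi
  · rfl
  · rw [mem_firstSpan_iff.1 h i (by omega), mul_zero]

theorem inner_eq_sum_of_mem_firstSpan {x : H} (h : x ∈ firstSpan d n) (y : H) :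
    ⟪x, y⟫ = ∑ i ∈ Finset.range n, ⟪x, d i⟫ * ⟪y, d i⟫ := by
  conv_lhs => rw [eq_sum_of_mem_firstSpan h]
  rw [sum_inner]
  refine Finset.sum_congr rfl fun i _ => ?_
  rw [real_inner_smul_left, real_inner_comm y (d i)]

end Basis

section CovInv

variable {H : Type*} [NormedAddCommGroup H] [InnerProductSpace ℝ H] [CompleteSpace H]
  [MeasurableSpace H] [BorelSpace H] {μ : Measure H} {d : HilbertBasis ℕ ℝ H} {lam : ℕ → ℝ} {n : ℕ}

theorem inner_covarianceOperator_basis (hμ : IsNondegenerateGaussian μ d lam) (x : H) (i : ℕ) :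
    ⟪covarianceOperator μ x, d i⟫ = lam i * ⟪x, d i⟫ := by
  have h := isPositive_covarianceOperator (μ := μ).1 x (d i)
  simp only [ContinuousLinearMap.coe_coe] at h
  rw [h, hμ.eigen, real_inner_smul_right]

/-- The covariance operator is diagonal with nonzero eigenvalues, hence injective. On a finite span
its preimage is found by dividing coordinates by the eigenvalues. -/
theorem covInv_apply (hμ : IsNondegenerateGaussian μ d lam) {x : H} (hx : x ∈ firstSpan d n) :
    x ∈ (covInv μ).domain ∧
      pval (covInv μ) x = ∑ i ∈ Finset.range n, ((lam i)⁻¹ * ⟪x, d i⟫) • d i := by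
  set Q := ((covarianceOperator μ).toLinearMap.toPMap ⊤) with hQ
  have hker : LinearMap.ker Q.toFun = ⊥ := by
    rw [LinearMap.ker_eq_bot']
    rintro ⟨z, hz⟩ h
    have h' : covarianceOperator μ z = 0 := h
    have : z = 0 := ext_inner_basis (d := d) fun i => by
      have h2 := inner_covarianceOperator_basis hμ z i
      rw [h', inner_zero_left] at h2
      rw [inner_zero_left]
      exact (mul_eq_zero.1 h2.symm).resolve_left (hμ.pos i).ne'
    exact Subtype.ext this
  set y := ∑ i ∈ Finset.range n, ((lam i)⁻¹ * ⟪x, d i⟫) • d i with hy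
  have hQy : covarianceOperator μ y = x := ext_inner_basis (d := d) fun i => by
    rw [inner_covarianceOperator_basis hμ, hy, inner_sum_basis]
    split_ifs with hi
    · rw [mul_inv_cancel_left₀ (hμ.pos i).ne']
    · rw [mem_firstSpan_iff.1 hx i (by omega), mul_zero]
  have hmem : x ∈ (covInv μ).domain := by
    rw [covInv, LinearPMap.inverse_domain]
    exact ⟨⟨y, trivial⟩, hQy⟩
  refine ⟨hmem, ?_⟩
  rw [pval_of_mem hmem]
  exact LinearPMap.inverse_apply_eq hker (x := ⟨y, trivial⟩) hQy

end CovInv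

/-! ### The coefficient operator as positive semidefinite blocks -/

/-- The operator `C` leaves the span of the first `M` basis vectors invariant, where it acts as a
positive semidefinite matrix. -/
structure IsBlockOperator {U : Type*} [NormedAddCommGroup U] [InnerProductSpace ℝ U]
    (C : U →ₗ.[ℝ] U) (d : HilbertBasis ℕ ℝ U) (c : ℕ → ℕ → ℝ) (M : ℕ) : Prop where
  mem : ∀ x ∈ firstSpan d M, x ∈ C.domain
  apply : ∀ x ∈ firstSpan d M,
    pval C x = ∑ j ∈ Finset.range M, (∑ i ∈ Finset.range M, c i j * ⟪x, d i⟫) • d j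
  factor : ∃ b : ℕ → ℕ → ℝ, ∀ i < M, ∀ j < M, c i j = ∑ l ∈ Finset.range M, b l i * b l j

section Coefficient

variable {U V : Type*} [NormedAddCommGroup U] [InnerProductSpace ℝ U] [CompleteSpace U]
  [NormedAddCommGroup V] [InnerProductSpace ℝ V] [CompleteSpace V]
  [MeasurableSpace V] [BorelSpace V] {d : HilbertBasis ℕ ℝ U} {e : HilbertBasis ℕ ℝ V}
  {μ₂ : Measure V} {lam₂ : ℕ → ℝ} {K : U →L[ℝ] V} {m : ℕ → ℕ}

/-- The matrix of an operator with respect to an orthonormal basis. -/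
def coeff (C : U →ₗ.[ℝ] U) (d : HilbertBasis ℕ ℝ U) (i j : ℕ) : ℝ := ⟪pval C (d i), d j⟫

/-- `K` maps the block into a finite span of `e`, where `Q₂⁻¹` is a finite sum, and the adjoint
returns to the block. Moving the adjoint across the scalar product gives the bilinear form. -/
theorem opC_apply (hμ₂ : IsNondegenerateGaussian μ₂ e lam₂) (hK : IsBlockInvariant K d e m) (k : ℕ)
    {x : U} (hx : x ∈ firstSpan d (m k)) :
    x ∈ (opC μ₂ K).domain ∧ pval (opC μ₂ K) x ∈ firstSpan d (m k) ∧
      ∀ y, ⟪pval (opC μ₂ K) x, y⟫ =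
        ∑ l ∈ Finset.range (m k), (lam₂ l)⁻¹ * ⟪K x, e l⟫ * ⟪K y, e l⟫ := by
  have hKx := hK.map_fst k _ le_rfl x hx
  obtain ⟨h1, h2⟩ := covInv_apply hμ₂ hKx
  have hmem : x ∈ (opC μ₂ K).domain := h1
  have hval : pval (opC μ₂ K) x = ContinuousLinearMap.adjoint K (pval (covInv μ₂) (K x)) := by
    rw [pval_of_mem hmem, pval_of_mem h1]; rfl
  refine ⟨hmem, ?_, fun y => ?_⟩
  · rw [hval, h2]
    exact hK.map_snd k _ le_rfl _ (sum_basis_mem_firstSpan _)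
  · rw [hval, ContinuousLinearMap.adjoint_inner_left, h2, sum_inner]
    refine Finset.sum_congr rfl fun l _ => ?_
    rw [real_inner_smul_left, real_inner_comm (K y) (e l)]

/-- On a block `C = (Q₂^{-1/2} K)* (Q₂^{-1/2} K)`. The factor `b` is therefore the matrix of
`Q₂^{-1/2} K`, whose entries carry `√(lam₂ l)⁻¹`. -/
theorem isBlockOperator_opC (hμ₂ : IsNondegenerateGaussian μ₂ e lam₂)
    (hK : IsBlockInvariant K d e m) (k : ℕ) :
    IsBlockOperator (opC μ₂ K) d (coeff (opC μ₂ K) d) (m k) := by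
  have hc : ∀ i < m k, ∀ j, coeff (opC μ₂ K) d i j =
      ∑ l ∈ Finset.range (m k), (lam₂ l)⁻¹ * ⟪K (d i), e l⟫ * ⟪K (d j), e l⟫ := fun i hi j =>
    (opC_apply hμ₂ hK k (basis_mem_firstSpan hi)).2.2 (d j)
  refine ⟨fun x hx => (opC_apply hμ₂ hK k hx).1, fun x hx => ?_,
    fun l i => Real.sqrt (lam₂ l)⁻¹ * ⟪K (d i), e l⟫, fun i hi j _ => ?_⟩
  · obtain ⟨-, h1, h2⟩ := opC_apply hμ₂ hK k hx
    rw [eq_sum_of_mem_firstSpan h1]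
    refine Finset.sum_congr rfl fun j _ => ?_
    congr 1
    rw [h2]
    have hKx : ∀ l, ⟪K x, e l⟫ = ∑ i ∈ Finset.range (m k), ⟪x, d i⟫ * ⟪K (d i), e l⟫ := fun l => by
      conv_lhs => rw [eq_sum_of_mem_firstSpan hx]
      simp [map_sum, sum_inner, real_inner_smul_left]
    simp_rw [hKx, Finset.mul_sum, Finset.sum_mul]
    rw [Finset.sum_comm]
    refine Finset.sum_congr rfl fun i hi => ?_
    rw [hc i (Finset.mem_range.1 hi), Finset.sum_mul]
    refine Finset.sum_congr rfl fun l _ => ?_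
    ring
  · rw [hc i hi]
    refine Finset.sum_congr rfl fun l _ => ?_
    have : Real.sqrt (lam₂ l)⁻¹ * Real.sqrt (lam₂ l)⁻¹ = (lam₂ l)⁻¹ :=
      Real.mul_self_sqrt (inv_nonneg.2 (hμ₂.pos l).le)
    linear_combination (-⟪K (d i), e l⟫ * ⟪K (d j), e l⟫) * this

/-- The eigenvalues of `Q₂⁻¹` are at least `(lam₂ 0)⁻¹`, as `lam₂` decreases. The constant does not
depend on the block, so the bound survives passage to a bounded extension of `C`. -/
theorem le_inner_opC (hμ₂ : IsNondegenerateGaussian μ₂ e lam₂) (hK : IsBlockInvariant K d e m)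
    (k : ℕ) {x : U} (hx : x ∈ firstSpan d (m k)) :
    (lam₂ 0)⁻¹ * ‖K x‖ ^ 2 ≤ ⟪pval (opC μ₂ K) x, x⟫ := by
  rw [(opC_apply hμ₂ hK k hx).2.2, ← real_inner_self_eq_norm_sq,
    inner_eq_sum_of_mem_firstSpan (hK.map_fst k _ le_rfl x hx), Finset.mul_sum]
  refine Finset.sum_le_sum fun l _ => ?_
  rw [mul_assoc]
  refine mul_le_mul_of_nonneg_right ?_ (mul_self_nonneg _)
  exact inv_anti₀ (hμ₂.pos l) (hμ₂.antitone (Nat.zero_le l))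

end Coefficient

/-! ### The operator `N` in coordinates -/

section Operator

variable {U : Type*} [NormedAddCommGroup U] [InnerProductSpace ℝ U] [CompleteSpace U]
  [SecondCountableTopology U] [MeasurableSpace U] [BorelSpace U]
  {μ : Measure U} {d : HilbertBasis ℕ ℝ U} {lam : ℕ → ℝ} {C : U →ₗ.[ℝ] U} {c : ℕ → ℕ → ℝ} {M : ℕ}
  {f : U → ℝ}

theorem gradient_mem_firstSpan (hf : f ∈ cylinder d) (hM : DependsOnFirst d M f) (u : U) :
    gradient f u ∈ firstSpan d M := by
  rw [gradient_eq_sum (differentiable_of_mem_cylinder hf) hM]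
  exact sum_basis_mem_firstSpan _

namespace IsBlockOperator

variable (hC : IsBlockOperator C d c M)
include hC

theorem symm {i j : ℕ} (hi : i < M) (hj : j < M) : c i j = c j i := by
  obtain ⟨b, hb⟩ := hC.factor
  rw [hb i hi j hj, hb j hj i hi]
  simp_rw [mul_comm]

theorem pval_mem {x : U} (hx : x ∈ firstSpan d M) : pval C x ∈ firstSpan d M := by
  rw [hC.apply x hx]; exact sum_basis_mem_firstSpan _

theorem inner_pval {x : U} (hx : x ∈ firstSpan d M) {j : ℕ} (hj : j < M) :
    ⟪pval C x, d j⟫ = ∑ i ∈ Finset.range M, c i j * ⟪x, d i⟫ := by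
  rw [hC.apply x hx, inner_sum_basis, if_pos hj]

/-- The operator `N` in coordinates. -/
theorem opN_eq (hμ : IsNondegenerateGaussian μ d lam) (hf : f ∈ cylinder d)
    (hM : DependsOnFirst d M f) (u : U) :
    opN μ d C f u =
      ∑ i ∈ Finset.range M, ∑ j ∈ Finset.range M, c i j * ld d lam j (pd d i f) u := by
  have hg := gradient_mem_firstSpan hf hM u
  have htr : (∑' i, ⟪pval C (fderiv ℝ (gradient f) u (d i)), d i⟫) =
      ∑ i ∈ Finset.range M, ∑ j ∈ Finset.range M, c j i * pd d i (pd d j f) u := by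
    have hmem : ∀ i, fderiv ℝ (gradient f) u (d i) ∈ firstSpan d M := fun i => by
      rw [fderiv_gradient_eq_sum hf hM]; exact sum_basis_mem_firstSpan _
    rw [tsum_eq_sum (s := Finset.range M)]
    · refine Finset.sum_congr rfl fun i hi => ?_
      rw [hC.inner_pval (hmem i) (Finset.mem_range.1 hi)]
      refine Finset.sum_congr rfl fun j hj => ?_
      rw [fderiv_gradient_eq_sum hf hM, inner_sum_basis, if_pos (Finset.mem_range.1 hj)]
    · intro i hi
      exact mem_firstSpan_iff.1 (hC.pval_mem (hmem i)) i (by simpa using hi)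
  have hdr : ⟪u, pval (covInv μ) (pval C (gradient f u))⟫ =
      ∑ i ∈ Finset.range M, ∑ j ∈ Finset.range M, c i j * ((lam j)⁻¹ * (⟪u, d j⟫ * pd d i f u)) := by
    rw [(covInv_apply hμ (hC.pval_mem hg)).2, inner_sum, Finset.sum_comm]
    refine Finset.sum_congr rfl fun j hj => ?_
    rw [real_inner_smul_right, hC.inner_pval hg (Finset.mem_range.1 hj), Finset.mul_sum,
      Finset.sum_mul]
    refine Finset.sum_congr rfl fun i _ => ?_
    rw [inner_gradient, pd]; ring
  rw [opN, htr, hdr, Finset.sum_comm, ← Finset.sum_sub_distrib]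
  refine Finset.sum_congr rfl fun i _ => ?_
  rw [← Finset.sum_sub_distrib]
  refine Finset.sum_congr rfl fun j _ => ?_
  rw [ld, pd_comm hf j i, pd_comm hf i j]
  ring

end IsBlockOperator

end Operator

/-! ### Superpositions of plane waves -/

section TrigonometricIntegral

variable {U : Type*} [NormedAddCommGroup U] [InnerProductSpace ℝ U] [CompleteSpace U]
  [SecondCountableTopology U] [MeasurableSpace U] [BorelSpace U] {d : HilbertBasis ℕ ℝ U} {M : ℕ}

/-- The `k`-th derivative of a characteristic function is bounded by the `k`-th absolute moment,
uniformly in the argument. -/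
theorem smoothBdd_re_charFun {ν : Measure U} [IsFiniteMeasure ν] (h : ∀ k : ℕ, MemLp id k ν) (z : ℂ) :
    SmoothBdd fun u => (z * charFun ν u).re := by
  let L : ℂ →L[ℝ] ℝ := Complex.reCLM ∘L ContinuousLinearMap.mul ℝ ℂ z
  have hL : (fun u => (z * charFun ν u).re) = L ∘ charFun ν := rfl
  have hc : ContDiff ℝ ((⊤ : ℕ∞) : WithTop ℕ∞) (charFun ν) := contDiff_charFun' h
  rw [hL]
  refine ⟨L.contDiff.comp hc, fun k => ⟨‖L‖ * ∫ y, ‖y‖ ^ k ∂ν, fun u => ?_⟩⟩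
  refine (L.norm_iteratedFDeriv_comp_left hc.contDiffAt (natCast_le_smooth k)).trans ?_
  gcongr
  refine ContinuousMultilinearMap.opNorm_le_bound (integral_nonneg fun y => by positivity) fun x => ?_
  rw [iteratedFDeriv_charFun (h k), norm_mul, norm_pow, Complex.norm_I, one_pow, one_mul,
    ← integral_mul_const]
  refine norm_integral_le_of_norm_le ((h k).integrable_norm_pow'.mul_const _)
    (Eventually.of_forall fun y => ?_)
  rw [norm_mul, Complex.norm_exp_ofReal_mul_I, mul_one, Complex.norm_real, norm_prod]
  calc ∏ i, ‖⟪y, x i⟫‖ ≤ ∏ i, ‖y‖ * ‖x i‖ :=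
        Finset.prod_le_prod (fun _ _ => norm_nonneg _) fun i _ => norm_inner_le_norm _ _
    _ = _ := by rw [Finset.prod_mul_distrib]; simp

/-- A superposition of plane waves with wave vectors `X t` and weights `a t`. -/
def waveIntegral (ρ : Measure ℝ) (a : ℝ → ℝ) (X : ℝ → U) (θ : ℝ) (u : U) : ℝ :=
  ∫ t, a t * Real.cos (⟪X t, u⟫ + θ) ∂ρ

variable {ρ : Measure ℝ} {a : ℝ → ℝ} {X : ℝ → U} {R : ℝ}

theorem integrable_wave (ha : Integrable a ρ) (hX : Continuous X) (θ : ℝ) (u : U) :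
    Integrable (fun t => a t * Real.cos (⟪X t, u⟫ + θ)) ρ :=
  ha.mul_bdd (c := 1)
    (by
      have : Continuous fun t => Real.cos (⟪X t, u⟫ + θ) := by fun_prop
      exact this.aestronglyMeasurable)
    (Eventually.of_forall fun t => Real.abs_cos_le_one _)

/-- Such a superposition is the real part of a rotated characteristic function of the image under
`X` of the measure with density `a`. As `X` is bounded a.e., all moments are finite; `a` has to be
nonnegative to serve as a density. -/
theorem waveIntegral_mem_cylinder (ha : Integrable a ρ) (ha0 : ∀ t, 0 ≤ a t) (hX : Continuous X)
    (hR : ∀ᵐ t ∂ρ, ‖X t‖ ≤ R) (hXM : ∀ t, X t ∈ firstSpan d M) (θ : ℝ) :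
    waveIntegral ρ a X θ ∈ cylinder d ∧ DependsOnFirst d M (waveIntegral ρ a X θ) := by
  have hdep : DependsOnFirst d M (waveIntegral ρ a X θ) := by
    intro u v huv
    have : ∀ t, ⟪X t, u⟫ = ⟪X t, v⟫ := fun t => by
      rw [inner_eq_sum_of_mem_firstSpan (hXM t), inner_eq_sum_of_mem_firstSpan (hXM t)]
      refine Finset.sum_congr rfl fun i hi => ?_
      rw [huv i (Finset.mem_range.1 hi)]
    simp only [waveIntegral, this]
  refine ⟨mem_cylinder_iff.2 ⟨?_, M, hdep⟩, hdep⟩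
  set σ := ρ.withDensity fun t => ENNReal.ofReal (a t) with hσ
  have : IsFiniteMeasure σ := isFiniteMeasure_withDensity_ofReal ha.2
  set ν := σ.map X
  have hb : ∀ᵐ y ∂ν, ‖y‖ ≤ R := by
    rw [ae_map_iff hX.aemeasurable (measurableSet_le measurable_norm measurable_const)]
    exact (withDensity_absolutelyContinuous _ _).ae_le hR
  have hmom : ∀ k : ℕ, MemLp id k ν := fun k => MemLp.of_bound (by fun_prop) R hb
  have heq : waveIntegral ρ a X θ = fun u => (Complex.exp (θ * Complex.I) * charFun ν u).re := by
    ext u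
    have hm : Continuous fun y : U => Complex.exp (⟪y, u⟫ * Complex.I) := by fun_prop
    rw [charFun_apply, integral_map hX.aemeasurable hm.aestronglyMeasurable,
      integral_withDensity_eq_integral_toReal_smul₀ ha.1.aemeasurable.ennreal_ofReal
      (Eventually.of_forall fun _ => ENNReal.ofReal_lt_top), ← integral_const_mul]
    have hint : Integrable (fun t => Complex.exp (θ * Complex.I) *
        ((ENNReal.ofReal (a t)).toReal • Complex.exp (⟪X t, u⟫ * Complex.I))) ρ := by
      refine Integrable.const_mul ?_ _
      simp_rw [ENNReal.toReal_ofReal (ha0 _), Complex.real_smul]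
      refine (ha.ofReal (𝕜 := ℂ)).mul_bdd (c := 1) ?_ (Eventually.of_forall fun t => ?_)
      · exact (hm.comp hX).aestronglyMeasurable
      · rw [Complex.norm_exp_ofReal_mul_I]
    rw [← RCLike.re_eq_complex_re, ← integral_re hint, waveIntegral]
    congr 1
    ext t
    rw [ENNReal.toReal_ofReal (ha0 t), mul_smul_comm, ← Complex.exp_add, ← add_mul,
      ← Complex.ofReal_add, RCLike.re_eq_complex_re, Complex.real_smul, Complex.re_ofReal_mul,
      Complex.exp_ofReal_mul_I_re, add_comm θ]
  rw [heq]
  exact smoothBdd_re_charFun hmom _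

/-- Differentiation under the integral sign. Absorbing the sign and the sine into a phase shift by
`π / 2` keeps derivatives in the same family, so the lemma can be iterated; the new weight may
change sign. -/
theorem hasDerivAt_waveIntegral (ha : Integrable a ρ) (hX : Continuous X)
    (hR : ∀ᵐ t ∂ρ, ‖X t‖ ≤ R) (θ : ℝ) (u : U) (i : ℕ) :
    Integrable (fun t => a t * ⟪X t, d i⟫) ρ ∧
    HasDerivAt (fun s : ℝ => waveIntegral ρ a X θ (u + s • d i))
      (waveIntegral ρ (fun t => a t * ⟪X t, d i⟫) X (θ + Real.pi / 2) u) 0 := by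
  have hn : ‖d i‖ = 1 := d.orthonormal.1 i
  have hle : ∀ᵐ t ∂ρ, ‖⟪X t, d i⟫‖ ≤ R := by
    filter_upwards [hR] with t ht
    refine (norm_inner_le_norm _ _).trans ?_
    rwa [hn, mul_one]
  have hint : Integrable (fun t => a t * ⟪X t, d i⟫) ρ :=
    ha.mul_bdd (c := R)
      (by
        have : Continuous fun t => ⟪X t, d i⟫ := by fun_prop
        exact this.aestronglyMeasurable) hle
  refine ⟨hint, ?_⟩
  have h := (hasDerivAt_integral_of_dominated_loc_of_deriv_le (μ := ρ) (s := Set.univ) (x₀ := (0 : ℝ))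
    (F := fun s t => a t * Real.cos (⟪X t, u + s • d i⟫ + θ))
    (F' := fun s t => a t * ⟪X t, d i⟫ * Real.cos (⟪X t, u + s • d i⟫ + (θ + Real.pi / 2)))
    (bound := fun t => ‖a t * ⟪X t, d i⟫‖) univ_mem
    (Eventually.of_forall fun s => (integrable_wave ha hX θ _).1) (integrable_wave ha hX θ _)
    (integrable_wave hint hX _ _).1
    (Eventually.of_forall fun t s _ => ?_) hint.norm
    (Eventually.of_forall fun t s _ => ?_)).2
  · simpa only [waveIntegral, zero_smul, add_zero] using h
  · rw [norm_mul]
    exact mul_le_of_le_one_right (norm_nonneg _) (Real.abs_cos_le_one _)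
  · have h1 : HasDerivAt (fun s : ℝ => ⟪X t, u + s • d i⟫ + θ) ⟪X t, d i⟫ s := by
      simp only [inner_add_right, real_inner_smul_right]
      simpa using (((hasDerivAt_id s).mul_const ⟪X t, d i⟫).const_add ⟪X t, u⟫).add_const θ
    refine (h1.cos.const_mul (a t)).congr_deriv ?_
    rw [← add_assoc, Real.cos_add_pi_div_two]
    ring

end TrigonometricIntegral

/-! ### Linear flows on finite spans -/

section Trajectory

variable {U : Type*} [NormedAddCommGroup U] [InnerProductSpace ℝ U] [CompleteSpace U]
  {d : HilbertBasis ℕ ℝ U} {M : ℕ}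

/-- The linear flow of a matrix on the span of the first basis vectors. -/
theorem exists_flow (B : ℕ → ℕ → ℝ) {h : U} (hh : h ∈ firstSpan d M) :
    ∃ X : ℝ → U, X 0 = h ∧ Continuous X ∧ (∀ t, X t ∈ firstSpan d M) ∧
      ∀ t, HasDerivAt X (-∑ j ∈ Finset.range M, (∑ i ∈ Finset.range M, B i j * ⟪X t, d i⟫) • d j) t := by
  let A : U →L[ℝ] U := ∑ j ∈ Finset.range M, ∑ i ∈ Finset.range M,
    ((B i j) • innerSL ℝ (d i)).smulRight (d j)
  have hA : ∀ x, A x = ∑ j ∈ Finset.range M, (∑ i ∈ Finset.range M, B i j * ⟪x, d i⟫) • d j := by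
    intro x
    simp only [A, sum_apply, Finset.sum_smul]
    refine Finset.sum_congr rfl fun j _ => Finset.sum_congr rfl fun i _ => ?_
    simp [real_inner_comm]
  let X : ℝ → U := fun t => NormedSpace.exp (t • (-A)) h
  have hder : ∀ t, HasDerivAt X (-A (X t)) t := fun t => by
    have h1 := hasDerivAt_exp_smul_const' (𝕂 := ℝ) (-A) t
    have h2 := ((ContinuousLinearMap.apply ℝ U h).hasFDerivAt).comp_hasDerivAt t h1
    exact h2
  refine ⟨X, by simp [X], continuous_iff_continuousAt.2 fun t => (hder t).continuousAt, fun t => ?_,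
    fun t => by rw [← hA]; exact hder t⟩
  rw [mem_firstSpan_iff]
  intro i hi
  -- The vector field has no component along `d i` for `i ≥ M`, so these coordinates stay zero.
  have h1 : ∀ t, HasDerivAt (fun t => ⟪X t, d i⟫) 0 t := fun t => by
    have := (hder t).inner ℝ (hasDerivAt_const t (d i))
    refine this.congr_deriv ?_
    rw [hA, inner_zero_right, inner_neg_left, inner_sum_basis, if_neg (by omega)]
    simp
  have h2 := is_const_of_deriv_eq_zero (fun t => (h1 t).differentiableAt) (fun t => (h1 t).deriv) t 0
  rw [h2]
  simpa [X] using mem_firstSpan_iff.1 hh i hi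

end Trajectory

/-! ### Solving the resolvent equation for plane waves -/

section Resolvent

variable {U : Type*} [NormedAddCommGroup U] [InnerProductSpace ℝ U] [CompleteSpace U]
  [SecondCountableTopology U] [MeasurableSpace U] [BorelSpace U]
  {μ : Measure U} {d : HilbertBasis ℕ ℝ U} {lam : ℕ → ℝ} {C : U →ₗ.[ℝ] U} {c : ℕ → ℕ → ℝ} {M : ℕ}

theorem IsBlockOperator.sum_nonneg (hC : IsBlockOperator C d c M) (x : ℕ → ℝ) :
    0 ≤ ∑ i ∈ Finset.range M, ∑ j ∈ Finset.range M, c i j * x i * x j := by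
  obtain ⟨b, hb⟩ := hC.factor
  have : ∑ i ∈ Finset.range M, ∑ j ∈ Finset.range M, c i j * x i * x j =
      ∑ l ∈ Finset.range M, (∑ i ∈ Finset.range M, b l i * x i) ^ 2 := by
    simp_rw [pow_two, Finset.sum_mul_sum]
    rw [Finset.sum_comm' (t' := Finset.range M) (s' := fun _ => Finset.range M) (by simp)]
    rw [Finset.sum_comm]
    rw [Finset.sum_comm (s := Finset.range M) (t := Finset.range M)
      (f := fun l i => ∑ j ∈ Finset.range M, b l i * x i * (b l j * x j))]
    refine Finset.sum_congr rfl fun i hi => ?_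
    rw [Finset.sum_comm]
    refine Finset.sum_congr rfl fun j hj => ?_
    rw [hb i (Finset.mem_range.1 hi) j (Finset.mem_range.1 hj), Finset.sum_mul, Finset.sum_mul]
    refine Finset.sum_congr rfl fun l _ => ?_
    ring
  rw [this]
  exact Finset.sum_nonneg fun _ _ => sq_nonneg _

variable (hμ : IsNondegenerateGaussian μ d lam) (hC : IsBlockOperator C d c M)
include hμ hC

/-- The flow of `-Q⁻¹ C` is bounded, since `(Q x, x)` decreases along it. -/
theorem exists_bounded_flow {h : U} (hh : h ∈ firstSpan d M) :
    ∃ (X : ℝ → U) (q : ℝ → ℝ) (R : ℝ), X 0 = h ∧ q 0 = 0 ∧ Continuous X ∧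
      (∀ t, X t ∈ firstSpan d M) ∧ (∀ t, 0 ≤ t → ‖X t‖ ≤ R) ∧ (∀ t, 0 ≤ t → 0 ≤ q t) ∧
      (∀ t, HasDerivAt X
        (-∑ j ∈ Finset.range M, (∑ i ∈ Finset.range M, (lam j)⁻¹ * c i j * ⟪X t, d i⟫) • d j) t) ∧
      ∀ t, HasDerivAt q
        (∑ i ∈ Finset.range M, ∑ j ∈ Finset.range M, c i j * ⟪X t, d i⟫ * ⟪X t, d j⟫) t := by
  obtain ⟨X, hX0, hXc, hXM, hXd⟩ := exists_flow (fun i j => (lam j)⁻¹ * c i j) hh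
  let E : ℝ → ℝ := fun t => ∑ j ∈ Finset.range M, lam j * ⟪X t, d j⟫ ^ 2
  have hcoord : ∀ t, ∀ j ∈ Finset.range M, HasDerivAt (fun t => ⟪X t, d j⟫)
      (-∑ i ∈ Finset.range M, (lam j)⁻¹ * c i j * ⟪X t, d i⟫) t := fun t j hj => by
    have := (hXd t).inner ℝ (hasDerivAt_const t (d j))
    refine this.congr_deriv ?_
    rw [inner_zero_right, inner_neg_left, inner_sum_basis, if_pos (Finset.mem_range.1 hj), zero_add]
  have hE : ∀ t, HasDerivAt E (-2 * ∑ i ∈ Finset.range M, ∑ j ∈ Finset.range M,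
      c i j * ⟪X t, d i⟫ * ⟪X t, d j⟫) t := fun t => by
    have := HasDerivAt.fun_sum fun j hj => ((hcoord t j hj).pow 2).const_mul (lam j)
    refine this.congr_deriv ?_
    rw [Finset.sum_comm, Finset.mul_sum]
    refine Finset.sum_congr rfl fun j _ => ?_
    have e : ∑ i ∈ Finset.range M, (lam j)⁻¹ * c i j * ⟪X t, d i⟫ =
        (lam j)⁻¹ * ∑ i ∈ Finset.range M, c i j * ⟪X t, d i⟫ := by
      rw [Finset.mul_sum]; simp_rw [mul_assoc]
    rw [e, ← Finset.sum_mul]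
    have := (hμ.pos j).ne'
    simp only [Nat.add_one_sub_one, Nat.cast_ofNat, pow_one]
    field_simp
  have hanti : Antitone E := antitone_of_deriv_nonpos (fun t => (hE t).differentiableAt) fun t => by
    rw [(hE t).deriv]
    have := hC.sum_nonneg fun i => ⟪X t, d i⟫
    linarith
  -- Since `E' = -2 ⟪C X, X⟫`, half the decrease of `E` is the required primitive `q`. The radius
  -- comes from `lam M * ‖X t‖² ≤ E t ≤ E 0`, as `lam M` bounds the eigenvalues of the block from
  -- below.
  refine ⟨X, fun t => (E 0 - E t) / 2, Real.sqrt ((lam M)⁻¹ * E 0), hX0, by simp, hXc, hXM,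
    fun t ht => ?_, fun t ht => ?_, hXd, fun t => ?_⟩
  · refine Real.le_sqrt_of_sq_le ?_
    rw [← real_inner_self_eq_norm_sq, inner_eq_sum_of_mem_firstSpan (hXM t)]
    have h1 : lam M * ∑ i ∈ Finset.range M, ⟪X t, d i⟫ * ⟪X t, d i⟫ ≤ E t := by
      rw [Finset.mul_sum]
      refine Finset.sum_le_sum fun j hj => ?_
      rw [pow_two]
      exact mul_le_mul_of_nonneg_right (hμ.antitone (Finset.mem_range.1 hj).le) (mul_self_nonneg _)
    rw [inv_mul_eq_div, le_div_iff₀ (hμ.pos M)]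
    linarith [hanti ht]
  · have := hanti ht
    simp only
    linarith
  · refine (((hasDerivAt_const t (E 0)).sub (hE t)).div_const 2).congr_deriv ?_
    ring

/-- Plane waves lie in the range of `l - N` on the cylinder functions. -/
theorem exists_resolvent_wave {l : ℝ} (hl : 0 < l) {h : U} (hh : h ∈ firstSpan d M) (θ : ℝ) :
    ∃ f ∈ cylinder d, DependsOnFirst d M f ∧
      ∀ u, l * f u - opN μ d C f u = Real.cos (⟪h, u⟫ + θ) := by
  obtain ⟨X, q, R, hX0, hq0, hXc, hXM, hXR, hq, hXd, hqd⟩ := exists_bounded_flow hμ hC hh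
  let ρ : Measure ℝ := volume.restrict (Set.Ioi 0)
  -- Mehler's formula: the semigroup of `N` turns the wave with vector `h` into `exp (-q t)` times
  -- the wave with vector `X t`. The extra factor `exp (-l t)` makes the integral over `t > 0` the
  -- resolvent.
  let w : ℝ → ℝ := fun t => Real.exp (-l * t - q t)
  have hqc : Continuous q := continuous_iff_continuousAt.2 fun t => (hqd t).continuousAt
  have hwle : ∀ t, 0 ≤ t → w t ≤ Real.exp (-l * t) := fun t ht =>
    Real.exp_le_exp.2 (by linarith [hq t ht])
  have hw : Integrable w ρ := by
    refine Integrable.mono' (exp_neg_integrableOn_Ioi 0 hl)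
      (by have : Continuous w := by fun_prop
          exact this.aestronglyMeasurable) ?_
    refine (ae_restrict_mem measurableSet_Ioi).mono fun t ht => ?_
    rw [Real.norm_of_nonneg (Real.exp_nonneg _)]
    exact hwle t (le_of_lt ht)
  have hR : ∀ᵐ t ∂ρ, ‖X t‖ ≤ R :=
    (ae_restrict_mem measurableSet_Ioi).mono fun t ht => hXR t (le_of_lt ht)
  obtain ⟨hf, hfM⟩ := waveIntegral_mem_cylinder hw (fun t => Real.exp_nonneg _) hXc hR hXM θ
  refine ⟨_, hf, hfM, fun u => ?_⟩
  have hw1 : ∀ i, Integrable (fun t => w t * ⟪X t, d i⟫) ρ := fun i =>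
    (hasDerivAt_waveIntegral (d := d) hw hXc hR θ u i).1
  have hw2 : ∀ i j, Integrable (fun t => w t * ⟪X t, d i⟫ * ⟪X t, d j⟫) ρ := fun i j =>
    (hasDerivAt_waveIntegral (d := d) (hw1 i) hXc hR θ u j).1
  have hpd1 : ∀ i, pd d i (waveIntegral ρ w X θ) =
      waveIntegral ρ (fun t => w t * ⟪X t, d i⟫) X (θ + Real.pi / 2) := fun i => by
    ext v
    exact pd_eq_of_hasDerivAt (differentiable_of_mem_cylinder hf)
      (hasDerivAt_waveIntegral (d := d) hw hXc hR θ v i).2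
  have hpd2 : ∀ i j v, pd d j (pd d i (waveIntegral ρ w X θ)) v =
      waveIntegral ρ (fun t => w t * ⟪X t, d i⟫ * ⟪X t, d j⟫) X (θ + Real.pi / 2 + Real.pi / 2) v :=
    fun i j v => by
      refine pd_eq_of_hasDerivAt (differentiable_of_mem_cylinder (pd_mem_cylinder hf i)) ?_
      rw [hpd1]
      exact (hasDerivAt_waveIntegral (d := d) (hw1 i) hXc hR _ v j).2
  have i0 := integrable_wave hw hXc θ u
  have i1 : ∀ i, Integrable (fun t => w t * ⟪X t, d i⟫ * Real.sin (⟪X t, u⟫ + θ)) ρ := fun i => by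
    have := integrable_wave (hw1 i) hXc (θ - Real.pi / 2) u
    simpa only [← add_sub_assoc, Real.cos_sub_pi_div_two] using this
  have i2 : ∀ i j, Integrable (fun t => -(w t * ⟪X t, d i⟫ * ⟪X t, d j⟫ * Real.cos (⟪X t, u⟫ + θ))) ρ :=
    fun i j => (integrable_wave (hw2 i j) hXc θ u).neg
  have v1 : ∀ i, pd d i (waveIntegral ρ w X θ) u =
      -∫ t, w t * ⟪X t, d i⟫ * Real.sin (⟪X t, u⟫ + θ) ∂ρ := fun i => by
    rw [hpd1, waveIntegral, ← integral_neg]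
    simp only [← add_assoc, Real.cos_add_pi_div_two, mul_neg]
  have v2 : ∀ i j, pd d j (pd d i (waveIntegral ρ w X θ)) u =
      -∫ t, w t * ⟪X t, d i⟫ * ⟪X t, d j⟫ * Real.cos (⟪X t, u⟫ + θ) ∂ρ := fun i j => by
    rw [hpd2, waveIntegral, ← integral_neg]
    simp only [← add_assoc, Real.cos_add_pi_div_two, Real.sin_add_pi_div_two, mul_neg]
  -- the integrand is a total derivative
  let D : ℝ → ℝ := fun t => l * (w t * Real.cos (⟪X t, u⟫ + θ)) -
    ∑ i ∈ Finset.range M, ∑ j ∈ Finset.range M, c i j *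
      (-(w t * ⟪X t, d i⟫ * ⟪X t, d j⟫ * Real.cos (⟪X t, u⟫ + θ)) +
        (lam j)⁻¹ * (⟪u, d j⟫ * (w t * ⟪X t, d i⟫ * Real.sin (⟪X t, u⟫ + θ))))
  have iterm : ∀ i j, Integrable (fun t => c i j *
      (-(w t * ⟪X t, d i⟫ * ⟪X t, d j⟫ * Real.cos (⟪X t, u⟫ + θ)) +
        (lam j)⁻¹ * (⟪u, d j⟫ * (w t * ⟪X t, d i⟫ * Real.sin (⟪X t, u⟫ + θ))))) ρ := fun i j =>
    ((i2 i j).add (((i1 i).const_mul _).const_mul _)).const_mul _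
  have isum : Integrable (fun t => ∑ i ∈ Finset.range M, ∑ j ∈ Finset.range M, c i j *
      (-(w t * ⟪X t, d i⟫ * ⟪X t, d j⟫ * Real.cos (⟪X t, u⟫ + θ)) +
        (lam j)⁻¹ * (⟪u, d j⟫ * (w t * ⟪X t, d i⟫ * Real.sin (⟪X t, u⟫ + θ))))) ρ :=
    integrable_finsetSum _ fun i _ => integrable_finsetSum _ fun j _ => iterm i j
  have hDint : Integrable D ρ := (i0.const_mul l).sub isum
  have hDval : ∫ t, D t ∂ρ = l * waveIntegral ρ w X θ u - opN μ d C (waveIntegral ρ w X θ) u := by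
    rw [hC.opN_eq hμ hf hfM, integral_sub (i0.const_mul l) isum, integral_const_mul,
      integral_finsetSum _ fun i _ => integrable_finsetSum _ fun j _ => iterm i j]
    congr 1
    refine Finset.sum_congr rfl fun i _ => ?_
    rw [integral_finsetSum _ fun j _ => iterm i j]
    refine Finset.sum_congr rfl fun j _ => ?_
    rw [integral_const_mul, integral_add (i2 i j) (((i1 i).const_mul _).const_mul _),
      integral_neg, integral_const_mul, integral_const_mul, ld, v1, v2]
    ring
  have hder : ∀ t, HasDerivAt (fun t => w t * Real.cos (⟪X t, u⟫ + θ)) (-D t) t := fun t => by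
    have a1 : HasDerivAt w (w t * (-l - ∑ i ∈ Finset.range M, ∑ j ∈ Finset.range M,
        c i j * ⟪X t, d i⟫ * ⟪X t, d j⟫)) t := by
      have : HasDerivAt (fun t => -l * t - q t) (-l - ∑ i ∈ Finset.range M, ∑ j ∈ Finset.range M,
          c i j * ⟪X t, d i⟫ * ⟪X t, d j⟫) t := by
        have := ((hasDerivAt_id t).const_mul (-l)).sub (hqd t)
        rwa [mul_one] at this
      exact this.exp
    have a2 : HasDerivAt (fun t => ⟪X t, u⟫ + θ) (-∑ i ∈ Finset.range M, ∑ j ∈ Finset.range M,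
        c i j * ((lam j)⁻¹ * (⟪u, d j⟫ * ⟪X t, d i⟫))) t := by
      have := ((hXd t).inner ℝ (hasDerivAt_const t u)).add_const θ
      refine this.congr_deriv ?_
      rw [inner_zero_right, zero_add, inner_neg_left, sum_inner, Finset.sum_comm]
      congr 1
      refine Finset.sum_congr rfl fun j _ => ?_
      rw [real_inner_smul_left, Finset.sum_mul]
      refine Finset.sum_congr rfl fun i _ => ?_
      rw [real_inner_comm u (d j)]; ring
    refine (a1.mul a2.cos).congr_deriv ?_
    have e : ∀ (p s : ℝ), ∑ i ∈ Finset.range M, ∑ j ∈ Finset.range M, c i j *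
        (-(w t * ⟪X t, d i⟫ * ⟪X t, d j⟫ * p) + (lam j)⁻¹ * (⟪u, d j⟫ * (w t * ⟪X t, d i⟫ * s))) =
        -(w t * p * ∑ i ∈ Finset.range M, ∑ j ∈ Finset.range M, c i j * ⟪X t, d i⟫ * ⟪X t, d j⟫) +
        w t * s * ∑ i ∈ Finset.range M, ∑ j ∈ Finset.range M,
          c i j * ((lam j)⁻¹ * (⟪u, d j⟫ * ⟪X t, d i⟫)) := fun p s => by
      rw [Finset.mul_sum, Finset.mul_sum, ← Finset.sum_neg_distrib, ← Finset.sum_add_distrib]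
      refine Finset.sum_congr rfl fun i _ => ?_
      rw [Finset.mul_sum, Finset.mul_sum, ← Finset.sum_neg_distrib, ← Finset.sum_add_distrib]
      refine Finset.sum_congr rfl fun j _ => ?_
      ring
    simp only [D]
    rw [e]
    ring
  have hlim : Tendsto (fun t => w t * Real.cos (⟪X t, u⟫ + θ)) atTop (𝓝 0) := by
    refine squeeze_zero_norm' (a := fun t => Real.exp (-l * t)) ?_ ?_
    · filter_upwards [eventually_ge_atTop 0] with t ht
      rw [norm_mul, Real.norm_of_nonneg (Real.exp_nonneg _)]
      exact (mul_le_of_le_one_right (Real.exp_nonneg _) (Real.abs_cos_le_one _)).trans (hwle t ht)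
    · refine Real.tendsto_exp_atBot.comp ?_
      exact tendsto_id.const_mul_atTop_of_neg (by linarith)
  -- Only the boundary value at `0` remains; it is the given plane wave, as `w 0 = 1` and `X 0 = h`.
  have hfin := integral_Ioi_of_hasDerivAt_of_tendsto' (a := 0) (fun t _ => hder t) hDint.neg hlim
  rw [integral_neg] at hfin
  rw [← hDval]
  have hw0 : w 0 = 1 := by simp [w, hq0]
  rw [hw0, hX0] at hfin
  change -∫ t, D t ∂ρ = _ at hfin
  linarith

end Resolvent

/-! ### Weak derivatives and integration by parts against `exp (-f)` -/

/-- The exponential `x ↦ exp (-x)` on `[c, ∞)` extends to a function of class `C¹` on `ℝ` that is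
Lipschitz together with its derivative. -/
theorem exists_lipschitz_exp_neg (c : ℝ) : ∃ (θ θ' : ℝ → ℝ) (L : ℝ), 0 ≤ L ∧
    (∀ x, HasDerivAt θ (θ' x) x) ∧ Continuous θ' ∧
    (∀ x y, |θ x - θ y| ≤ L * |x - y|) ∧ (∀ x y, |θ' x - θ' y| ≤ L * |x - y|) ∧
    ∀ x, c ≤ x → θ x = Real.exp (-x) ∧ θ' x = -Real.exp (-x) := by
  -- Freezing the slope below `c` continues the exponential affinely. Both `θ` and `θ'` are then
  -- Lipschitz with constant `exp (-c)`.
  let θ' : ℝ → ℝ := fun x => -Real.exp (-max x c)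
  have hc : Continuous θ' := by fun_prop
  let θ : ℝ → ℝ := fun x => Real.exp (-c) + ∫ t in c..x, θ' t
  have hd : ∀ x, HasDerivAt θ (θ' x) x := fun x =>
    (hc.integral_hasStrictDerivAt c x).hasDerivAt.const_add _
  have hb : ∀ x, |θ' x| ≤ Real.exp (-c) := fun x => by
    simp only [θ', abs_neg, Real.abs_exp]
    exact Real.exp_le_exp.2 (neg_le_neg (le_max_right _ _))
  refine ⟨θ, θ', Real.exp (-c), (Real.exp_pos _).le, hd, hc, fun x y => ?_, fun x y => ?_,
    fun x hx => ⟨?_, by simp only [θ', max_eq_left hx]⟩⟩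
  · exact convex_univ.norm_image_sub_le_of_norm_hasDerivWithin_le
      (fun x _ => (hd x).hasDerivWithinAt) (fun x _ => hb x) (Set.mem_univ y) (Set.mem_univ x)
  · have h1 : ∀ z, HasDerivAt (fun z : ℝ => -Real.exp (-z)) (Real.exp (-z)) z := fun z => by
      have := ((hasDerivAt_neg z).exp).neg
      rw [mul_neg_one, neg_neg] at this
      exact this
    have := (convex_Ici c).norm_image_sub_le_of_norm_hasDerivWithin_le
      (f := fun z : ℝ => -Real.exp (-z)) (C := Real.exp (-c))
      (fun z _ => (h1 z).hasDerivWithinAt)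
      (fun z hz => by
        rw [Real.norm_of_nonneg (Real.exp_pos _).le]
        exact Real.exp_le_exp.2 (neg_le_neg hz))
      (le_max_right y c) (le_max_right x c)
    refine this.trans ?_
    gcongr
    exact abs_max_sub_max_le_abs x y c
  · have h1 : ∀ z, HasDerivAt (fun z : ℝ => Real.exp (-z)) (-Real.exp (-z)) z := fun z => by
      simpa using (hasDerivAt_neg z).exp
    have : ∫ t in c..x, θ' t = Real.exp (-x) - Real.exp (-c) := by
      rw [← intervalIntegral.integral_eq_sub_of_hasDerivAt (fun z _ => h1 z)
        (Continuous.intervalIntegrable (by fun_prop) _ _)]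
      refine intervalIntegral.integral_congr fun t ht => ?_
      rw [Set.uIcc_of_le hx] at ht
      simp only [θ', max_eq_left ht.1]
    simp only [θ, this]
    ring

theorem memLp_comp_of_lipschitz {X : Type*} [MeasurableSpace X] {μ : Measure X} [IsFiniteMeasure μ]
    {θ : ℝ → ℝ} {L : ℝ} (hθ : Continuous θ) (hL : ∀ x y, |θ x - θ y| ≤ L * |x - y|) {f : X → ℝ}
    (hf : MemLp f 2 μ) : MemLp (fun x => θ (f x)) 2 μ := by
  have h1 : MemLp (fun x => θ (f x) - θ 0) 2 μ :=
    hf.of_le_mul (c := L) ((hθ.comp_aestronglyMeasurable hf.1).sub aestronglyMeasurable_const)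
      (Eventually.of_forall fun x => by simpa using hL (f x) 0)
  exact (memLp_congr_ae (Eventually.of_forall fun x => by simp)).1 (h1.add (memLp_const (θ 0)))

section WeakDerivative

variable {U : Type*} [NormedAddCommGroup U] [InnerProductSpace ℝ U] [CompleteSpace U]
  [SecondCountableTopology U] [MeasurableSpace U] [BorelSpace U]
  {μ : Measure U} {d : HilbertBasis ℕ ℝ U} {lam : ℕ → ℝ} {M : ℕ}

/-- A plane wave is the superposition against a Dirac mass with constant wave vector. -/
theorem cos_mem_cylinder {h : U} (hh : h ∈ firstSpan d M) (θ : ℝ) :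
    (fun u => Real.cos (⟪u, h⟫ + θ)) ∈ cylinder d := by
  have := (waveIntegral_mem_cylinder (d := d) (ρ := Measure.dirac 0) (a := fun _ => 1)
    (X := fun _ => h) (R := ‖h‖) (integrable_const _) (fun _ => zero_le_one) continuous_const
    (Eventually.of_forall fun _ => le_rfl) (fun _ => hh) θ).1
  have e : waveIntegral (Measure.dirac 0) (fun _ => 1) (fun _ => h) θ =
      fun u => Real.cos (⟪u, h⟫ + θ) := by
    ext u
    simp [waveIntegral, real_inner_comm]
  rwa [e] at this

/-- Cylinder functions separate integrable functions. -/
theorem ae_eq_zero_of_forall_cylinder {ν : Measure U} [IsFiniteMeasure ν] {g : U → ℝ}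
    (hg : Integrable g ν) (h : ∀ F ∈ cylinder d, ∫ u, g u * F u ∂ν = 0) : g =ᵐ[ν] 0 := by
  refine ae_eq_zero_of_trigonometric hg (dense_iUnion_firstSpan d) (fun x hx => ?_) fun x hx => ?_
  · obtain ⟨n, hn⟩ := Set.mem_iUnion.1 hx
    simpa using h _ (cos_mem_cylinder hn 0)
  · obtain ⟨n, hn⟩ := Set.mem_iUnion.1 hx
    simpa [← sub_eq_add_neg, Real.cos_sub_pi_div_two] using h _ (cos_mem_cylinder hn (-(Real.pi / 2)))

/-- `g` is the weak derivative of `f` in the direction `∑ j < M, a j • d j`. -/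
def IsWeakDeriv (μ : Measure U) (d : HilbertBasis ℕ ℝ U) (lam : ℕ → ℝ) (M : ℕ) (a : ℕ → ℝ)
    (f g : U → ℝ) : Prop :=
  ∀ F ∈ cylinder d, ∫ u, g u * F u ∂μ = -∑ j ∈ Finset.range M, a j * ∫ u, ld d lam j F u * f u ∂μ

/-- Cylinder functions separate integrable functions. This uniqueness serves as closability of the
weighted gradients. -/
theorem IsWeakDeriv.unique [IsFiniteMeasure μ] {a : ℕ → ℝ} {f g g' : U → ℝ}
    (h : IsWeakDeriv μ d lam M a f g) (h' : IsWeakDeriv μ d lam M a f g') (hg : MemLp g 2 μ)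
    (hg' : MemLp g' 2 μ) : g =ᵐ[μ] g' := by
  have := ae_eq_zero_of_forall_cylinder (d := d) ((hg.sub hg').integrable one_le_two) fun F hF => by
    have hF2 : MemLp F 2 μ := memLp_of_mem_cylinder hF 2
    simp only [Pi.sub_apply, sub_mul]
    rw [integral_sub (integrable_mul_of_memLp_two hg hF2) (integrable_mul_of_memLp_two hg' hF2),
      h F hF, h' F hF, sub_self]
  filter_upwards [this] with u hu
  exact sub_eq_zero.1 hu

/-- Integrate by parts for the approximating cylinder functions and pass to the limit in `L²`. The
hypothesis on `w` requires one fixed finite combination of partial derivatives for all cylinder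
functions, so that the adjoint side is a fixed finite sum. -/
theorem IsSobolevGradient.isWeakDeriv (hμ : IsNondegenerateGaussian μ d lam) {T G : U → U}
    {f : U → ℝ} (h : IsSobolevGradient μ d T f G) {a : ℕ → ℝ} {w : U}
    (hw : ∀ F ∈ cylinder d, ∀ u, ⟪T (gradient F u), w⟫ = ∑ j ∈ Finset.range M, a j * pd d j F u) :
    IsWeakDeriv μ d lam M a f fun u => ⟪G u, w⟫ := by
  have := hμ.isProbabilityMeasure
  obtain ⟨hf, hG, fn, hfn, hTn, hlim, hGlim⟩ := h
  intro F hF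
  have hF2 : MemLp F 2 μ := memLp_of_mem_cylinder hF 2
  have h1 : Tendsto (fun n => ∫ u, ⟪T (gradient (fn n) u), w⟫ * F u ∂μ) atTop
      (𝓝 (∫ u, ⟪G u, w⟫ * F u ∂μ)) := by
    refine tendsto_integral_mul_const (hG.inner_const w) hF2 (fun n => (hTn n).inner_const w) ?_
    refine eLpNorm_tendsto_zero_of_le ‖w‖ (fun n => Eventually.of_forall fun u => ?_) hGlim
    rw [← inner_sub_left, mul_comm]
    exact norm_inner_le_norm _ _
  have h2 : Tendsto (fun n => -∑ j ∈ Finset.range M, a j * ∫ u, fn n u * ld d lam j F u ∂μ) atTop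
      (𝓝 (-∑ j ∈ Finset.range M, a j * ∫ u, f u * ld d lam j F u ∂μ)) := by
    refine (tendsto_finsetSum _ fun j _ => ?_).neg
    exact (tendsto_integral_mul_const hf (memLp_ld hμ hF j)
      (fun n => memLp_of_mem_cylinder (hfn n) 2) hlim).const_mul _
  have e : ∀ n, ∫ u, ⟪T (gradient (fn n) u), w⟫ * F u ∂μ =
      -∑ j ∈ Finset.range M, a j * ∫ u, fn n u * ld d lam j F u ∂μ := fun n => by
    simp_rw [hw _ (hfn n), Finset.sum_mul, mul_assoc]
    rw [integral_finsetSum _ fun j _ => (integrable_mul_of_memLp_two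
      (memLp_of_mem_cylinder (pd_mem_cylinder (hfn n) j) 2) hF2).const_mul _,
      ← Finset.sum_neg_distrib]
    refine Finset.sum_congr rfl fun j _ => ?_
    have := integral_ld_mul hμ hF (hfn n) j
    simp_rw [mul_comm (fn n _), integral_const_mul, mul_comm (pd d j (fn n) _), this]
    ring
  simp_rw [e] at h1
  simpa only [mul_comm] using tendsto_nhds_unique h1 h2

theorem IsWeakDeriv.ae_eq_sum [IsFiniteMeasure μ] {a : ℕ → ℝ} {f g : U → ℝ} {p : ℕ → U → ℝ}
    (h : IsWeakDeriv μ d lam M a f g) (hg : MemLp g 2 μ) (hp2 : ∀ j, MemLp (p j) 2 μ)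
    (hp : ∀ j, ∀ F ∈ cylinder d, ∫ u, p j u * F u ∂μ = -∫ u, ld d lam j F u * f u ∂μ) :
    g =ᵐ[μ] fun u => ∑ j ∈ Finset.range M, a j * p j u := by
  refine h.unique (fun F hF => ?_) hg (memLp_finsetSum _ fun j _ => (hp2 j).const_mul _)
  simp_rw [Finset.sum_mul, mul_assoc]
  rw [integral_finsetSum _ fun j _ => (integrable_mul_of_memLp_two (hp2 j)
    (memLp_of_mem_cylinder hF 2)).const_mul _, ← Finset.sum_neg_distrib]
  refine Finset.sum_congr rfl fun j _ => ?_
  rw [integral_const_mul, hp j F hF]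
  ring

/-- Integration by parts against the weight `exp (-f)` for a weakly differentiable `f`. -/
theorem integral_ld_mul_exp_neg (hμ : IsNondegenerateGaussian μ d lam) {f g F : U → ℝ} {c : ℝ}
    {fn : ℕ → U → ℝ} {j : ℕ} (hf : MemLp f 2 μ) (hg : MemLp g 2 μ) (hc : ∀ᵐ u ∂μ, c ≤ f u)
    (hfn : ∀ n, fn n ∈ cylinder d)
    (h1 : Tendsto (fun n => eLpNorm (fun u => fn n u - f u) 2 μ) atTop (𝓝 0))
    (h2 : Tendsto (fun n => eLpNorm (fun u => pd d j (fn n) u - g u) 2 μ) atTop (𝓝 0))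
    (hF : F ∈ cylinder d) :
    ∫ u, ld d lam j F u * Real.exp (-f u) ∂μ = ∫ u, F u * g u * Real.exp (-f u) ∂μ := by
  have := hμ.isProbabilityMeasure
  -- The bound `c ≤ f` need not hold for the approximants `fn n`, so `exp (-fn n)` is not
  -- controlled. The Lipschitz substitute is, and it agrees with the exponential at the values of
  -- `f`.
  obtain ⟨θ, θ', L, hL0, hd, hc', hL, hL', hexp⟩ := exists_lipschitz_exp_neg c
  have hcθ : Continuous θ := continuous_iff_continuousAt.2 fun x => (hd x).continuousAt
  have m : ∀ {h}, h ∈ cylinder d → MemLp h 2 μ := fun hh => memLp_of_mem_cylinder hh 2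
  have mθ : ∀ {h : U → ℝ}, MemLp h 2 μ → MemLp (fun u => θ (h u)) 2 μ :=
    memLp_comp_of_lipschitz hcθ hL
  have mθ' : ∀ {h : U → ℝ}, MemLp h 2 μ → MemLp (fun u => F u * θ' (h u)) 2 μ := fun hh =>
    memLp_mul_of_mem_cylinder hF (memLp_comp_of_lipschitz hc' hL' hh)
  have hn : ∀ n, ∫ u, θ (fn n u) * ld d lam j F u ∂μ =
      -∫ u, F u * θ' (fn n u) * pd d j (fn n) u ∂μ := fun n => by
    have i0 := integrable_mul_of_memLp_two (m hF) (mθ (m (hfn n)))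
    have i1 := integrable_mul_of_memLp_two (m (pd_mem_cylinder hF j)) (mθ (m (hfn n)))
    have i2 := integrable_mul_of_memLp_two (mθ' (m (hfn n))) (m (pd_mem_cylinder (hfn n) j))
    have i3 := integrable_mul_of_memLp_two (memLp_mul_of_mem_cylinder hF (hμ.memLp_coord j))
      (mθ (m (hfn n)))
    have hder : ∀ u, HasDerivAt (fun s : ℝ => F (u + s • d j) * θ (fn n (u + s • d j)))
        (pd d j F u * θ (fn n u) + F u * θ' (fn n u) * pd d j (fn n) u) 0 := fun u => by
      have a1 := hasDerivAt_pd (d := d) (differentiable_of_mem_cylinder hF) j u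
      have a2 := hasDerivAt_pd (d := d) (differentiable_of_mem_cylinder (hfn n)) j u
      have a3 := (hd (fn n (u + (0 : ℝ) • d j))).comp (0 : ℝ) a2
      refine (a1.mul a3).congr_deriv ?_
      simp only [Function.comp_apply, zero_smul, add_zero]
      ring
    have key := hμ.integral_deriv_eq (F' := fun u => pd d j F u * θ (fn n u) +
      F u * θ' (fn n u) * pd d j (fn n) u) j hder i0 (i1.add i2)
      (i3.congr (Eventually.of_forall fun u => by simp only; ring))
    rw [integral_add i1 i2] at key
    have e : ∀ u, θ (fn n u) * ld d lam j F u =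
        pd d j F u * θ (fn n u) - (lam j)⁻¹ * (F u * θ (fn n u) * ⟪u, d j⟫) := fun u => by
      rw [ld]; ring
    simp_rw [e]
    rw [integral_sub i1, integral_const_mul]
    · linarith
    · exact (i3.congr (Eventually.of_forall fun u => by simp only; ring)).const_mul _
  obtain ⟨B, hB0, hB⟩ := (smoothBdd_of_mem_cylinder hF).exists_bound
  have l1 : Tendsto (fun n => ∫ u, θ (fn n u) * ld d lam j F u ∂μ) atTop
      (𝓝 (∫ u, θ (f u) * ld d lam j F u ∂μ)) := by
    refine tendsto_integral_mul_const (mθ hf) (memLp_ld hμ hF j) (fun n => mθ (m (hfn n))) ?_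
    exact eLpNorm_tendsto_zero_of_le L (fun n => Eventually.of_forall fun u => hL _ _) h1
  have l2 : Tendsto (fun n => -∫ u, F u * θ' (fn n u) * pd d j (fn n) u ∂μ) atTop
      (𝓝 (-∫ u, F u * θ' (f u) * g u ∂μ)) := by
    refine (tendsto_integral_mul (mθ' hf) hg (fun n => mθ' (m (hfn n)))
      (fun n => m (pd_mem_cylinder (hfn n) j)) ?_ h2).neg
    refine eLpNorm_tendsto_zero_of_le (B * L) (fun n => Eventually.of_forall fun u => ?_) h1
    rw [← mul_sub, norm_mul, mul_assoc]
    exact mul_le_mul (hB u) (hL' _ _) (norm_nonneg _) hB0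
  simp_rw [hn] at l1
  have hfin := tendsto_nhds_unique l1 l2
  have e1 : ∫ u, ld d lam j F u * Real.exp (-f u) ∂μ = ∫ u, θ (f u) * ld d lam j F u ∂μ :=
    integral_congr_ae (hc.mono fun u hu => by simp only; rw [(hexp _ hu).1, mul_comm])
  have e2 : ∫ u, F u * g u * Real.exp (-f u) ∂μ = -∫ u, F u * θ' (f u) * g u ∂μ := by
    rw [← integral_neg]
    exact integral_congr_ae (hc.mono fun u hu => by simp only; rw [(hexp _ hu).2]; ring)
  rw [e1, e2, hfin]

end WeakDerivative

/-! ### The density of the Gibbs measure -/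

section Gibbs

variable {U : Type*} [MeasurableSpace U] {μ : Measure U} [IsProbabilityMeasure μ] {Φ : U → EReal}

/-- The Gibbs measure has a bounded positive density. -/
theorem exists_gibbs_density (hΦm : Measurable Φ) {c : ℝ} (hΦb : ∀ u, (c : EReal) ≤ Φ u)
    (hΦ : ∀ᵐ u ∂μ, Φ u ≠ ⊤) :
    ∃ z : ℝ, 0 < z ∧
      gibbs μ Φ = μ.withDensity (fun u => ENNReal.ofReal (z * Real.exp (-(Φ u).toReal))) ∧
      ∀ᵐ u ∂μ, c ≤ (Φ u).toReal := by
  have hcoe : ∀ᵐ u ∂μ, ((Φ u).toReal : EReal) = Φ u := by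
    filter_upwards [hΦ] with u hu
    exact EReal.coe_toReal hu (ne_bot_of_le_ne_bot (EReal.coe_ne_bot c) (hΦb u))
  have hexp : (fun u => EReal.exp (-Φ u)) =ᵐ[μ]
      fun u => ENNReal.ofReal (Real.exp (-(Φ u).toReal)) := by
    filter_upwards [hcoe] with u hu
    rw [← EReal.exp_coe, EReal.coe_neg, hu]
  have hm : Measurable fun u => ENNReal.ofReal (Real.exp (-(Φ u).toReal)) := by fun_prop
  have hcle : ∀ᵐ u ∂μ, c ≤ (Φ u).toReal := by
    filter_upwards [hcoe] with u hu
    have := hΦb u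
    rw [← hu] at this
    exact_mod_cast this
  set Z := ∫⁻ u, EReal.exp (-Φ u) ∂μ with hZ
  have hZe : Z = ∫⁻ u, ENNReal.ofReal (Real.exp (-(Φ u).toReal)) ∂μ := lintegral_congr_ae hexp
  have hZtop : Z ≠ ⊤ := by
    rw [hZe]
    refine ((lintegral_mono_ae (g := fun _ => ENNReal.ofReal (Real.exp (-c))) ?_).trans_lt ?_).ne
    · filter_upwards [hcle] with u hu
      exact ENNReal.ofReal_le_ofReal (Real.exp_le_exp.2 (neg_le_neg hu))
    · simp
  have hZ0 : Z ≠ 0 := by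
    rw [hZe]
    intro h
    rw [lintegral_eq_zero_iff hm] at h
    obtain ⟨u, hu⟩ := h.exists
    have : (0 : ℝ) < Real.exp (-(Φ u).toReal) := Real.exp_pos _
    simp at hu
    linarith
  refine ⟨Z⁻¹.toReal, ENNReal.toReal_pos (ENNReal.inv_ne_zero.2 hZtop) (ENNReal.inv_ne_top.2 hZ0),
    ?_, hcle⟩
  rw [gibbs, withDensity_congr_ae hexp, ← withDensity_smul _ hm]
  congr 1
  ext u
  rw [ENNReal.ofReal_mul ENNReal.toReal_nonneg, ENNReal.ofReal_toReal (ENNReal.inv_ne_top.2 hZ0)]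
  rfl

end Gibbs

/-! ### The vector field `C Df` and second-order regularity -/

section Flux

variable {U : Type*} [NormedAddCommGroup U] [InnerProductSpace ℝ U] [CompleteSpace U]
  [SecondCountableTopology U] [MeasurableSpace U] [BorelSpace U]
  {μ : Measure U} {d : HilbertBasis ℕ ℝ U} {lam : ℕ → ℝ} {C : U →ₗ.[ℝ] U} {c : ℕ → ℕ → ℝ} {M : ℕ}
  {f g : U → ℝ}

/-- The coordinates of the vector field `C Df`. -/
def flux (C : U →ₗ.[ℝ] U) (d : HilbertBasis ℕ ℝ U) (f : U → ℝ) (j : ℕ) (u : U) : ℝ :=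
  ⟪pval C (gradient f u), d j⟫

theorem pd_finset_sum {ι : Type*} (s : Finset ι) {F : ι → U → ℝ} (hF : ∀ i, Differentiable ℝ (F i))
    (a : ι → ℝ) (j : ℕ) (u : U) :
    pd d j (fun u => ∑ i ∈ s, a i * F i u) u = ∑ i ∈ s, a i * pd d j (F i) u := by
  simp only [pd]
  rw [fderiv_fun_sum fun i _ => (hF i u).const_mul (a i), sum_apply]
  refine Finset.sum_congr rfl fun i _ => ?_
  rw [fderiv_const_mul (hF i u)]
  rfl

theorem gradient_add (hf : f ∈ cylinder d) (hg : g ∈ cylinder d) (u : U) :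
    gradient (f + g) u = gradient f u + gradient g u :=
  ext_inner_basis (d := d) fun i => by
    rw [inner_add_left, inner_gradient, inner_gradient, inner_gradient,
      fderiv_add (differentiable_of_mem_cylinder hf u) (differentiable_of_mem_cylinder hg u)]
    rfl

theorem gradient_const_mul (hf : f ∈ cylinder d) (a : ℝ) (u : U) :
    gradient (fun u => a * f u) u = a • gradient f u :=
  ext_inner_basis (d := d) fun i => by
    rw [real_inner_smul_left, inner_gradient, inner_gradient,
      fderiv_const_mul (differentiable_of_mem_cylinder hf u)]
    rfl

namespace IsBlockOperator

variable (hC : IsBlockOperator C d c M)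
include hC

theorem pval_add {x y : U} (hx : x ∈ firstSpan d M) (hy : y ∈ firstSpan d M) :
    pval C (x + y) = pval C x + pval C y := by
  rw [pval_of_mem (hC.mem _ hx), pval_of_mem (hC.mem _ hy),
    pval_of_mem (hC.mem _ (Submodule.add_mem _ hx hy)), ← LinearPMap.map_add]
  rfl

theorem pval_smul {x : U} (hx : x ∈ firstSpan d M) (a : ℝ) : pval C (a • x) = a • pval C x := by
  rw [pval_of_mem (hC.mem _ hx), pval_of_mem (hC.mem _ (Submodule.smul_mem _ a hx)),
    ← LinearPMap.map_smul]
  rfl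

theorem flux_eq (hf : f ∈ cylinder d) (hM : DependsOnFirst d M f) {j : ℕ} (hj : j < M) :
    flux C d f j = fun u => ∑ i ∈ Finset.range M, c i j * pd d i f u := by
  ext u
  rw [flux, hC.inner_pval (gradient_mem_firstSpan hf hM u) hj]
  simp only [inner_gradient, pd]

theorem flux_eq_zero (hf : f ∈ cylinder d) (hM : DependsOnFirst d M f) {j : ℕ} (hj : M ≤ j) :
    flux C d f j = fun _ => 0 := by
  ext u
  exact mem_firstSpan_iff.1 (hC.pval_mem (gradient_mem_firstSpan hf hM u)) j hj

theorem flux_mem_cylinder (hf : f ∈ cylinder d) (hM : DependsOnFirst d M f) (j : ℕ) :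
    flux C d f j ∈ cylinder d := by
  rcases lt_or_ge j M with hj | hj
  · rw [hC.flux_eq hf hM hj]
    exact sum_mem_cylinder _ fun i _ => const_mul_mem_cylinder _ (pd_mem_cylinder hf i)
  · rw [hC.flux_eq_zero hf hM hj]
    exact const_mem_cylinder 0

theorem pd_flux (hf : f ∈ cylinder d) (hM : DependsOnFirst d M f) {j : ℕ} (hj : j < M) (l : ℕ)
    (u : U) : pd d l (flux C d f j) u = ∑ i ∈ Finset.range M, c i j * pd d l (pd d i f) u := by
  rw [hC.flux_eq hf hM hj]
  exact pd_finset_sum _ (fun i => differentiable_of_mem_cylinder (pd_mem_cylinder hf i)) _ _ _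

/-- Divergence form of `N`: the coefficients `c i j` are constant, so they pass through `ld`. -/
theorem opN_eq_sum_flux (hμ : IsNondegenerateGaussian μ d lam) (hf : f ∈ cylinder d)
    (hM : DependsOnFirst d M f) (u : U) :
    opN μ d C f u = ∑ j ∈ Finset.range M, ld d lam j (flux C d f j) u := by
  rw [hC.opN_eq hμ hf hM, Finset.sum_comm]
  refine Finset.sum_congr rfl fun j hj => ?_
  rw [ld, hC.pd_flux hf hM (Finset.mem_range.1 hj), hC.flux_eq hf hM (Finset.mem_range.1 hj),
    Finset.mul_sum, Finset.mul_sum, ← Finset.sum_sub_distrib]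
  refine Finset.sum_congr rfl fun i _ => ?_
  rw [ld]; ring

theorem inner_pval_gradient_eq (hf : f ∈ cylinder d) (hM : DependsOnFirst d M f) (u v : U) :
    ⟪pval C (gradient f u), v⟫ = ∑ j ∈ Finset.range M, flux C d f j u * ⟪v, d j⟫ :=
  inner_eq_sum_of_mem_firstSpan (hC.pval_mem (gradient_mem_firstSpan hf hM u)) v

theorem inner_pval_comm {x y : U} (hx : x ∈ firstSpan d M) (hy : y ∈ firstSpan d M) :
    ⟪pval C x, y⟫ = ⟪x, pval C y⟫ := by
  rw [inner_eq_sum_of_mem_firstSpan (hC.pval_mem hx), inner_eq_sum_of_mem_firstSpan hx]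
  have h1 : ∀ j ∈ Finset.range M, ⟪pval C x, d j⟫ * ⟪y, d j⟫ =
      ∑ i ∈ Finset.range M, c i j * ⟪x, d i⟫ * ⟪y, d j⟫ := fun j hj => by
    rw [hC.inner_pval hx (Finset.mem_range.1 hj), Finset.sum_mul]
  have h2 : ∀ i ∈ Finset.range M, ⟪x, d i⟫ * ⟪pval C y, d i⟫ =
      ∑ j ∈ Finset.range M, c i j * ⟪x, d i⟫ * ⟪y, d j⟫ := fun i hi => by
    rw [hC.inner_pval hy (Finset.mem_range.1 hi), Finset.mul_sum]
    refine Finset.sum_congr rfl fun j hj => ?_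
    rw [hC.symm (Finset.mem_range.1 hj) (Finset.mem_range.1 hi)]
    ring
  rw [Finset.sum_congr rfl h1, Finset.sum_congr rfl h2, Finset.sum_comm]

theorem inner_pval_self_nonneg {x : U} (hx : x ∈ firstSpan d M) : 0 ≤ ⟪pval C x, x⟫ := by
  rw [inner_eq_sum_of_mem_firstSpan (hC.pval_mem hx)]
  refine (hC.sum_nonneg fun i => ⟪x, d i⟫).trans_eq ?_
  rw [Finset.sum_comm]
  refine Finset.sum_congr rfl fun j hj => ?_
  rw [hC.inner_pval hx (Finset.mem_range.1 hj), Finset.sum_mul]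

/-- The trace of the square of the product of a positive semidefinite and a symmetric matrix is
nonnegative. -/
theorem trace_sq_nonneg (H : ℕ → ℕ → ℝ) (hH : ∀ i j, H i j = H j i) :
    0 ≤ ∑ j ∈ Finset.range M, ∑ l ∈ Finset.range M,
      (∑ i ∈ Finset.range M, c i j * H l i) * (∑ k ∈ Finset.range M, c k l * H j k) := by
  obtain ⟨b, hb⟩ := hC.factor
  let B : Matrix (Fin M) (Fin M) ℝ := Matrix.of fun p i => b p i
  let Hm : Matrix (Fin M) (Fin M) ℝ := Matrix.of fun i j => H i j
  have hc : ∀ i j : Fin M, c i j = (B.transpose * B) i j := fun i j => by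
    rw [hb i i.2 j j.2, Finset.sum_range, Matrix.mul_apply]
    rfl
  have hHt : Hm.transpose = Hm := by
    ext i j; exact hH j i
  -- Writing `c = Bᵀ B`, cyclicity of the trace turns the trace of `(C H)²` into that of the square
  -- of the symmetric matrix `B H Bᵀ`, a sum of squares.
  have key : ∑ j ∈ Finset.range M, ∑ l ∈ Finset.range M,
      (∑ i ∈ Finset.range M, c i j * H l i) * (∑ k ∈ Finset.range M, c k l * H j k) =
      ((B * Hm * B.transpose).transpose * (B * Hm * B.transpose)).trace := by
    have h1 : (B * Hm * B.transpose).transpose = B * Hm * B.transpose := by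
      simp [Matrix.transpose_mul, hHt, Matrix.mul_assoc]
    have h2 : ((B * Hm * B.transpose) * (B * Hm * B.transpose)).trace =
        ((B.transpose * B * Hm) * (B.transpose * B * Hm)).trace := by
      simpa only [Matrix.mul_assoc] using
        Matrix.trace_mul_comm (B * Hm * B.transpose * B * Hm) B.transpose
    rw [h1, h2, Matrix.trace, Finset.sum_range]
    refine Finset.sum_congr rfl fun j _ => ?_
    rw [Matrix.diag_apply, Matrix.mul_apply, Finset.sum_range]
    have e : ∀ j l : Fin M, (B.transpose * B * Hm) j l = ∑ i ∈ Finset.range M, c i j * H l i :=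
      fun j l => by
        rw [Matrix.mul_apply, Finset.sum_range]
        refine Finset.sum_congr rfl fun i _ => ?_
        rw [← hc, hC.symm j.2 i.2, hH l i]
        rfl
    refine Finset.sum_congr rfl fun l _ => ?_
    rw [e, e]
  rw [key, Matrix.trace]
  refine Finset.sum_nonneg fun i _ => ?_
  rw [Matrix.diag_apply, Matrix.mul_apply]
  exact Finset.sum_nonneg fun j _ => mul_self_nonneg _

variable (hμ : IsNondegenerateGaussian μ d lam) (hf : f ∈ cylinder d) (hM : DependsOnFirst d M f)
include hμ hf hM

/-- The second-order regularity estimate for `N`. -/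
theorem integral_sq_flux_le :
    ∫ u, ∑ j ∈ Finset.range M, (lam j)⁻¹ * flux C d f j u ^ 2 ∂μ ≤ ∫ u, opN μ d C f u ^ 2 ∂μ := by
  have := hμ.isProbabilityMeasure
  have hg := hC.flux_mem_cylinder hf hM
  have m : ∀ {h}, h ∈ cylinder d → MemLp h 2 μ := fun hh => memLp_of_mem_cylinder hh 2
  have i1 : ∀ j l, Integrable (fun u => pd d l (flux C d f j) u * pd d j (flux C d f l) u) μ :=
    fun j l => integrable_mul_of_memLp_two (m (pd_mem_cylinder (hg j) l))
      (m (pd_mem_cylinder (hg l) j))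
  have i2 : ∀ j, Integrable (fun u => (lam j)⁻¹ * flux C d f j u ^ 2) μ := fun j => by
    simp_rw [pow_two]
    exact (integrable_mul_of_memLp_two (m (hg j)) (m (hg j))).const_mul _
  -- Expand the square of the divergence form and apply `integral_ld_mul_ld`. The diagonal
  -- commutators produce the weighted square of the flux.
  have e1 : ∫ u, opN μ d C f u ^ 2 ∂μ =
      (∑ j ∈ Finset.range M, ∑ l ∈ Finset.range M,
        ∫ u, pd d l (flux C d f j) u * pd d j (flux C d f l) u ∂μ) +
      ∑ j ∈ Finset.range M, ∫ u, (lam j)⁻¹ * flux C d f j u ^ 2 ∂μ := by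
    simp_rw [hC.opN_eq_sum_flux hμ hf hM, pow_two, Finset.sum_mul_sum]
    have i0 : ∀ j l, Integrable (fun u => ld d lam j (flux C d f j) u * ld d lam l (flux C d f l) u) μ :=
      fun j l => integrable_mul_of_memLp_two (memLp_ld hμ (hg j) j) (memLp_ld hμ (hg l) l)
    rw [integral_finsetSum _ fun j _ => integrable_finsetSum _ fun l _ => i0 j l,
      ← Finset.sum_add_distrib]
    refine Finset.sum_congr rfl fun j hj => ?_
    rw [integral_finsetSum _ fun l _ => i0 j l]
    simp_rw [integral_ld_mul_ld hμ (hg _) (hg _)]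
    rw [Finset.sum_add_distrib]
    congr 1
    simp only [ite_mul, zero_mul]
    rw [Finset.sum_ite_eq, if_pos hj, integral_const_mul]
  have e2 : 0 ≤ ∑ j ∈ Finset.range M, ∑ l ∈ Finset.range M,
      ∫ u, pd d l (flux C d f j) u * pd d j (flux C d f l) u ∂μ := by
    have : ∑ j ∈ Finset.range M, ∑ l ∈ Finset.range M,
        ∫ u, pd d l (flux C d f j) u * pd d j (flux C d f l) u ∂μ =
        ∫ u, ∑ j ∈ Finset.range M, ∑ l ∈ Finset.range M,
          pd d l (flux C d f j) u * pd d j (flux C d f l) u ∂μ := by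
      rw [integral_finsetSum _ fun j _ => integrable_finsetSum _ fun l _ => i1 j l]
      exact Finset.sum_congr rfl fun j _ => (integral_finsetSum _ fun l _ => i1 j l).symm
    rw [this]
    refine integral_nonneg fun u => ?_
    have := hC.trace_sq_nonneg (fun i j => pd d i (pd d j f) u)
      fun i j => congrFun (pd_comm hf i j) u
    refine this.trans_eq ?_
    refine Finset.sum_congr rfl fun j hj => Finset.sum_congr rfl fun l hl => ?_
    rw [hC.pd_flux hf hM (Finset.mem_range.1 hj), hC.pd_flux hf hM (Finset.mem_range.1 hl)]
  rw [integral_finsetSum _ fun j _ => i2 j, e1]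
  linarith

end IsBlockOperator

end Flux

/-! ### Drift operators in weighted `L²` spaces -/

section Weighted

variable {U : Type*} [NormedAddCommGroup U] [InnerProductSpace ℝ U] [CompleteSpace U]
  [SecondCountableTopology U] [MeasurableSpace U] [BorelSpace U]
  {μ ν : Measure U} {d : HilbertBasis ℕ ℝ U} {lam : ℕ → ℝ} {C : U →ₗ.[ℝ] U} {c : ℕ → ℕ → ℝ}
  {ρ : U → ℝ} {P : ℕ → U → ℝ} {A : (U → ℝ) → U → ℝ}

/-- The measure `ν` has the bounded positive density `ρ` with respect to `μ`, and `-P j` is its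
logarithmic derivative in the direction `d j` (relative to `μ`). -/
structure IsWeight (μ : Measure U) (d : HilbertBasis ℕ ℝ U) (lam : ℕ → ℝ) (ν : Measure U) (ρ : U → ℝ)
    (P : ℕ → U → ℝ) : Prop where
  measurable : Measurable ρ
  pos : ∀ u, 0 < ρ u
  bounded : ∃ K, ∀ᵐ u ∂μ, ρ u ≤ K
  eq_withDensity : ν = μ.withDensity fun u => ENNReal.ofReal (ρ u)
  memLp : ∀ j, MemLp (P j) 2 μ
  ibp : ∀ j, ∀ F ∈ cylinder d, ∫ u, ld d lam j F u * ρ u ∂μ = ∫ u, F u * P j u * ρ u ∂μ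

namespace IsWeight

variable (hν : IsWeight μ d lam ν ρ P)
include hν

theorem integral_eq (h : U → ℝ) : ∫ u, h u ∂ν = ∫ u, h u * ρ u ∂μ := by
  rw [hν.eq_withDensity, integral_withDensity_eq_integral_toReal_smul hν.measurable.ennreal_ofReal
    (Eventually.of_forall fun _ => ENNReal.ofReal_lt_top)]
  refine integral_congr_ae (Eventually.of_forall fun u => ?_)
  simp only [ENNReal.toReal_ofReal (hν.pos u).le, smul_eq_mul, mul_comm]

theorem exists_le : ∃ K : ℝ≥0∞, K ≠ ⊤ ∧ ν ≤ K • μ := by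
  obtain ⟨K, hK⟩ := hν.bounded
  refine ⟨ENNReal.ofReal K, ENNReal.ofReal_ne_top, ?_⟩
  rw [hν.eq_withDensity, ← withDensity_const]
  exact withDensity_mono (hK.mono fun u hu => ENNReal.ofReal_le_ofReal hu)

theorem absolutelyContinuous : ν ≪ μ := by
  rw [hν.eq_withDensity]; exact withDensity_absolutelyContinuous _ _

theorem memLp_of_memLp {E : Type*} [NormedAddCommGroup E] {h : U → E} {p : ℝ≥0∞}
    (hh : MemLp h p μ) : MemLp h p ν := by
  obtain ⟨K, hK, hle⟩ := hν.exists_le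
  exact hh.of_measure_le_smul hK hle

theorem isFiniteMeasure [IsFiniteMeasure μ] : IsFiniteMeasure ν := by
  obtain ⟨K, hK, hle⟩ := hν.exists_le
  refine ⟨(hle Set.univ).trans_lt ?_⟩
  simpa using ENNReal.mul_lt_top hK.lt_top (measure_lt_top μ Set.univ)

theorem tendsto_eLpNorm {fn : ℕ → U → ℝ} (h : Tendsto (fun n => eLpNorm (fn n) 2 μ) atTop (𝓝 0)) :
    Tendsto (fun n => eLpNorm (fn n) 2 ν) atTop (𝓝 0) := by
  obtain ⟨K, hK, hle⟩ := hν.exists_le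
  have h0 : Tendsto (fun n => K ^ (1 / (2 : ℝ≥0∞)).toReal * eLpNorm (fn n) 2 μ) atTop (𝓝 0) := by
    have := ENNReal.Tendsto.const_mul h
      (Or.inr (ENNReal.rpow_ne_top_of_nonneg (y := (1 / (2 : ℝ≥0∞)).toReal) (by simp) hK))
    simpa using this
  refine tendsto_of_tendsto_of_tendsto_of_le_of_le tendsto_const_nhds h0 (fun _ => zero_le)
    fun n => ?_
  refine (eLpNorm_mono_measure _ hle).trans_eq ?_
  rw [eLpNorm_smul_measure_of_ne_top (by simp), smul_eq_mul]

theorem integral_ld (j : ℕ) {F : U → ℝ} (hF : F ∈ cylinder d) :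
    ∫ u, ld d lam j F u ∂ν = ∫ u, F u * P j u ∂ν := by
  rw [hν.integral_eq, hν.integral_eq]; exact hν.ibp j F hF

/-- A function in `L²(ν)`, multiplied by the density, lies in `L²(μ)`. -/
theorem memLp_mul_density (v : Lp ℝ 2 ν) : MemLp (fun u => v u * ρ u) 2 μ := by
  obtain ⟨K, hK⟩ := hν.bounded
  have hm : AEStronglyMeasurable (fun u => v u * ρ u) μ :=
    ((Lp.stronglyMeasurable v).measurable.mul hν.measurable).aestronglyMeasurable
  have key : ∀ h : U → ℝ, Integrable h ν →
      Integrable (fun u => (ENNReal.ofReal (ρ u)).toReal • h u) μ := fun h hh => by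
    rw [hν.eq_withDensity] at hh
    exact (integrable_withDensity_iff_integrable_smul' hν.measurable.ennreal_ofReal
      (Eventually.of_forall fun _ => ENNReal.ofReal_lt_top)).1 hh
  have h1 := key (fun u => v u ^ 2) (Lp.memLp v).integrable_sq
  rw [memLp_two_iff_integrable_sq hm]
  refine (h1.const_mul K).mono' (hm.pow 2) ?_
  filter_upwards [hK] with u hu
  have hp := (hν.pos u).le
  rw [Real.norm_of_nonneg (sq_nonneg _), ENNReal.toReal_ofReal hp, smul_eq_mul, mul_pow]
  -- One factor of the density is absorbed by its upper bound; the other turns `v ^ 2` into an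
  -- integrand for `ν`.
  have : ρ u * (ρ u * v u ^ 2) ≤ K * (ρ u * v u ^ 2) := by gcongr
  nlinarith

end IsWeight

/-- `A` is the operator `N` perturbed by the drift `-P`. -/
def IsDriftOperator (d : HilbertBasis ℕ ℝ U) (lam : ℕ → ℝ) (C : U →ₗ.[ℝ] U) (c : ℕ → ℕ → ℝ)
    (P : ℕ → U → ℝ) (A : (U → ℝ) → U → ℝ) : Prop :=
  ∀ f ∈ cylinder d, ∀ M, IsBlockOperator C d c M → DependsOnFirst d M f → ∀ u,
    A f u = ∑ j ∈ Finset.range M, (ld d lam j (flux C d f j) u - P j u * flux C d f j u)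

variable {f g : U → ℝ}

/-- A single block large enough for both functions reduces statements about pairs to finite
matrices. -/
theorem exists_block (hblock : ∀ n, ∃ M, n ≤ M ∧ IsBlockOperator C d c M) (hf : f ∈ cylinder d)
    (hg : g ∈ cylinder d) :
    ∃ M, IsBlockOperator C d c M ∧ DependsOnFirst d M f ∧ DependsOnFirst d M g := by
  obtain ⟨n, hn⟩ := exists_dependsOnFirst hf
  obtain ⟨k, hk⟩ := exists_dependsOnFirst hg
  obtain ⟨M, hM, hC⟩ := hblock (max n k)
  exact ⟨M, hC, hn.mono ((le_max_left _ _).trans hM), hk.mono ((le_max_right _ _).trans hM)⟩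

theorem DependsOnFirst.add {M : ℕ} (hf : DependsOnFirst d M f) (hg : DependsOnFirst d M g) :
    DependsOnFirst d M (f + g) := fun u v huv => by
  simp [hf u v huv, hg u v huv]

theorem DependsOnFirst.const_mul {M : ℕ} (hf : DependsOnFirst d M f) (a : ℝ) :
    DependsOnFirst d M (fun u => a * f u) := fun u v huv => by
  simp only [hf u v huv]

variable (hμ : IsNondegenerateGaussian μ d lam)
  (hblock : ∀ n, ∃ M, n ≤ M ∧ IsBlockOperator C d c M)

section

variable (hA : IsDriftOperator d lam C c P A)
include hblock hA

theorem drift_add (hf : f ∈ cylinder d) (hg : g ∈ cylinder d) : A (f + g) = A f + A g := by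
  obtain ⟨M, hC, hfM, hgM⟩ := exists_block hblock hf hg
  ext u
  rw [Pi.add_apply, hA _ (add_mem_cylinder hf hg) M hC (hfM.add hgM), hA _ hf M hC hfM,
    hA _ hg M hC hgM, ← Finset.sum_add_distrib]
  refine Finset.sum_congr rfl fun j _ => ?_
  have e : flux C d (f + g) j = flux C d f j + flux C d g j := by
    ext v
    rw [Pi.add_apply, flux, flux, flux, gradient_add hf hg,
      hC.pval_add (gradient_mem_firstSpan hf hfM v) (gradient_mem_firstSpan hg hgM v),
      inner_add_left]
  rw [e, ld, ld, ld, pd_add (differentiable_of_mem_cylinder (hC.flux_mem_cylinder hf hfM j))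
    (differentiable_of_mem_cylinder (hC.flux_mem_cylinder hg hgM j))]
  simp only [Pi.add_apply]
  ring

theorem drift_const_mul (hf : f ∈ cylinder d) (a : ℝ) : A (fun u => a * f u) = fun u => a * A f u := by
  obtain ⟨M, hC, hfM, -⟩ := exists_block hblock hf hf
  ext u
  rw [hA _ (const_mul_mem_cylinder a hf) M hC (hfM.const_mul a), hA _ hf M hC hfM, Finset.mul_sum]
  refine Finset.sum_congr rfl fun j _ => ?_
  have e : flux C d (fun u => a * f u) j = fun u => a * flux C d f j u := by
    ext v
    rw [flux, flux, gradient_const_mul hf, hC.pval_smul (gradient_mem_firstSpan hf hfM v),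
      real_inner_smul_left]
  rw [e, ld, ld, pd_const_mul (differentiable_of_mem_cylinder (hC.flux_mem_cylinder hf hfM j))]
  ring

end

section

variable (hP : ∀ j, MemLp (P j) 2 μ) (hA : IsDriftOperator d lam C c P A)
include hμ hblock hP hA

theorem memLp_drift (hf : f ∈ cylinder d) : MemLp (A f) 2 μ := by
  obtain ⟨M, hC, hfM, -⟩ := exists_block hblock hf hf
  have e : A f = fun u => ∑ j ∈ Finset.range M,
      (ld d lam j (flux C d f j) u - P j u * flux C d f j u) := funext fun u => hA _ hf M hC hfM u
  rw [e]
  refine memLp_finsetSum _ fun j _ => (memLp_ld hμ (hC.flux_mem_cylinder hf hfM j) j).sub ?_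
  simpa only [mul_comm] using memLp_mul_of_mem_cylinder (hC.flux_mem_cylinder hf hfM j) (hP j)

end

section

variable (hν : IsWeight μ d lam ν ρ P) (hA : IsDriftOperator d lam C c P A)
include hμ hblock hν

theorem integrable_inner_gradient (hf : f ∈ cylinder d) (hg : g ∈ cylinder d) :
    Integrable (fun u => ⟪pval C (gradient f u), gradient g u⟫) ν := by
  have := hμ.isProbabilityMeasure
  have := hν.isFiniteMeasure
  obtain ⟨M, hC, hfM, hgM⟩ := exists_block hblock hf hg
  simp_rw [hC.inner_pval_gradient_eq hf hfM, inner_gradient]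
  exact integrable_finsetSum _ fun j _ => integrable_mul_of_memLp_two
    (memLp_of_mem_cylinder (hC.flux_mem_cylinder hf hfM j) 2)
    (memLp_of_mem_cylinder (pd_mem_cylinder hg j) 2)

include hA

/-- The integration by parts formula. -/
theorem integral_drift_mul (hf : f ∈ cylinder d) (hg : g ∈ cylinder d) :
    ∫ u, A f u * g u ∂ν = ∫ u, -⟪pval C (gradient f u), gradient g u⟫ ∂ν := by
  have := hμ.isProbabilityMeasure
  have := hν.isFiniteMeasure
  obtain ⟨M, hC, hfM, hgM⟩ := exists_block hblock hf hg
  have hF := hC.flux_mem_cylinder hf hfM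
  have m : ∀ {h}, h ∈ cylinder d → MemLp h 2 ν := fun hh => memLp_of_mem_cylinder hh 2
  have i1 : ∀ j, Integrable (ld d lam j (flux C d f j * g)) ν := fun j =>
    (hν.memLp_of_memLp (memLp_ld hμ (mul_mem_cylinder (hF j) hg) j)).integrable one_le_two
  have i2 : ∀ j, Integrable (fun u => flux C d f j u * pd d j g u) ν := fun j =>
    integrable_mul_of_memLp_two (m (hF j)) (m (pd_mem_cylinder hg j))
  have i3 : ∀ j, Integrable (fun u => (flux C d f j * g) u * P j u) ν := fun j =>
    integrable_mul_of_memLp_two (m (mul_mem_cylinder (hF j) hg)) (hν.memLp_of_memLp (hν.memLp j))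
  have e : ∀ u, A f u * g u = ∑ j ∈ Finset.range M, (ld d lam j (flux C d f j * g) u -
      flux C d f j u * pd d j g u - (flux C d f j * g) u * P j u) := fun u => by
    rw [hA _ hf M hC hfM, Finset.sum_mul]
    refine Finset.sum_congr rfl fun j _ => ?_
    rw [ld, ld, pd_mul (differentiable_of_mem_cylinder (hF j)) (differentiable_of_mem_cylinder hg)]
    simp only [Pi.mul_apply]
    ring
  have i4 : ∀ j, Integrable (fun u => ld d lam j (flux C d f j * g) u -
      flux C d f j u * pd d j g u) ν := fun j => (i1 j).sub (i2 j)
  have i5 : ∀ j, Integrable (fun u => ld d lam j (flux C d f j * g) u -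
      flux C d f j u * pd d j g u - (flux C d f j * g) u * P j u) ν := fun j => (i4 j).sub (i3 j)
  have e' : ∀ u, -⟪pval C (gradient f u), gradient g u⟫ =
      ∑ j ∈ Finset.range M, -(flux C d f j u * pd d j g u) := fun u => by
    rw [hC.inner_pval_gradient_eq hf hfM, Finset.sum_neg_distrib]
    exact congrArg _ (Finset.sum_congr rfl fun j _ => by rw [inner_gradient, pd])
  simp_rw [e, e']
  rw [integral_finsetSum _ fun j _ => i5 j, integral_finsetSum _ fun j _ => (i2 j).fun_neg]
  refine Finset.sum_congr rfl fun j _ => ?_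
  rw [integral_sub (i4 j) (i3 j), integral_sub (i1 j) (i2 j), integral_neg,
    hν.integral_ld j (mul_mem_cylinder (hF j) hg)]
  ring

theorem integral_drift_mul_comm (hf : f ∈ cylinder d) (hg : g ∈ cylinder d) :
    ∫ u, A f u * g u ∂ν = ∫ u, f u * A g u ∂ν := by
  obtain ⟨M, hC, hfM, hgM⟩ := exists_block hblock hf hg
  simp_rw [mul_comm (f _)]
  rw [integral_drift_mul hμ hblock hν hA hf hg, integral_drift_mul hμ hblock hν hA hg hf]
  congr 1
  ext u
  rw [hC.inner_pval_comm (gradient_mem_firstSpan hf hfM u) (gradient_mem_firstSpan hg hgM u),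
    real_inner_comm]

theorem integral_drift_mul_self_nonpos (hf : f ∈ cylinder d) : ∫ u, A f u * f u ∂ν ≤ 0 := by
  obtain ⟨M, hC, hfM, -⟩ := exists_block hblock hf hf
  rw [integral_drift_mul hμ hblock hν hA hf hf, integral_neg, neg_nonpos]
  exact integral_nonneg fun u => hC.inner_pval_self_nonneg (gradient_mem_firstSpan hf hfM u)

/-- The drift operator on the cylinder functions is well defined in `L²(ν)`. -/
theorem exists_isRealization : ∃ T : Lp ℝ 2 ν →ₗ.[ℝ] Lp ℝ 2 ν, IsRealization ν d A T := by
  have := hμ.isProbabilityMeasure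
  have := hν.isFiniteMeasure
  have m : ∀ f ∈ cylinder d, MemLp f 2 ν ∧ MemLp (A f) 2 ν := fun f hf =>
    ⟨memLp_of_mem_cylinder hf 2, hν.memLp_of_memLp (memLp_drift hμ hblock hν.memLp hA hf)⟩
  let S : Submodule ℝ (Lp ℝ 2 ν × Lp ℝ 2 ν) :=
    { carrier := {p | ∃ f ∈ cylinder d, p.1 =ᵐ[ν] f ∧ p.2 =ᵐ[ν] A f}
      zero_mem' := by
        have h0 := const_mem_cylinder (d := d) 0
        refine ⟨fun u => 0 * (fun _ => (0 : ℝ)) u, const_mul_mem_cylinder 0 h0, ?_, ?_⟩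
        · filter_upwards [Lp.coeFn_zero ℝ 2 ν] with u hu
          simpa using hu
        · rw [drift_const_mul hblock hA h0]
          filter_upwards [Lp.coeFn_zero ℝ 2 ν] with u hu
          simpa using hu
      add_mem' := by
        rintro ⟨x, y⟩ ⟨x', y'⟩ ⟨f, hf, h1, h2⟩ ⟨g, hg, h3, h4⟩
        refine ⟨f + g, add_mem_cylinder hf hg, ?_, ?_⟩
        · exact (Lp.coeFn_add x x').trans (h1.add h3)
        · rw [drift_add hblock hA hf hg]
          exact (Lp.coeFn_add y y').trans (h2.add h4)
      smul_mem' := by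
        rintro a ⟨x, y⟩ ⟨f, hf, h1, h2⟩
        refine ⟨fun u => a * f u, const_mul_mem_cylinder a hf, ?_, ?_⟩
        · exact (Lp.coeFn_smul a x).trans (h1.mono fun u hu => by simp [hu])
        · rw [drift_const_mul hblock hA hf]
          exact (Lp.coeFn_smul a y).trans (h2.mono fun u hu => by simp [hu]) }
  refine ⟨S.toLinearPMap, m, ?_⟩
  rw [Submodule.toLinearPMap_graph_eq]
  · rfl
  -- The action on classes is single-valued: if `f = 0` a.e., then by symmetry `A f` is orthogonal
  -- to all cylinder functions, hence vanishes a.e.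
  · rintro ⟨x, y⟩ ⟨f, hf, h1, h2⟩ h0
    simp only at h0 h1 h2 ⊢
    subst h0
    have hf0 : f =ᵐ[ν] 0 := h1.symm.trans (Lp.coeFn_zero ℝ 2 ν)
    have : A f =ᵐ[ν] 0 := by
      refine ae_eq_zero_of_forall_cylinder (d := d) ((m f hf).2.integrable one_le_two) fun F hF => ?_
      rw [integral_drift_mul_comm hμ hblock hν hA hf hF]
      refine integral_eq_zero_of_ae ?_
      filter_upwards [hf0] with u hu
      simp [hu]
    exact Lp.ext (h2.trans (this.trans (Lp.coeFn_zero ℝ 2 ν).symm))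

end

namespace IsRealization

variable {T : Lp ℝ 2 ν →ₗ.[ℝ] Lp ℝ 2 ν} (hT : IsRealization ν d A T)
include hT

theorem exists_of_mem (x : T.domain) : ∃ f ∈ cylinder d, (x : Lp ℝ 2 ν) =ᵐ[ν] f ∧ T x =ᵐ[ν] A f := by
  have : ((x : Lp ℝ 2 ν), T x) ∈ (T.graph : Set (Lp ℝ 2 ν × Lp ℝ 2 ν)) := T.mem_graph x
  rw [hT.2] at this
  exact this

theorem exists_domain (hf : f ∈ cylinder d) :
    ∃ x : T.domain, (x : Lp ℝ 2 ν) = (hT.1 f hf).1.toLp f ∧ T x = (hT.1 f hf).2.toLp (A f) := by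
  have : ((hT.1 f hf).1.toLp f, (hT.1 f hf).2.toLp (A f)) ∈
      (T.graph : Set (Lp ℝ 2 ν × Lp ℝ 2 ν)) := by
    exact hT.2.ge ⟨f, hf, (hT.1 f hf).1.coeFn_toLp, (hT.1 f hf).2.coeFn_toLp⟩
  exact (LinearPMap.mem_graph_iff _).1 this

theorem dense_domain [IsFiniteMeasure ν] : Dense (T.domain : Set (Lp ℝ 2 ν)) := by
  rw [Submodule.dense_iff_topologicalClosure_eq_top, Submodule.topologicalClosure_eq_top_iff,
    Submodule.eq_bot_iff]
  intro v hv
  rw [Submodule.mem_orthogonal'] at hv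
  refine Lp.ext (Filter.EventuallyEq.trans ?_ (Lp.coeFn_zero ℝ 2 ν).symm)
  refine ae_eq_zero_of_forall_cylinder (d := d) ((Lp.memLp v).integrable one_le_two) fun F hF => ?_
  obtain ⟨x, hx, -⟩ := hT.exists_domain hF
  rw [← hv x x.2, inner_lp_eq_integral]
  refine integral_congr_ae ?_
  rw [hx]
  filter_upwards [(hT.1 F hF).1.coeFn_toLp] with u hu
  rw [hu]

/-- `l - T` has dense range if no nonzero function is orthogonal to it. -/
theorem dense_range {l : ℝ} (h : ∀ v : Lp ℝ 2 ν,
    (∀ f ∈ cylinder d, ∫ u, v u * (l * f u - A f u) ∂ν = 0) → v =ᵐ[ν] 0) :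
    Dense (Set.range fun x : T.domain => l • (x : Lp ℝ 2 ν) - T x) := by
  let R : T.domain →ₗ[ℝ] Lp ℝ 2 ν := l • T.domain.subtype - T.toFun
  have hR : (Set.range fun x : T.domain => l • (x : Lp ℝ 2 ν) - T x) =
      (LinearMap.range R : Set (Lp ℝ 2 ν)) := by
    ext; simp [R]
  rw [hR, Submodule.dense_iff_topologicalClosure_eq_top,
    Submodule.topologicalClosure_eq_top_iff, Submodule.eq_bot_iff]
  intro v hv
  rw [Submodule.mem_orthogonal'] at hv
  refine Lp.ext ((h v fun f hf => ?_).trans (Lp.coeFn_zero ℝ 2 ν).symm)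
  obtain ⟨x, hx, hTx⟩ := hT.exists_domain hf
  have h1 : ⟪v, l • (x : Lp ℝ 2 ν) - T x⟫ = 0 := hv _ ⟨x, rfl⟩
  rw [← h1, inner_lp_eq_integral]
  refine integral_congr_ae ?_
  rw [hx, hTx]
  filter_upwards [(hT.1 f hf).1.coeFn_toLp, (hT.1 f hf).2.coeFn_toLp,
    Lp.coeFn_sub (l • (hT.1 f hf).1.toLp f) ((hT.1 f hf).2.toLp (A f)),
    Lp.coeFn_smul l ((hT.1 f hf).1.toLp f)] with u h1 h2 h3 h4
  rw [h3, Pi.sub_apply, h4, Pi.smul_apply, h1, h2, smul_eq_mul]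

end IsRealization

section

variable (hν : IsWeight μ d lam ν ρ P) (hA : IsDriftOperator d lam C c P A)
  {T : Lp ℝ 2 ν →ₗ.[ℝ] Lp ℝ 2 ν} (hT : IsRealization ν d A T)
include hμ hblock hν hA hT

theorem realization_symmetric (x y : T.domain) : ⟪T x, y⟫ = ⟪(x : Lp ℝ 2 ν), T y⟫ := by
  obtain ⟨f, hf, h1, h2⟩ := hT.exists_of_mem x
  obtain ⟨g, hg, h3, h4⟩ := hT.exists_of_mem y
  rw [inner_lp_eq_integral, inner_lp_eq_integral]
  have := integral_drift_mul_comm hμ hblock hν hA hf hg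
  exact (integral_congr_ae (h2.mul h3)).trans (this.trans (integral_congr_ae (h1.mul h4)).symm)

theorem realization_dissipative (x : T.domain) : ⟪T x, x⟫ ≤ 0 := by
  obtain ⟨f, hf, h1, h2⟩ := hT.exists_of_mem x
  rw [inner_lp_eq_integral]
  exact (integral_congr_ae (h2.mul h1)).trans_le (integral_drift_mul_self_nonpos hμ hblock hν hA hf)

end

end Weighted

/-! ### Relatively bounded perturbations -/

/-- Orthogonality gives `⟪v, t i⟫ = -⟪v, b i⟫`, hence `⟪v, x⟫² ≤ κ ‖v‖² ‖x‖²` on the range of `t`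
and, by density, for `x = v`. As `κ < 1`, this forces `v = 0`. -/
theorem eq_zero_of_orthogonal_perturbation {E ι : Type*} [NormedAddCommGroup E]
    [InnerProductSpace ℝ E] {t b : ι → E} (ht : Dense (Set.range t)) {κ : ℝ} (hκ : κ < 1)
    (hb : ∀ i, ‖b i‖ ^ 2 ≤ κ * ‖t i‖ ^ 2) {v : E} (hv : ∀ i, ⟪v, t i + b i⟫ = 0) : v = 0 := by
  have hc : IsClosed {x : E | ⟪v, x⟫ ^ 2 ≤ κ * ‖v‖ ^ 2 * ‖x‖ ^ 2} :=
    isClosed_le (by fun_prop) (by fun_prop)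
  have hr : Set.range t ⊆ {x : E | ⟪v, x⟫ ^ 2 ≤ κ * ‖v‖ ^ 2 * ‖x‖ ^ 2} := by
    rintro _ ⟨i, rfl⟩
    have h1 : ⟪v, t i⟫ = -⟪v, b i⟫ := by
      have := hv i
      rw [inner_add_right] at this
      linarith
    have h2 : ⟪v, b i⟫ ^ 2 ≤ (‖v‖ * ‖b i‖) ^ 2 :=
      sq_le_sq' (neg_le_of_abs_le (abs_real_inner_le_norm _ _)) (real_inner_le_norm _ _)
    rw [Set.mem_ofPred_eq, h1, neg_sq]
    calc ⟪v, b i⟫ ^ 2 ≤ ‖v‖ ^ 2 * ‖b i‖ ^ 2 := by rw [← mul_pow]; exact h2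
      _ ≤ ‖v‖ ^ 2 * (κ * ‖t i‖ ^ 2) := by gcongr; exact hb i
      _ = _ := by ring
  have h : ⟪v, v⟫ ^ 2 ≤ κ * ‖v‖ ^ 2 * ‖v‖ ^ 2 := hc.closure_subset_iff.2 hr (ht v)
  rw [real_inner_self_eq_norm_sq] at h
  by_contra hne
  have hp : 0 < (‖v‖ ^ 2) ^ 2 := by
    have := norm_pos_iff.2 hne
    positivity
  nlinarith

theorem norm_toLp_sq {X E : Type*} [MeasurableSpace X] {μ : Measure X} [NormedAddCommGroup E]
    [InnerProductSpace ℝ E] {f : X → E} (hf : MemLp f 2 μ) :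
    ‖hf.toLp f‖ ^ 2 = ∫ x, ‖f x‖ ^ 2 ∂μ := by
  rw [← real_inner_self_eq_norm_sq, L2.inner_def]
  refine integral_congr_ae ?_
  filter_upwards [hf.coeFn_toLp] with x hx
  rw [hx, real_inner_self_eq_norm_sq]

section RelativelyBounded

variable {U : Type*} [NormedAddCommGroup U] [InnerProductSpace ℝ U] [CompleteSpace U]
  [SecondCountableTopology U] [MeasurableSpace U] [BorelSpace U]
  {μ ν : Measure U} {d : HilbertBasis ℕ ℝ U} {lam : ℕ → ℝ} {C : U →ₗ.[ℝ] U} {c : ℕ → ℕ → ℝ}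
  {ρ : U → ℝ} {P : ℕ → U → ℝ} {A : (U → ℝ) → U → ℝ}

theorem norm_sq_smul_sub (l : ℝ) {w z : Lp ℝ 2 μ} {f g : U → ℝ} (hw : w =ᵐ[μ] f) (hz : z =ᵐ[μ] g) :
    ‖l • w - z‖ ^ 2 = ∫ u, (l * f u - g u) ^ 2 ∂μ := by
  rw [← real_inner_self_eq_norm_sq, inner_lp_eq_integral]
  refine integral_congr_ae ?_
  filter_upwards [hw, hz, Lp.coeFn_sub (l • w) z, Lp.coeFn_smul l w] with u h1 h2 h3 h4
  rw [h3, Pi.sub_apply, h4, Pi.smul_apply, h1, h2, smul_eq_mul, sq]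

/-- The unperturbed operator is covered by the weighted theory with constant density and no drift.
-/
theorem isWeight_one (hμ : IsNondegenerateGaussian μ d lam) :
    IsWeight μ d lam μ (fun _ => 1) (fun _ _ => 0) where
  measurable := measurable_const
  pos _ := one_pos
  bounded := ⟨1, Eventually.of_forall fun _ => le_rfl⟩
  eq_withDensity := by simp
  memLp _ := MemLp.zero'
  ibp j F hF := by
    have := integral_ld_mul hμ hF (const_mem_cylinder 1) j
    simpa [pd] using this

theorem isDriftOperator_opN (hμ : IsNondegenerateGaussian μ d lam) :
    IsDriftOperator d lam C c (fun _ _ => 0) (opN μ d C) := fun f hf M hC hM u => by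
  simp [hC.opN_eq_sum_flux hμ hf hM u]

variable (hμ : IsNondegenerateGaussian μ d lam)
  (hblock : ∀ n, ∃ M, n ≤ M ∧ IsBlockOperator C d c M)
include hμ hblock

/-- The cylinder functions are a core for the unperturbed operator. -/
theorem dense_range_opN {N : Lp ℝ 2 μ →ₗ.[ℝ] Lp ℝ 2 μ} (hN : IsRealization μ d (opN μ d C) N) {l : ℝ}
    (hl : 0 < l) : Dense (Set.range fun x : N.domain => l • (x : Lp ℝ 2 μ) - N x) := by
  have := hμ.isProbabilityMeasure
  refine hN.dense_range fun v hv => ?_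
  have key : ∀ h ∈ ⋃ n, (firstSpan d n : Set U), ∀ θ : ℝ, ∫ u, v u * Real.cos (⟪h, u⟫ + θ) ∂μ = 0 := by
    intro h hh θ
    obtain ⟨n, hn⟩ := Set.mem_iUnion.1 hh
    obtain ⟨M, hM, hC⟩ := hblock n
    obtain ⟨f, hf, -, hfe⟩ := exists_resolvent_wave hμ hC hl (firstSpan_mono hM hn) θ
    rw [← hv f hf]
    simp_rw [hfe]
  refine ae_eq_zero_of_trigonometric ((Lp.memLp v).integrable one_le_two) (dense_iUnion_firstSpan d)
    (fun h hh => ?_) fun h hh => ?_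
  · simpa [real_inner_comm] using key h hh 0
  · simpa [real_inner_comm, ← sub_eq_add_neg, Real.cos_sub_pi_div_two] using
      key h hh (-(Real.pi / 2))

section

variable (hν : IsWeight μ d lam ν ρ P) (hA : IsDriftOperator d lam C c P A)
  {N : Lp ℝ 2 μ →ₗ.[ℝ] Lp ℝ 2 μ} (hN : IsRealization μ d (opN μ d C) N)
  {NΦ : Lp ℝ 2 ν →ₗ.[ℝ] Lp ℝ 2 ν} (hNΦ : IsRealization ν d A NΦ)
  {F G : U → U} {γ l β : ℝ}
  (hGγ : ∀ᵐ u ∂μ, ‖G u‖ ≤ γ)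
  (hFm : ∀ f ∈ cylinder d, MemLp (fun u => F (gradient f u)) 2 μ)
  (hest : ∀ f ∈ cylinder d, ∫ u, ‖F (gradient f u)‖ ^ 2 ∂μ ≤
    β * ∫ u, (l * f u - opN μ d C f u) ^ 2 ∂μ)
  (hpair : ∀ f ∈ cylinder d, ∀ᵐ u ∂μ, opN μ d C f u - A f u = ⟪G u, F (gradient f u)⟫)
include hν hA hN hNΦ hGγ hFm hest hpair

/-- The range of `l - N^Φ` remains dense under a perturbation with relative bound less than one. -/
theorem dense_range_of_perturbation (hl : 0 < l) (hβ : γ ^ 2 * β < 1) :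
    Dense (Set.range fun x : NΦ.domain => l • (x : Lp ℝ 2 ν) - NΦ x) := by
  have := hμ.isProbabilityMeasure
  have := hν.isFiniteMeasure
  refine hNΦ.dense_range fun v hv => ?_
  have hV := hν.memLp_mul_density v
  choose f hf hxf hNf using hN.exists_of_mem
  have hb : ∀ x : N.domain, MemLp (fun u => ⟪G u, F (gradient (f x) u)⟫) 2 μ := fun x =>
    ((hN.1 _ (hf x)).2.sub (memLp_drift hμ hblock hν.memLp hA (hf x))).ae_eq (hpair _ (hf x))
  -- Since `(l - N^Φ) f = (l - N) f + ⟪G, F Df⟫`, orthogonality of `v` in `L²(ν)` becomes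
  -- orthogonality of `v * ρ` in `L²(μ)` to a perturbation of the dense range of `l - N`, with
  -- relative bound `γ² β`.
  have h0 : hV.toLp _ = 0 := by
    refine eq_zero_of_orthogonal_perturbation (dense_range_opN hμ hblock hN hl) hβ
      (b := fun x => (hb x).toLp _) (fun x => ?_) fun x => ?_
    · rw [norm_toLp_sq, norm_sq_smul_sub l (hxf x) (hNf x), mul_assoc]
      refine le_trans ?_ (mul_le_mul_of_nonneg_left (hest _ (hf x)) (sq_nonneg γ))
      rw [← integral_const_mul]
      refine integral_mono_ae (hb x).norm.integrable_sq
        ((hFm _ (hf x)).norm.integrable_sq.const_mul _) ?_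
      filter_upwards [hGγ] with u hu
      rw [← mul_pow]
      gcongr
      exact (norm_inner_le_norm _ _).trans (by gcongr)
    · rw [inner_lp_eq_integral, ← hv _ (hf x), hν.integral_eq]
      refine integral_congr_ae ?_
      filter_upwards [hV.coeFn_toLp, (hb x).coeFn_toLp, hxf x, hNf x, hpair _ (hf x),
        Lp.coeFn_add (l • (x : Lp ℝ 2 μ) - N x) ((hb x).toLp _),
        Lp.coeFn_sub (l • (x : Lp ℝ 2 μ)) (N x), Lp.coeFn_smul l (x : Lp ℝ 2 μ)]
        with u h1 h2 h3 h4 h5 h6 h7 h8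
      rw [h6, Pi.add_apply, h7, Pi.sub_apply, h8, Pi.smul_apply, h1, h2, h3, h4, ← h5, smul_eq_mul]
      ring
  have hv0 : v =ᵐ[μ] 0 := by
    have h1 : (fun u => v u * ρ u) =ᵐ[μ] 0 := by
      refine hV.coeFn_toLp.symm.trans ?_
      rw [h0]
      exact Lp.coeFn_zero ℝ 2 μ
    filter_upwards [h1] with u hu
    exact (mul_eq_zero.1 hu).resolve_right (hν.pos u).ne'
  exact hν.absolutelyContinuous.ae_le hv0

/-- Along a sequence converging in the graph of `N`, the estimate makes `F Df` Cauchy, so `N f - ⟪G,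
F Df⟫` converges in `L²(μ)`. The density is bounded, so it converges in `L²(ν)` too, and the limit
lies in the closed graph of `N^Φ`. -/
theorem domainInclusion_of_perturbation (hG : MemLp G 2 μ)
    (hFsub : ∀ f ∈ cylinder d, ∀ g ∈ cylinder d, ∀ u,
      F (gradient (fun u => f u - g u) u) = F (gradient f u) - F (gradient g u))
    (huniq : ∀ f h h', IsSobolevGradient μ d F f h → IsSobolevGradient μ d F f h' → h =ᵐ[μ] h') :
    DomainInclusion d F G N NΦ := by
  have := hμ.isProbabilityMeasure
  have := hν.isFiniteMeasure
  have hclN : N.IsClosable := isClosable_of_symmetric hN.dense_domain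
    (realization_symmetric hμ hblock (isWeight_one hμ) (isDriftOperator_opN hμ) hN)
  have hclΦ : NΦ.IsClosable := isClosable_of_symmetric hNΦ.dense_domain
    (realization_symmetric hμ hblock hν hA hNΦ)
  intro x
  obtain ⟨s, hs, hNs⟩ := exists_seq_of_mem_closure_graph hclN x
  choose f hf hxf hNf using fun n => hN.exists_of_mem (s n)
  have hsub : ∀ n k, (fun u => f n u - f k u) ∈ cylinder d := fun n k => by
    have := add_mem_cylinder (hf n) (const_mul_mem_cylinder (-1) (hf k))
    convert this using 2
    simp [sub_eq_add_neg]
  let y : ℕ → Lp U 2 μ := fun n => (hFm _ (hf n)).toLp _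
  let w : ℕ → Lp ℝ 2 μ := fun n => l • (s n : Lp ℝ 2 μ) - N (s n)
  have hw : CauchySeq w := ((hs.const_smul l).sub hNs).cauchySeq
  have hle : ∀ n k, dist (y n) (y k) ≤ √β * dist (w n) (w k) := by
    intro n k
    have h1 : ‖y n - y k‖ ^ 2 = ∫ u, ‖F (gradient (fun u => f n u - f k u) u)‖ ^ 2 ∂μ := by
      simp only [y]
      rw [← MemLp.toLp_sub, norm_toLp_sq]
      refine integral_congr_ae (Eventually.of_forall fun u => ?_)
      simp only [Pi.sub_apply, hFsub _ (hf n) _ (hf k)]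
    have h2 : w n - w k = l • ((s n - s k : N.domain) : Lp ℝ 2 μ) - N (s n - s k) := by
      simp only [w, LinearPMap.map_sub, Submodule.coe_sub, smul_sub]
      abel
    have h3 : ((s n - s k : N.domain) : Lp ℝ 2 μ) =ᵐ[μ] fun u => f n u - f k u := by
      rw [Submodule.coe_sub]
      exact (Lp.coeFn_sub _ _).trans ((hxf n).sub (hxf k))
    -- The operator acts on classes, so the difference of the chosen representatives may be used to
    -- evaluate it: it represents the same class, hence the same point of the domain.
    have h4 : N (s n - s k) =ᵐ[μ] opN μ d C (fun u => f n u - f k u) := by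
      obtain ⟨g, hg, hg1, hg2⟩ := hN.exists_of_mem (s n - s k)
      obtain ⟨z, hz, hNz⟩ := hN.exists_domain (hsub n k)
      have : z = s n - s k := by
        refine Subtype.ext (Lp.ext ?_)
        rw [hz]
        exact (hN.1 _ (hsub n k)).1.coeFn_toLp.trans h3.symm
      rw [← this, hNz]
      exact (hN.1 _ (hsub n k)).2.coeFn_toLp
    rw [dist_eq_norm, dist_eq_norm, ← abs_of_nonneg (norm_nonneg (w n - w k)), ← Real.sqrt_sq_eq_abs,
      ← Real.sqrt_mul' _ (sq_nonneg _), h2, norm_sq_smul_sub l h3 h4]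
    refine (le_abs_self _).trans (Real.abs_le_sqrt ?_)
    rw [h1]
    exact hest _ (hsub n k)
  have hy : CauchySeq y := by
    rw [cauchySeq_iff_tendsto_dist_atTop_0] at hw ⊢
    refine squeeze_zero (fun _ => dist_nonneg) (fun n => hle n.1 n.2) ?_
    simpa using hw.const_mul (√β)
  obtain ⟨h₀, hlim⟩ := cauchySeq_tendsto_of_complete hy
  have hfx : Tendsto (fun n => eLpNorm (fun u => f n u - (x : Lp ℝ 2 μ) u) 2 μ) atTop (𝓝 0) := by
    refine ((Lp.tendsto_Lp_iff_tendsto_eLpNorm' _ _).1 hs).congr fun n => eLpNorm_congr_ae ?_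
    exact (hxf n).sub EventuallyEq.rfl
  have hNx : Tendsto (fun n => eLpNorm (fun u => opN μ d C (f n) u - N.closure x u) 2 μ) atTop
      (𝓝 0) := by
    refine ((Lp.tendsto_Lp_iff_tendsto_eLpNorm' _ _).1 hNs).congr fun n => eLpNorm_congr_ae ?_
    exact (hNf n).sub EventuallyEq.rfl
  have hFx : Tendsto (fun n => eLpNorm (fun u => F (gradient (f n) u) - h₀ u) 2 μ) atTop (𝓝 0) := by
    refine ((Lp.tendsto_Lp_iff_tendsto_eLpNorm' _ _).1 hlim).congr fun n => eLpNorm_congr_ae ?_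
    exact (hFm _ (hf n)).coeFn_toLp.sub EventuallyEq.rfl
  have hgrad : IsSobolevGradient μ d F (x : Lp ℝ 2 μ) h₀ :=
    ⟨Lp.memLp _, Lp.memLp _, f, hf, fun n => hFm _ (hf n), hfx, hFx⟩
  refine ⟨⟨h₀, hgrad⟩, fun h hh => ?_⟩
  have hh₀ := huniq _ _ _ hgrad hh
  have hm : MemLp (fun u => ⟪G u, h₀ u⟫) 2 μ := by
    refine (Lp.memLp h₀).of_le_mul (c := γ) (hG.1.inner (Lp.memLp h₀).1) ?_
    filter_upwards [hGγ] with u hu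
    exact (norm_inner_le_norm _ _).trans (by gcongr)
  have hX := hν.memLp_of_memLp (Lp.memLp (x : Lp ℝ 2 μ))
  have hY := hν.memLp_of_memLp ((Lp.memLp (N.closure x)).sub hm)
  choose z hz hNz using fun n => hNΦ.exists_domain (hf n)
  have hzx : Tendsto (fun n => (z n : Lp ℝ 2 ν)) atTop (𝓝 (hX.toLp _)) := by
    simp_rw [hz]
    exact (Lp.tendsto_Lp_iff_tendsto_eLpNorm'' _ _ _ _).2 (hν.tendsto_eLpNorm hfx)
  have hpert : Tendsto (fun n => eLpNorm (fun u => ⟪G u, F (gradient (f n) u) - h₀ u⟫) 2 μ) atTop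
      (𝓝 0) := by
    refine eLpNorm_tendsto_zero_of_le γ (fun n => ?_) hFx
    filter_upwards [hGγ] with u hu
    exact (norm_inner_le_norm _ _).trans (by gcongr)
  have hAx : Tendsto (fun n => eLpNorm (fun u => A (f n) u - (N.closure x u - ⟪G u, h₀ u⟫)) 2 μ)
      atTop (𝓝 0) := by
    have h0 := hNx.add hpert
    rw [add_zero] at h0
    refine tendsto_of_tendsto_of_tendsto_of_le_of_le tendsto_const_nhds h0 (fun _ => zero_le)
      fun n => ?_
    have m1 : AEStronglyMeasurable (fun u => opN μ d C (f n) u - N.closure x u) μ :=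
      ((hN.1 _ (hf n)).2.sub (Lp.memLp _)).1
    have m2 : AEStronglyMeasurable (fun u => ⟪G u, F (gradient (f n) u) - h₀ u⟫) μ :=
      hG.1.inner ((hFm _ (hf n)).sub (Lp.memLp h₀)).1
    refine le_trans (eLpNorm_congr_ae ?_).le (eLpNorm_sub_le m1 m2 one_le_two)
    filter_upwards [hpair _ (hf n)] with u hu
    simp only [Pi.sub_apply, inner_sub_right, ← hu]
    ring
  have hzA : Tendsto (fun n => NΦ (z n)) atTop (𝓝 (hY.toLp _)) := by
    simp_rw [hNz]
    exact (Lp.tendsto_Lp_iff_tendsto_eLpNorm'' _ _ _ _).2 (hν.tendsto_eLpNorm hAx)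
  obtain ⟨g, hg, hNg⟩ := mem_closure_graph_of_seq hclΦ hzx hzA
  refine ⟨g, ?_, ?_⟩
  · rw [hg]; exact hX.coeFn_toLp
  · rw [hNg]
    filter_upwards [hY.coeFn_toLp, hν.absolutelyContinuous.ae_le hh₀] with u h1 h2
    rw [h1, Pi.sub_apply, h2]

/-- A relatively bounded perturbation with relative bound less than one preserves essential
self-adjointness and enlarges the domain of the closure. -/
theorem perturbation (hG : MemLp G 2 μ) (hl : 0 < l) (hβ : γ ^ 2 * β < 1)
    (hFsub : ∀ f ∈ cylinder d, ∀ g ∈ cylinder d, ∀ u,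
      F (gradient (fun u => f u - g u) u) = F (gradient f u) - F (gradient g u))
    (huniq : ∀ f h h', IsSobolevGradient μ d F f h → IsSobolevGradient μ d F f h' → h =ᵐ[μ] h') :
    DomainInclusion d F G N NΦ ∧ IsEssentiallySelfAdjoint NΦ ∧
      ∀ l : ℝ, 0 < l → ∃ R, IsResolventAt NΦ.closure l R := by
  have := hμ.isProbabilityMeasure
  have := hν.isFiniteMeasure
  exact ⟨domainInclusion_of_perturbation hμ hblock hν hA hN hNΦ hGγ hFm hest hpair hG hFsub huniq,
    essentiallySelfAdjoint_of_dense_range hNΦ.dense_domain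
      (realization_symmetric hμ hblock hν hA hNΦ) (realization_dissipative hμ hblock hν hA hNΦ) hl
      (dense_range_of_perturbation hμ hblock hν hA hN hNΦ hGγ hFm hest hpair hl hβ)⟩

end

end RelativelyBounded

/-! ### Partial derivatives of the potential -/

section Potential

variable {U : Type*} [NormedAddCommGroup U] [InnerProductSpace ℝ U] [CompleteSpace U]
  [SecondCountableTopology U] [MeasurableSpace U] [BorelSpace U]
  {μ : Measure U} {d : HilbertBasis ℕ ℝ U} {lam : ℕ → ℝ} {C : U →ₗ.[ℝ] U} {c : ℕ → ℕ → ℝ}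
  {f : U → ℝ} {G : U → U} {α : ℝ}

theorem exists_gradient_mem_firstSpan (hf : f ∈ cylinder d) : ∃ n, ∀ u, gradient f u ∈ firstSpan d n := by
  obtain ⟨n, hn⟩ := exists_dependsOnFirst hf
  exact ⟨n, gradient_mem_firstSpan hf hn⟩

theorem gradient_sub {g : U → ℝ} (hf : f ∈ cylinder d) (hg : g ∈ cylinder d) (u : U) :
    gradient (fun u => f u - g u) u = gradient f u - gradient g u :=
  ext_inner_basis (d := d) fun i => by
    rw [inner_sub_left, inner_gradient, inner_gradient, inner_gradient,
      fderiv_fun_sub (differentiable_of_mem_cylinder hf u) (differentiable_of_mem_cylinder hg u)]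
    rfl

theorem memLp_sum_smul_basis {M : ℕ} {p : ℕ → U → ℝ} (hp : ∀ j, MemLp (p j) 2 μ) :
    MemLp (fun u => ∑ j ∈ Finset.range M, p j u • d j) 2 μ :=
  memLp_finsetSum _ fun j _ => (ContinuousLinearMap.toSpanSingleton ℝ (d j)).comp_memLp' (hp j)

theorem inner_diagPow_gradient (hf : f ∈ cylinder d) (θ : ℝ) (j : ℕ) (u : U) :
    ⟪diagPow d lam θ (gradient f u), d j⟫ = lam j ^ θ * pd d j f u := by
  obtain ⟨n, hn⟩ := exists_gradient_mem_firstSpan hf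
  rw [inner_diagPow lam θ (hn u), inner_gradient, pd]

/-- The partial derivative `∂ⱼf` obtained from the weighted gradient `Q ^ α Df`. -/
def weakPartial (d : HilbertBasis ℕ ℝ U) (lam : ℕ → ℝ) (α : ℝ) (G : U → U) (j : ℕ) (u : U) : ℝ :=
  lam j ^ (-α) * ⟪G u, d j⟫

theorem memLp_weakPartial (hG : MemLp G 2 μ) (j : ℕ) : MemLp (weakPartial d lam α G j) 2 μ :=
  (hG.inner_const (d j)).const_mul _

theorem opN_sub_opNPhi {M : ℕ} (hC : IsBlockOperator C d c M) (hf : f ∈ cylinder d)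
    (hM : DependsOnFirst d M f) (u : U) :
    opN μ d C f u - opNPhi μ d lam C α G f u =
      ∑ j ∈ Finset.range M, weakPartial d lam α G j u * flux C d f j u := by
  rw [opNPhi, sub_sub_cancel, gradPairing, tsum_eq_sum (s := Finset.range M)]
  · simp only [weakPartial, flux, real_inner_comm]
  · intro j hj
    have := congrFun (hC.flux_eq_zero hf hM (not_lt.1 (by simpa using hj))) u
    rw [flux, real_inner_comm] at this
    rw [this, mul_zero]

theorem isDriftOperator_opNPhi (hμ : IsNondegenerateGaussian μ d lam) :
    IsDriftOperator d lam C c (weakPartial d lam α G) (opNPhi μ d lam C α G) :=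
  fun f hf M hC hM u => by
    rw [Finset.sum_sub_distrib, ← hC.opN_eq_sum_flux hμ hf hM, ← opN_sub_opNPhi (lam := lam) hC hf hM,
      sub_sub_cancel]

variable (hμ : IsNondegenerateGaussian μ d lam)
include hμ

theorem IsSobolevGradient.isWeakDeriv_coord (hG : IsSobolevGradient μ d (diagPow d lam α) f G)
    (j : ℕ) : IsWeakDeriv μ d lam (j + 1) (fun i => if i = j then lam j ^ α else 0) f
      fun u => ⟪G u, d j⟫ :=
  hG.isWeakDeriv hμ fun F hF u => by
    rw [inner_diagPow_gradient hF]
    simp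

/-- Dividing by `lam j ^ α` removes the weight, so the partial derivatives are characterised without
reference to `α`. -/
theorem IsSobolevGradient.integral_weakPartial_mul
    (hG : IsSobolevGradient μ d (diagPow d lam α) f G) (j : ℕ) {F : U → ℝ} (hF : F ∈ cylinder d) :
    ∫ u, weakPartial d lam α G j u * F u ∂μ = -∫ u, ld d lam j F u * f u ∂μ := by
  have h := hG.isWeakDeriv_coord hμ j F hF
  simp only [ite_mul, zero_mul, Finset.sum_ite_eq', Finset.mem_range, lt_add_one, if_true] at h
  simp_rw [weakPartial, mul_assoc]
  rw [integral_const_mul, h, Real.rpow_neg (hμ.pos j).le, mul_neg,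
    inv_mul_cancel_left₀ (Real.rpow_pos_of_pos (hμ.pos j) α).ne']

/-- The Gibbs measure of a Sobolev potential is a weight. -/
theorem exists_isWeight_gibbs {Φ : U → EReal} (hΦm : Measurable Φ) {c : ℝ}
    (hΦb : ∀ u, (c : EReal) ≤ Φ u) (hG : IsPotentialGradient μ d (diagPow d lam α) Φ G) :
    ∃ ρ : U → ℝ, IsWeight μ d lam (gibbs μ Φ) ρ (weakPartial d lam α G) := by
  have := hμ.isProbabilityMeasure
  obtain ⟨hfin, hf, hG2, fn, hfn, -, hlim, hGlim⟩ := hG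
  obtain ⟨z, hz, heq, hc⟩ := exists_gibbs_density (μ := μ) hΦm hΦb hfin
  refine ⟨fun u => z * Real.exp (-(Φ u).toReal),
    { measurable := by fun_prop
      pos := fun u => by positivity
      bounded := ⟨z * Real.exp (-c), ?_⟩
      eq_withDensity := heq
      memLp := memLp_weakPartial hG2
      ibp := fun j F hF => ?_ }⟩
  · filter_upwards [hc] with u hu
    gcongr
  · have hpd : Tendsto (fun n => eLpNorm (fun u => pd d j (fn n) u - weakPartial d lam α G j u) 2 μ)
        atTop (𝓝 0) := by
      -- Each single coordinate loses only the fixed factor `lam j ^ (-α)`, so convergence of the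
      -- weighted gradient gives convergence of every partial derivative.
      refine eLpNorm_tendsto_zero_of_le (lam j ^ (-α)) (fun n => Eventually.of_forall fun u => ?_) hGlim
      have h0 := Real.rpow_pos_of_pos (hμ.pos j) (-α)
      have e : pd d j (fn n) u - weakPartial d lam α G j u =
          lam j ^ (-α) * ⟪diagPow d lam α (gradient (fn n) u) - G u, d j⟫ := by
        rw [inner_sub_left, inner_diagPow_gradient (hfn n), mul_sub, ← mul_assoc,
          ← Real.rpow_add (hμ.pos j), neg_add_cancel, Real.rpow_zero, one_mul, weakPartial]
      rw [e, norm_mul, Real.norm_of_nonneg h0.le]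
      gcongr
      refine (norm_inner_le_norm _ _).trans ?_
      rw [d.orthonormal.1 j, mul_one]
    have := integral_ld_mul_exp_neg hμ hf (memLp_weakPartial hG2 j) hc hfn hlim hpd hF
    have e1 : ∀ h : U → ℝ, ∫ u, h u * (z * Real.exp (-(Φ u).toReal)) ∂μ =
        z * ∫ u, h u * Real.exp (-(Φ u).toReal) ∂μ := fun h => by
      rw [← integral_const_mul]
      congr 1
      ext u
      ring
    rw [e1, e1 fun u => F u * weakPartial d lam α G j u, this]

end Potential

/-! ### Compatibility of nested blocks -/

section BlockStructure

variable {U : Type*} [NormedAddCommGroup U] [InnerProductSpace ℝ U] [CompleteSpace U]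
  [SecondCountableTopology U] [MeasurableSpace U] [BorelSpace U]
  {d : HilbertBasis ℕ ℝ U} {C : U →ₗ.[ℝ] U} {c : ℕ → ℕ → ℝ} {M : ℕ} {f : U → ℝ}

theorem IsBlockOperator.coeff_eq {M : ℕ} (hC : IsBlockOperator C d c M) {i j : ℕ} (hi : i < M)
    (hj : j < M) : c i j = ⟪pval C (d i), d j⟫ := by
  rw [hC.inner_pval (basis_mem_firstSpan hi) hj]
  simp [inner_basis, hi]

/-- Invariance of the smaller block kills the entries leaving it, and symmetry in the larger block
kills the entries entering it. -/
theorem IsBlockOperator.coeff_eq_zero {M' : ℕ} (hC : IsBlockOperator C d c M)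
    (hC' : IsBlockOperator C d c M') {i j : ℕ} (hi : i < M) (hj : M ≤ j) (hj' : j < M') :
    c j i = 0 := by
  have hi' : i < M' := hi.trans (hj.trans_lt hj')
  rw [hC'.symm hj' hi', hC'.coeff_eq hi' hj']
  exact mem_firstSpan_iff.1 (hC.pval_mem (basis_mem_firstSpan hi)) j hj

/-- By block diagonality the sum stops at `M`, even if `f` depends on more coordinates. Thus each
component of `C Df` is one fixed finite combination of partial derivatives, as needed for
`IsSobolevGradient.isWeakDeriv`. -/
theorem IsBlockOperator.flux_eq_sum (hblock : ∀ n, ∃ M, n ≤ M ∧ IsBlockOperator C d c M)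
    (hC : IsBlockOperator C d c M) (hf : f ∈ cylinder d) {i : ℕ} (hi : i < M) (u : U) :
    flux C d f i u = ∑ j ∈ Finset.range M, c j i * pd d j f u := by
  obtain ⟨n, hn⟩ := exists_dependsOnFirst hf
  obtain ⟨M', hM', hC'⟩ := hblock (max n M)
  have hle : M ≤ M' := (le_max_right _ _).trans hM'
  rw [hC'.flux_eq hf (hn.mono ((le_max_left _ _).trans hM')) (hi.trans_le hle)]
  refine (Finset.sum_subset (Finset.range_mono hle) fun j hj hj' => ?_).symm
  rw [hC.coeff_eq_zero hC' hi (not_lt.1 (by simpa using hj')) (Finset.mem_range.1 hj), zero_mul]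

end BlockStructure

theorem ae_norm_le_eLpNorm_top {X E : Type*} [MeasurableSpace X] {μ : Measure X}
    [NormedAddCommGroup E] {G : X → E} (hG : eLpNorm G ⊤ μ < ⊤) :
    ∀ᵐ x ∂μ, ‖G x‖ ≤ (eLpNorm G ⊤ μ).toReal := by
  rw [eLpNorm_exponent_top] at hG ⊢
  filter_upwards [ae_le_eLpNormEssSup (f := G) (μ := μ)] with x hx
  rw [← toReal_enorm]
  exact ENNReal.toReal_mono hG.ne hx

/-! ### The two classes of potentials -/

section Perturbation

variable {U : Type*} [NormedAddCommGroup U] [InnerProductSpace ℝ U] [CompleteSpace U]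
  [SecondCountableTopology U] [MeasurableSpace U] [BorelSpace U]
  {μ ν : Measure U} {d : HilbertBasis ℕ ℝ U} {lam : ℕ → ℝ} {C : U →ₗ.[ℝ] U} {c : ℕ → ℕ → ℝ}
  {ρ φ f : U → ℝ} {α : ℝ} {G G₁ : U → U} {M : ℕ}

theorem IsBlockOperator.pval_sub (hC : IsBlockOperator C d c M) {x y : U} (hx : x ∈ firstSpan d M)
    (hy : y ∈ firstSpan d M) : pval C (x - y) = pval C x - pval C y := by
  rw [pval_of_mem (hC.mem _ hx), pval_of_mem (hC.mem _ hy),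
    pval_of_mem (hC.mem _ (Submodule.sub_mem _ hx hy)), ← LinearPMap.map_sub]
  rfl

theorem ext_of_ae_inner {ι : Type*} [Countable ι] {w : ι → U} {h h' : U → U}
    (hw : ∀ x, (∀ i, ⟪x, w i⟫ = 0) → x = 0)
    (H : ∀ i, (fun u => ⟪h u, w i⟫) =ᵐ[μ] fun u => ⟪h' u, w i⟫) : h =ᵐ[μ] h' := by
  filter_upwards [ae_all_iff.2 H] with u hu
  refine sub_eq_zero.1 (hw _ fun i => ?_)
  rw [inner_sub_left, hu i, sub_self]

/-- The square root of the bounded extension of `K₂₁ Q₂⁻¹ K₁₂` is injective if `K₁₂` is. -/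
theorem injective_sqrt_opC {V : Type*} [NormedAddCommGroup V] [InnerProductSpace ℝ V]
    [CompleteSpace V] [SecondCountableTopology V] [MeasurableSpace V] [BorelSpace V] {μ₂ : Measure V}
    {e : HilbertBasis ℕ ℝ V} {lam₂ : ℕ → ℝ} {K : U →L[ℝ] V} {m : ℕ → ℕ}
    (hμ₂ : IsNondegenerateGaussian μ₂ e lam₂) (hK : IsBlockInvariant K d e m)
    (hKinj : ∀ x, K x = 0 → x = 0) {B S : U →L[ℝ] U} (hB : ∀ x : (opC μ₂ K).domain, B x = opC μ₂ K x)
    (hSB : S ∘L S = B) {x : U} (hx : S x = 0) : x = 0 := by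
  have hc : IsClosed {x : U | (lam₂ 0)⁻¹ * ‖K x‖ ^ 2 ≤ ⟪B x, x⟫} :=
    isClosed_le (by fun_prop) (by fun_prop)
  have hsub : (⋃ n, (firstSpan d n : Set U)) ⊆ {x : U | (lam₂ 0)⁻¹ * ‖K x‖ ^ 2 ≤ ⟪B x, x⟫} := by
    intro y hy
    obtain ⟨n, hn⟩ := Set.mem_iUnion.1 hy
    have hy' := firstSpan_mono hK.strictMono.le_apply hn
    have := le_inner_opC hμ₂ hK n hy'
    rw [pval_of_mem ((isBlockOperator_opC hμ₂ hK n).mem y hy'), ← hB] at this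
    exact this
  -- The lower bound for `C` on the blocks extends to all of `U` by density and continuity of `B`.
  have h : (lam₂ 0)⁻¹ * ‖K x‖ ^ 2 ≤ ⟪B x, x⟫ := hc.closure_subset_iff.2 hsub (dense_iUnion_firstSpan d x)
  have hBx : B x = 0 := by rw [← hSB, ContinuousLinearMap.comp_apply, hx, map_zero]
  rw [hBx, inner_zero_left] at h
  have h0 := inv_pos.2 (hμ₂.pos 0)
  refine hKinj x (norm_eq_zero.1 (pow_eq_zero_iff two_ne_zero |>.1 (le_antisymm ?_ (sq_nonneg _))))
  exact nonpos_of_mul_nonpos_right h h0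

variable (hμ : IsNondegenerateGaussian μ d lam)
include hμ

/-- Values of the closure of `T D` are determined by their components along the countable separating
family `w`, and these components are weak derivatives of `f`. -/
theorem IsSobolevGradient.ae_eq_of_coord {T : U → U} {w : ℕ → U} {h h' : U → U}
    (hh : IsSobolevGradient μ d T f h) (hh' : IsSobolevGradient μ d T f h')
    (hw : ∀ x, (∀ i, ⟪x, w i⟫ = 0) → x = 0)
    (hT : ∀ i, ∃ (M : ℕ) (a : ℕ → ℝ), ∀ F ∈ cylinder d, ∀ u,
      ⟪T (gradient F u), w i⟫ = ∑ j ∈ Finset.range M, a j * pd d j F u) : h =ᵐ[μ] h' := by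
  have := hμ.isProbabilityMeasure
  refine ext_of_ae_inner hw fun i => ?_
  obtain ⟨M, a, ha⟩ := hT i
  exact (hh.isWeakDeriv hμ ha).unique (hh'.isWeakDeriv hμ ha) (hh.2.1.inner_const _)
    (hh'.2.1.inner_const _)

variable (hblock : ∀ n, ∃ M, n ≤ M ∧ IsBlockOperator C d c M)
include hblock

theorem integral_opN_mul_self_nonpos (hf : f ∈ cylinder d) : ∫ u, opN μ d C f u * f u ∂μ ≤ 0 :=
  integral_drift_mul_self_nonpos hμ hblock (isWeight_one hμ) (isDriftOperator_opN hμ) hf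

variable {N : Lp ℝ 2 μ →ₗ.[ℝ] Lp ℝ 2 μ} (hN : IsRealization μ d (opN μ d C) N)
  {NΦ : Lp ℝ 2 ν →ₗ.[ℝ] Lp ℝ 2 ν} (hNΦ : IsRealization ν d (opNPhi μ d lam C α G) NΦ)
  (hν : IsWeight μ d lam ν ρ (weakPartial d lam α G))
  (hG : IsSobolevGradient μ d (diagPow d lam α) φ G)
include hN hNΦ hν hG

/-- Second-order regularity bounds `∫ ‖Q^{-1/2} C Df‖²` by `∫ (N f)²`. This is at most `∫ (f - N
f)²`, since dissipativity makes the cross term nonnegative. -/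
theorem small_gradient_perturbation (hG₁ : IsSobolevGradient μ d (diagPow d lam (1 / 2)) φ G₁)
    (hsmall : eLpNorm G₁ ⊤ μ < 1 / 2) :
    DomainInclusion d (fun x => diagPow d lam (-(1 / 2)) (pval C x)) G₁ N NΦ ∧
      IsEssentiallySelfAdjoint NΦ ∧ ∀ l : ℝ, 0 < l → ∃ R, IsResolventAt NΦ.closure l R := by
  have := hμ.isProbabilityMeasure
  have hF : ∀ {f} (_ : f ∈ cylinder d) {M}, IsBlockOperator C d c M → DependsOnFirst d M f → ∀ u i,
      ⟪diagPow d lam (-(1 / 2)) (pval C (gradient f u)), d i⟫ =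
        lam i ^ (-(1 / 2) : ℝ) * flux C d f i u := fun hf M hC hM u i =>
    inner_diagPow lam _ (hC.pval_mem (gradient_mem_firstSpan hf hM u)) i
  have hFsum : ∀ {f} (_ : f ∈ cylinder d) {M}, IsBlockOperator C d c M → DependsOnFirst d M f → ∀ u,
      diagPow d lam (-(1 / 2)) (pval C (gradient f u)) =
        ∑ i ∈ Finset.range M, (lam i ^ (-(1 / 2) : ℝ) * flux C d f i u) • d i :=
    fun hf M hC hM u => diagPow_eq_sum lam _ (hC.pval_mem (gradient_mem_firstSpan hf hM u))
  have hFm : ∀ f ∈ cylinder d, MemLp (fun u => diagPow d lam (-(1 / 2)) (pval C (gradient f u))) 2 μ := by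
    intro f hf
    obtain ⟨M, hC, hM, -⟩ := exists_block hblock hf hf
    simp_rw [hFsum hf hC hM]
    exact memLp_sum_smul_basis fun i =>
      (memLp_of_mem_cylinder (hC.flux_mem_cylinder hf hM i) 2).const_mul _
  have hγ : (eLpNorm G₁ ⊤ μ).toReal < 1 / 2 := by
    simpa using (ENNReal.toReal_lt_toReal hsmall.ne_top (by simp)).2 hsmall
  have hγ0 : 0 ≤ (eLpNorm G₁ ⊤ μ).toReal := ENNReal.toReal_nonneg
  -- The estimate holds with `l = β = 1`, and `γ < 1 / 2` gives `γ² β < 1`.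
  refine perturbation hμ hblock hν (isDriftOperator_opNPhi hμ) hN hNΦ
    (ae_norm_le_eLpNorm_top hsmall.lt_top) hFm (l := 1) (β := 1) ?_ ?_ hG₁.2.1 one_pos
    (by nlinarith) ?_ ?_
  · intro f hf
    obtain ⟨M, hC, hM, -⟩ := exists_block hblock hf hf
    have e : ∀ u, ‖diagPow d lam (-(1 / 2)) (pval C (gradient f u))‖ ^ 2 =
        ∑ j ∈ Finset.range M, (lam j)⁻¹ * flux C d f j u ^ 2 := fun u => by
      have hm : diagPow d lam (-(1 / 2)) (pval C (gradient f u)) ∈ firstSpan d M := by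
        rw [hFsum hf hC hM]
        exact sum_basis_mem_firstSpan _
      rw [← real_inner_self_eq_norm_sq, inner_eq_sum_of_mem_firstSpan hm]
      refine Finset.sum_congr rfl fun j _ => ?_
      have hj : lam j ^ (-(1 / 2) : ℝ) * lam j ^ (-(1 / 2) : ℝ) = (lam j)⁻¹ := by
        rw [← Real.rpow_add (hμ.pos j), ← Real.rpow_neg_one]
        norm_num
      rw [hF hf hC hM, ← hj]
      ring
    simp_rw [e]
    refine (hC.integral_sq_flux_le hμ hf hM).trans ?_
    have hfm : MemLp f 2 μ := memLp_of_mem_cylinder hf 2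
    have hNm := (hN.1 f hf).2
    have hsub : 0 ≤ ∫ u, f u * f u - 2 * (opN μ d C f u * f u) ∂μ := by
      rw [integral_sub (integrable_mul_of_memLp_two hfm hfm)
        ((integrable_mul_of_memLp_two hNm hfm).const_mul 2), integral_const_mul]
      have := integral_opN_mul_self_nonpos hμ hblock hf
      have h2 : 0 ≤ ∫ u, f u * f u ∂μ := integral_nonneg fun u => mul_self_nonneg _
      linarith
    have hadd : ∫ u, (1 * f u - opN μ d C f u) ^ 2 ∂μ =
        ∫ u, opN μ d C f u ^ 2 ∂μ + ∫ u, f u * f u - 2 * (opN μ d C f u * f u) ∂μ := by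
      have hi : Integrable (fun u => f u * f u - 2 * (opN μ d C f u * f u)) μ :=
        (integrable_mul_of_memLp_two hfm hfm).sub ((integrable_mul_of_memLp_two hNm hfm).const_mul 2)
      rw [← integral_add hNm.integrable_sq hi]
      congr 1
      ext u
      ring
    rw [one_mul, hadd]
    linarith
  · intro f hf
    obtain ⟨M, hC, hM, -⟩ := exists_block hblock hf hf
    -- `G` and `G₁` may come from different approximating sequences. They are compared through the
    -- weak partial derivatives of the potential, which both determine.
    have hcoord : ∀ i, (fun u => ⟪G₁ u, d i⟫) =ᵐ[μ]
        fun u => lam i ^ (1 / 2 : ℝ) * weakPartial d lam α G i u := fun i => by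
      have := (hG₁.isWeakDeriv_coord hμ i).ae_eq_sum (hG₁.2.1.inner_const _)
        (memLp_weakPartial hG.2.1) fun j F hF => hG.integral_weakPartial_mul hμ j hF
      simpa using this
    filter_upwards [ae_all_iff.2 hcoord] with u hu
    rw [opN_sub_opNPhi hC hf hM, hFsum hf hC hM, inner_sum]
    refine Finset.sum_congr rfl fun j _ => ?_
    have hj : lam j ^ (-(1 / 2) : ℝ) * lam j ^ (1 / 2 : ℝ) = 1 := by
      rw [← Real.rpow_add (hμ.pos j), neg_add_cancel, Real.rpow_zero]
    rw [real_inner_smul_right, hu j]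
    linear_combination (-weakPartial d lam α G j u * flux C d f j u) * hj
  · intro f hf g hg u
    obtain ⟨M, hC, hfM, hgM⟩ := exists_block hblock hf hg
    have hx := gradient_mem_firstSpan hf hfM u
    have hy := gradient_mem_firstSpan hg hgM u
    refine ext_inner_basis (d := d) fun i => ?_
    rw [gradient_sub hf hg, hC.pval_sub hx hy, inner_sub_left,
      inner_diagPow lam _ (Submodule.sub_mem _ (hC.pval_mem hx) (hC.pval_mem hy)),
      inner_diagPow lam _ (hC.pval_mem hx), inner_diagPow lam _ (hC.pval_mem hy), inner_sub_left]
    ring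
  · intro f h h' hh hh'
    refine hh.ae_eq_of_coord hμ hh' (w := d) (fun x hx => ext_inner_basis (d := d) fun i => ?_)
      fun i => ?_
    · rw [hx, inner_zero_left]
    · obtain ⟨M, hM, hC⟩ := hblock (i + 1)
      refine ⟨M, fun j => lam i ^ (-(1 / 2) : ℝ) * c j i, fun F hF' u => ?_⟩
      obtain ⟨M', hC', hM', -⟩ := exists_block hblock hF' hF'
      simp_rw [mul_assoc]
      rw [hF hF' hC' hM', hC.flux_eq_sum hblock hF' hM, Finset.mul_sum]

/-- The form identity `∫ ‖S Df‖² = -∫ f N f` and `-4 l f N f ≤ (l f - N f)²` give the relative bound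
`(4 l)⁻¹`. It can be made small, so any finite bound on the gradient suffices. -/
theorem bounded_coefficient_perturbation {B S : U →L[ℝ] U} (hB : ∀ x : C.domain, B x = C x)
    (hS : S.IsPositive) (hSB : S ∘L S = B) (hinj : ∀ x, S x = 0 → x = 0)
    (hG₁ : IsSobolevGradient μ d S φ G₁) (hfin : eLpNorm G₁ ⊤ μ < ⊤) :
    DomainInclusion d S G₁ N NΦ ∧
      IsEssentiallySelfAdjoint NΦ ∧ ∀ l : ℝ, 0 < l → ∃ R, IsResolventAt NΦ.closure l R := by
  have := hμ.isProbabilityMeasure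
  have hSS : ∀ x y, ⟪S x, S y⟫ = ⟪B x, y⟫ := fun x y => by
    rw [← hSB]
    exact (hS.1 (S x) y).symm
  have hBC : ∀ {M}, IsBlockOperator C d c M → ∀ x ∈ firstSpan d M, B x = pval C x :=
    fun hC x hx => by rw [pval_of_mem (hC.mem x hx), ← hB]
  have hSf : ∀ {f} (_ : f ∈ cylinder d) i u, ⟪S (gradient f u), S (d i)⟫ = flux C d f i u := by
    intro f hf i u
    obtain ⟨M, hC, hM, -⟩ := exists_block hblock hf hf
    rw [hSS, hBC hC _ (gradient_mem_firstSpan hf hM u), flux]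
  set γ := (eLpNorm G₁ ⊤ μ).toReal
  have hl : 0 < γ ^ 2 + 1 := by positivity
  -- With `l = γ² + 1` and `β = (4 l)⁻¹`, the product `γ² β` is below one.
  refine perturbation hμ hblock hν (isDriftOperator_opNPhi hμ) hN hNΦ
    (ae_norm_le_eLpNorm_top hfin) ?_ (l := γ ^ 2 + 1) (β := (4 * (γ ^ 2 + 1))⁻¹) ?_ ?_ hG₁.2.1 hl
    ?_ ?_ ?_
  · intro f hf
    obtain ⟨M, hC, hM, -⟩ := exists_block hblock hf hf
    have e : gradient f = fun u => ∑ i ∈ Finset.range M, pd d i f u • d i :=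
      funext fun u => gradient_eq_sum (differentiable_of_mem_cylinder hf) hM u
    refine S.comp_memLp' ?_
    rw [e]
    exact memLp_sum_smul_basis fun i => memLp_of_mem_cylinder (pd_mem_cylinder hf i) 2
  · intro f hf
    obtain ⟨M, hC, hM, -⟩ := exists_block hblock hf hf
    have e : ∫ u, ‖S (gradient f u)‖ ^ 2 ∂μ = -∫ u, opN μ d C f u * f u ∂μ := by
      rw [integral_drift_mul hμ hblock (isWeight_one hμ) (isDriftOperator_opN hμ) hf hf, integral_neg,
        neg_neg]
      congr 1
      ext u
      rw [← real_inner_self_eq_norm_sq, hSS, hBC hC _ (gradient_mem_firstSpan hf hM u)]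
    have hfm : MemLp f 2 μ := memLp_of_mem_cylinder hf 2
    have hNm := (hN.1 f hf).2
    rw [e, ← integral_neg, ← integral_const_mul]
    refine integral_mono (integrable_mul_of_memLp_two hNm hfm).fun_neg
      (((hfm.const_mul _).sub hNm).integrable_sq.const_mul _) fun u => ?_
    simp only [inv_mul_eq_div]
    rw [le_div_iff₀ (by positivity)]
    nlinarith [sq_nonneg ((γ ^ 2 + 1) * f u + opN μ d C f u)]
  · intro f hf
    obtain ⟨M, hC, hM, -⟩ := exists_block hblock hf hf
    -- Testing against `S (d i)` gives `⟪S Df, S (d i)⟫ = (C Df)_i`, a finite combination of partial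
    -- derivatives; a component along `d i` itself need not be one, as `S` need not preserve finite
    -- spans a priori.
    have hcoord : ∀ i : Fin M, (fun u => ⟪G₁ u, S (d i)⟫) =ᵐ[μ]
        fun u => ∑ j ∈ Finset.range M, c j i * weakPartial d lam α G j u := fun i =>
      IsWeakDeriv.ae_eq_sum (hG₁.isWeakDeriv hμ (a := fun j => c j i) fun F hF u => by
        rw [hSf hF, hC.flux_eq_sum hblock hF i.2]) (hG₁.2.1.inner_const _)
        (memLp_weakPartial hG.2.1) fun j F hF => hG.integral_weakPartial_mul hμ j hF
    filter_upwards [ae_all_iff.2 hcoord] with u hu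
    rw [opN_sub_opNPhi hC hf hM, gradient_eq_sum (differentiable_of_mem_cylinder hf) hM, map_sum,
      inner_sum]
    have h1 : ∀ i ∈ Finset.range M, ⟪G₁ u, S (pd d i f u • d i)⟫ =
        ∑ j ∈ Finset.range M, weakPartial d lam α G j u * (c i j * pd d i f u) := fun i hi => by
      rw [map_smul, real_inner_smul_right, hu ⟨i, Finset.mem_range.1 hi⟩, Finset.mul_sum]
      refine Finset.sum_congr rfl fun j hj => ?_
      rw [hC.symm (Finset.mem_range.1 hj) (Finset.mem_range.1 hi)]
      ring
    rw [Finset.sum_congr rfl h1, Finset.sum_comm]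
    refine Finset.sum_congr rfl fun j hj => ?_
    rw [hC.flux_eq hf hM (Finset.mem_range.1 hj), Finset.mul_sum]
  · rw [← div_eq_mul_inv, div_lt_one (by positivity)]
    nlinarith [sq_nonneg γ]
  · intro f hf g hg u
    rw [gradient_sub hf hg, map_sub]
  · intro f h h' hh hh'
    refine hh.ae_eq_of_coord hμ hh' (w := fun i => S (d i)) (fun x hx => hinj x ?_) fun i => ?_
    -- Orthogonality to all `S (d i)` means `S x = 0`, since `S` is symmetric; injectivity of `S`
    -- then makes this family separating.
    · refine ext_inner_basis (d := d) fun i => ?_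
      rw [inner_zero_left, ← hx i]
      exact hS.1 x (d i)
    · obtain ⟨M, hM, hC⟩ := hblock (i + 1)
      exact ⟨M, fun j => c j i, fun F hF u => by rw [hSf hF, hC.flux_eq_sum hblock hF hM]⟩

end Perturbation

end OUPerturbation

end

/-! ### The theorem -/

theorem mainTheorem8
    {U V : Type*}
    [NormedAddCommGroup U] [InnerProductSpace ℝ U] [CompleteSpace U] [SecondCountableTopology U]
    [MeasurableSpace U] [BorelSpace U]
    [NormedAddCommGroup V] [InnerProductSpace ℝ V] [CompleteSpace V] [SecondCountableTopology V]
    [MeasurableSpace V] [BorelSpace V]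
    (μ₁ : Measure U) (d : HilbertBasis ℕ ℝ U) (lam₁ : ℕ → ℝ)
    (hμ₁ : OUPerturbation.IsNondegenerateGaussian μ₁ d lam₁)
    (μ₂ : Measure V) (e : HilbertBasis ℕ ℝ V) (lam₂ : ℕ → ℝ)
    (hμ₂ : OUPerturbation.IsNondegenerateGaussian μ₂ e lam₂)
    (K₁₂ : U →L[ℝ] V) (m : ℕ → ℕ)
    (hK : OUPerturbation.IsBlockInvariant K₁₂ d e m)
    (hKpos : ∀ u : U, u ≠ 0 → 0 < ⟪ContinuousLinearMap.adjoint K₁₂ (K₁₂ u), u⟫)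
    (Φ : U → EReal) (hΦm : Measurable Φ) (hΦb : ∃ c : ℝ, ∀ u, (c : EReal) ≤ Φ u)
    (α : ℝ) (hα : 0 ≤ α) (G : U → U)
    (hG : OUPerturbation.IsPotentialGradient μ₁ d (OUPerturbation.diagPow d lam₁ α) Φ G) :
    let C : U →ₗ.[ℝ] U := OUPerturbation.opC μ₂ K₁₂
    let μΦ : Measure U := OUPerturbation.gibbs μ₁ Φ
    -- the cylinder operators `N` on `L²(μ₁)` and `N^Φ` on `L²(μ₁^Φ)` are well defined, with
    ∃ (N : Lp ℝ 2 μ₁ →ₗ.[ℝ] Lp ℝ 2 μ₁) (NΦ : Lp ℝ 2 μΦ →ₗ.[ℝ] Lp ℝ 2 μΦ),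
      OUPerturbation.IsRealization μ₁ d (OUPerturbation.opN μ₁ d C) N ∧ N.IsClosable ∧
      OUPerturbation.IsRealization μΦ d (OUPerturbation.opNPhi μ₁ d lam₁ C α G) NΦ ∧
      -- the integration by parts formula
      (∀ f ∈ OUPerturbation.cylinder d, ∀ g ∈ OUPerturbation.cylinder d,
        Integrable (fun u => ⟪OUPerturbation.pval C (gradient f u), gradient g u⟫) μΦ ∧
        ∫ u, OUPerturbation.opNPhi μ₁ d lam₁ C α G f u * g u ∂μΦ =
          ∫ u, -⟪OUPerturbation.pval C (gradient f u), gradient g u⟫ ∂μΦ) ∧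
      -- the case of a small gradient `Q₁ ^ (1 / 2) DΦ`
      (∀ G₁ : U → U,
        OUPerturbation.IsPotentialGradient μ₁ d (OUPerturbation.diagPow d lam₁ (1 / 2)) Φ G₁ →
        eLpNorm G₁ ⊤ μ₁ < 1 / 2 →
        OUPerturbation.DomainInclusion d
          (fun x => OUPerturbation.diagPow d lam₁ (-(1 / 2)) (OUPerturbation.pval C x)) G₁ N NΦ ∧
        OUPerturbation.IsEssentiallySelfAdjoint NΦ ∧
        ∀ l : ℝ, 0 < l → ∃ R, OUPerturbation.IsResolventAt NΦ.closure l R) ∧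
      -- the case of a bounded operator `C` (with bounded extension `B` and `S = B ^ (1 / 2)`)
      (∀ (B S : U →L[ℝ] U) (G₂ : U → U),
        (∀ x : C.domain, B x = C x) → S.IsPositive → S ∘L S = B →
        OUPerturbation.IsPotentialGradient μ₁ d S Φ G₂ →
        eLpNorm G₂ ⊤ μ₁ < ⊤ →
        OUPerturbation.DomainInclusion d S G₂ N NΦ ∧
        OUPerturbation.IsEssentiallySelfAdjoint NΦ ∧
        ∀ l : ℝ, 0 < l → ∃ R, OUPerturbation.IsResolventAt NΦ.closure l R) := by
  intro C μΦ
  have hblock : ∀ n, ∃ M, n ≤ M ∧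
      OUPerturbation.IsBlockOperator C d (OUPerturbation.coeff C d) M := fun n =>
    -- Strict monotonicity gives `n ≤ m n`, so invariant blocks of arbitrarily large size exist.
    ⟨m n, hK.strictMono.le_apply, OUPerturbation.isBlockOperator_opC hμ₂ hK n⟩
  obtain ⟨b, hb⟩ := hΦb
  obtain ⟨ρ, hν⟩ := OUPerturbation.exists_isWeight_gibbs hμ₁ hΦm hb hG
  have hone := OUPerturbation.isWeight_one hμ₁
  have hopN := OUPerturbation.isDriftOperator_opN (C := C) (c := OUPerturbation.coeff C d) hμ₁
  have hopNPhi := OUPerturbation.isDriftOperator_opNPhi (C := C) (c := OUPerturbation.coeff C d)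
    (α := α) (G := G) hμ₁
  obtain ⟨N, hN⟩ := OUPerturbation.exists_isRealization hμ₁ hblock hone hopN
  obtain ⟨NΦ, hNΦ⟩ := OUPerturbation.exists_isRealization hμ₁ hblock hν hopNPhi
  have := hμ₁.isProbabilityMeasure
  refine ⟨N, NΦ, hN, OUPerturbation.isClosable_of_symmetric hN.dense_domain
    (OUPerturbation.realization_symmetric hμ₁ hblock hone hopN hN), hNΦ, fun f hf g hg =>
    ⟨OUPerturbation.integrable_inner_gradient hμ₁ hblock hν hf hg,
      OUPerturbation.integral_drift_mul hμ₁ hblock hν hopNPhi hf hg⟩, fun G₁ hG₁ hsmall =>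
    OUPerturbation.small_gradient_perturbation hμ₁ hblock hN hNΦ hν hG.2 hG₁.2 hsmall,
    fun B S G₂ hB hS hSB hG₂ hfin =>
    OUPerturbation.bounded_coefficient_perturbation hμ₁ hblock hN hNΦ hν hG.2 hB hS hSB
      (fun x hx => OUPerturbation.injective_sqrt_opC hμ₂ hK (fun y hy => ?_) hB hSB hx) hG₂.2 hfin⟩
  -- Positive definiteness of `K₂₁ K₁₂` makes `K₁₂` injective, which gives injectivity of `S =
  -- C^{1/2}`.
  by_contra hne
  have := hKpos y hne
  rw [hy, map_zero, inner_zero_left] at this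
  exact this.false
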